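/- Let $P\subset\mathbb R^4$ be a cubical $4$-polytope, i.e. a convex $4$-polytope all of whose proper faces are combinatorial cubes. The derivative complex of its boundary complex has as its $(j-1)$-dimensional cells the pairs $(F,[e])$, where $F$ is a proper $j$-face of $P$ ($1\le j\le 3$) and $[e]$ is a class of parallel edges of $F$ (parallelism being the equivalence relation generated by being opposite in a $2$-face); $(F,[e])$ is a face of $(F',[e'])$ if $F\subseteq F'$ and $[e]\subseteq[e']$. The connected components of the derivative complex are the dual manifolds of $P$; they are closed surfaces. A dual manifold comes with its canonical immersion into the boundary of $P$, which is linear on the simplices of the barycentric subdivision and maps the barycenter of the cell $(F,[e])$ to the barycenter of $F$ (the average of its vertices); it is called embedded if this immersion is an embedding. For each integer $g>0$ there is a cubical $4$-polytope $P_g$ with the following properties. (i) $P_g$ has exactly one embedded orientable dual manifold $\mathcal M$ of genus $g$, and its $f$-vector is $f(\mathcal M)=(12g+4,\;28g+4,\;14g+2)$. (ii) There is a facet $F$ of $P_g$ that is not intersected by the image of $\mathcal M$ under its canonical immersion and that is affinely regular, i.e. $F$ is the image of the standard cube $[-1,+1]^3$ under an injective affine map. (iii) All other dual manifolds of $P_g$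 are embedded $2$-spheres. (iv) $f(P_g)=(24g+8,\;68g+12,\;66g+6,\;22g+2)$. -/

import Mathlib

open Set

noncomputable section

namespace CubicalPolytope

section Polytopes

variable {E : Type*} [NormedAddCommGroup E] [NormedSpace ℝ E]

/-- A nonempty face of the convex set `P`, i.e. the set of points of `P` at which some linear
functional is maximal (`P` itself is included). -/
def IsFace (P F : Set E) : Prop := F.Nonempty ∧ IsExposed ℝ P F

/-- The dimension of (the affine hull of) a set. -/
def dim (F : Set E) : ℕ := Module.finrank ℝ (vectorSpan ℝ F)

/-- A convex `d`-polytope: the convex hull of a nonempty finite set, of dimension `d`. -/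
def IsPolytope (d : ℕ) (P : Set E) : Prop :=
  P.Nonempty ∧ (∃ S : Set E, S.Finite ∧ P = convexHull ℝ S) ∧ dim P = d

/-- `fNum P k` is the number of `k`-dimensional faces of `P`. -/
def fNum (P : Set E) (k : ℕ) : ℕ := {F : Set E | IsFace P F ∧ dim F = k}.ncard

/-- The standard cube `[-1,+1]^k`. -/
def stdCube (k : ℕ) : Set (EuclideanSpace ℝ (Fin k)) := {x | ∀ i, -1 ≤ x i ∧ x i ≤ 1}

/-- `F` is a combinatorial `k`-cube: its poset of (nonempty) faces is isomorphic to the poset of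
(nonempty) faces of the standard `k`-cube. -/
def IsCombinatorialCube (k : ℕ) (F : Set E) : Prop :=
  Nonempty ({G : Set E // IsFace F G} ≃o
    {G : Set (EuclideanSpace ℝ (Fin k)) // IsFace (stdCube k) G})

/-- A cubical `d`-polytope: all proper faces are combinatorial cubes. -/
def IsCubicalPolytope (d : ℕ) (P : Set E) : Prop :=
  IsPolytope d P ∧ ∀ F, IsFace P F → F ≠ P → IsCombinatorialCube (dim F) F

/-- A combinatorial 3-cube `F` is affinely regular if it is the image of the standard cube
`[-1,+1]^3` under an injective affine map. -/
def IsAffinelyRegularCube (F : Set E) : Prop :=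
  ∃ f : EuclideanSpace ℝ (Fin 3) →ᵃ[ℝ] E, Function.Injective f ∧ f '' stdCube 3 = F

/-! ### The derivative complex of the boundary complex of a cubical polytope -/

/-- `e` is an edge of `F`. -/
def IsEdge (F e : Set E) : Prop := IsFace F e ∧ dim e = 1

/-- `e` and `e'` are opposite (that is, disjoint) edges of a 2-face of `F`. -/
def OppositeIn (F e e' : Set E) : Prop :=
  ∃ G, IsFace F G ∧ dim G = 2 ∧ IsEdge G e ∧ IsEdge G e' ∧ Disjoint e e'

/-- The class of all edges of `F` parallel to the edge `e`, parallelism being the equivalence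
relation generated by being opposite in a 2-face of `F`. -/
def parallelClass (F e : Set E) : Set (Set E) :=
  {e' | IsEdge F e' ∧ Relation.EqvGen (OppositeIn F) e e'}

/-- A cell `(F, [e])` of the derivative complex of the boundary complex of `P`: a proper face `F`
of `P` together with a parallel class of edges of `F`. -/
@[ext]
structure DualCell (P : Set E) where
  face : Set E
  edges : Set (Set E)
  isFace : IsFace P face
  proper : face ≠ P
  isClass : ∃ e, IsEdge face e ∧ edges = parallelClass face e

/-- The face relation between the cells of the derivative complex. -/
instance (P : Set E) : PartialOrder (DualCell P) where
  le a b := a.face ⊆ b.face ∧ a.edges ⊆ b.edges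
  le_refl a := ⟨Subset.rfl, Subset.rfl⟩
  le_trans a b c h h' := ⟨h.1.trans h'.1, h.2.trans h'.2⟩
  le_antisymm a b h h' := DualCell.ext (h.1.antisymm h'.1) (h.2.antisymm h'.2)

/-- A dual manifold of `P`: a connected component of the derivative complex, given as the set of
its cells (two cells are in the same component if they are joined by a sequence of cells in which
consecutive ones are incident). -/
def IsDualManifold (P : Set E) (M : Set (DualCell P)) : Prop :=
  ∃ c : DualCell P, M = {c' | Relation.EqvGen (· ≤ ·) c c'}

/-- The number of `k`-dimensional cells of `M`; the cell `(F, [e])` has dimension `dim F - 1`. -/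
def dualFNum {P : Set E} (M : Set (DualCell P)) (k : ℕ) : ℕ :=
  {c | c ∈ M ∧ dim c.face = k + 1}.ncard

/-- The geometric realization of the cell complex `M`, as the realization (in barycentric
coordinates) of its barycentric subdivision: the vertices are the cells of `M`, the simplices are
the chains of cells. -/
def realization {P : Set E} (M : Set (DualCell P)) : Set (DualCell P → ℝ) :=
  {w | (∀ c, 0 ≤ w c) ∧ (Function.support w).Finite ∧ Function.support w ⊆ M ∧
    IsChain (· ≤ ·) (Function.support w) ∧ ∑ᶠ c, w c = 1}

/-- The barycenter of a polytope: the average of its vertices. -/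
def barycenter (F : Set E) : E :=
  ((F.extremePoints ℝ).ncard : ℝ)⁻¹ • ∑ᶠ (v) (_ : v ∈ F.extremePoints ℝ), v

/-- The canonical immersion of a dual manifold into the boundary of `P`: it is linear on the
simplices of the barycentric subdivision and maps the barycenter of the cell `(F, [e])` to the
barycenter of `F`. -/
def canonicalMap {P : Set E} (M : Set (DualCell P)) (w : realization M) : E :=
  ∑ᶠ c, (w : DualCell P → ℝ) c • barycenter c.face

/-- The canonical immersion of `M` is an embedding. -/
def IsEmbeddedDual {P : Set E} (M : Set (DualCell P)) : Prop :=
  Topology.IsEmbedding (canonicalMap M)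

end Polytopes

/-! ### Surfaces -/

/-- A closed surface: a compact connected 2-manifold without boundary. -/
def IsClosedSurface (X : Type*) [TopologicalSpace X] : Prop :=
  T2Space X ∧ CompactSpace X ∧ ConnectedSpace X ∧
    ∀ x : X, ∃ U : Set X, IsOpen U ∧ x ∈ U ∧ Nonempty (U ≃ₜ EuclideanSpace ℝ (Fin 2))

/-- `X` is a (topological) 2-sphere. -/
def IsTwoSphere (X : Type*) [TopologicalSpace X] : Prop :=
  Nonempty (X ≃ₜ Metric.sphere (0 : EuclideanSpace ℝ (Fin 3)) 1)

variable {E : Type*} [NormedAddCommGroup E] [NormedSpace ℝ E] {P : Set E}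

/-- `a < b < c` span a triangle of the barycentric subdivision of the 2-dimensional complex `M`. -/
def IsTriangle (M : Set (DualCell P)) (a b c : DualCell P) : Prop :=
  a ∈ M ∧ b ∈ M ∧ c ∈ M ∧ a < b ∧ b < c

/-- The 2-dimensional complex `M` is orientable: the triangles of its barycentric subdivision can
be oriented coherently. The sign `o a b c` compares the chosen orientation of the triangle with
the one given by the order `a < b < c`. Two triangles with a common edge differ in one vertex
only, which has the same position in both, so their orientations are coherent (they induce
opposite orientations on the common edge) if and only if the signs are opposite. -/
def IsOrientable (M : Set (DualCell P)) : Prop :=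
  ∃ o : DualCell P → DualCell P → DualCell P → ℤˣ,
    (∀ a a' b c, IsTriangle M a b c → IsTriangle M a' b c → a ≠ a' → o a' b c = -o a b c) ∧
    (∀ a b b' c, IsTriangle M a b c → IsTriangle M a b' c → b ≠ b' → o a b' c = -o a b c) ∧
    (∀ a b c c', IsTriangle M a b c → IsTriangle M a b c' → c ≠ c' → o a b c' = -o a b c)

/-- The Euler characteristic of the 2-dimensional cell complex `M`. -/
def eulerChar (M : Set (DualCell P)) : ℤ :=
  (dualFNum M 0 : ℤ) - (dualFNum M 1 : ℤ) + (dualFNum M 2 : ℤ)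

/-- `M` is an orientable closed (connected) surface of genus `g`, the genus of an orientable
surface being defined by `χ = 2 - 2g`. -/
def IsOrientableSurfaceOfGenus (g : ℕ) (M : Set (DualCell P)) : Prop :=
  IsClosedSurface (realization M) ∧ IsOrientable M ∧ eulerChar M = 2 - 2 * (g : ℤ)

end CubicalPolytope

end

/-! For `g = 1` take the polytope `|xᵢ| ≤ 2`, `|xᵢ| + |xⱼ| ≤ 3` (`i = 0, 1`, `j = 2, 3`). It is the
union of the boxes with half-lengths `t, t, 3 - t, 3 - t` for `1 ≤ t ≤ 2`, and its vertices are
those of the two extreme boxes: 32 points labelled by the vertices of the 5-cube, the last sign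
telling which box. Its boundary complex is a subcomplex of the 5-cube, so faces are sign vectors and
parallel classes of edges are coordinate directions. Direction `4` gives a torus, the other
directions give spheres.

For general `g`, projective copies are stacked along the disjoint facets `botW` and `topW`. Copy `k`
is the image under `boost (9 ^ k)`, a one-parameter group of linear maps in homogeneous coordinates,
and consecutive copies share a wall up to the reflection `flip` (`boost_hvert_wall`). Directions
`1`, `3`, `4` occur in the wall and continue through it; directions `0` and `2` do not and close up
inside each copy. The direction `4` surface has a single 2-cell in each wall, which the gluing
removes, so the `g` tori form a connected sum.

Two facts make the stack a convex polytope with the expected faces. By `fac_boost_spec` every vertex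
of every copy satisfies every outer facet inequality, with equality exactly under the combinatorial
incidence `Inc`. By `exists_piece` every solution of the inequalities lies in some copy. Hence the
tight sets, and with them the face lattice (`exists_code_of_mem`, `isFace_ne_iff`, `Fc_eq_iff`), are
read off from pairs of a copy and a sign vector, and all counts become finite checks: one
contribution per copy, plus one for the two ends.

The topology comes from hyperplane sections. The faces of a 4-polytope met by a hyperplane through
its interior form a complex realizing a 2-sphere (`sectionFaces_sphere`). For a direction other than
`4` a coordinate hyperplane cuts exactly the faces of the component (`isTwoSphere_comp`). For
direction `4` this works only near a given cell, with a hyperplane separating two opposite sides of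
its face (`exists_star_congr`); this gives a closed surface, whose Euler characteristic is counted
and whose orientation is written down explicitly (`isOrientable_comp`). Inside one component a cell
is determined by its face and the order is inclusion of faces (`comp_le_iff_face`), so the
realization is a subcomplex of the barycentric subdivision of the boundary; `barycentric_injective`
then gives the embeddings. Only the direction `4` component has Euler characteristic `2 - 2g` rather
than `2`, whence uniqueness. -/

namespace CubicalPolytope

/-! ### Faces of polyhedra given by finitely many inequalities -/

section HPolyhedra

variable {E : Type*} [NormedAddCommGroup E] [NormedSpace ℝ E]
variable {κ : Type*}

/-- The polyhedron given by the inequalities `ℓ j x ≤ 0`. -/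
def poly (ℓ : κ → E →ᵃ[ℝ] ℝ) : Set E := {x | ∀ j, ℓ j x ≤ 0}

/-- The inequalities that are tight at `x`. -/
def tight (ℓ : κ → E →ᵃ[ℝ] ℝ) (x : E) : Set κ := {j | ℓ j x = 0}

@[simp] lemma mem_tight {ℓ : κ → E →ᵃ[ℝ] ℝ} {x : E} {j : κ} : j ∈ tight ℓ x ↔ ℓ j x = 0 := Iff.rfl

/-- The points of the polyhedron at which the inequalities in `T` are tight. -/
def strat (ℓ : κ → E →ᵃ[ℝ] ℝ) (T : Set κ) : Set E := {x | x ∈ poly ℓ ∧ T ⊆ tight ℓ x}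

lemma affine_combo (f : E →ᵃ[ℝ] ℝ) {a b : ℝ} (h : a + b = 1) (x y : E) :
    f (a • x + b • y) = a * f x + b * f y := by
  simpa using Convex.combo_affine_apply (f := f) (x := x) (y := y) h

lemma affine_extend (f : E →ᵃ[ℝ] ℝ) (e : ℝ) (x y : E) :
    f ((1 + e) • x - e • y) = f x + e * (f x - f y) := by
  have := affine_combo f (a := 1 + e) (b := -e) (by ring) x y
  rw [neg_smul, ← sub_eq_add_neg] at this
  rw [this]; ring

lemma affine_linear_sub (f : E →ᵃ[ℝ] ℝ) (x y : E) : f.linear (x - y) = f x - f y := by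
  simpa using f.linearMap_vsub x y

lemma affine_sum_vec {ι E F : Type*} [AddCommGroup E] [Module ℝ E] [AddCommGroup F] [Module ℝ F]
    (s : Finset ι) (f : E →ᵃ[ℝ] F) (w : ι → ℝ) (x : ι → E) (h : ∑ i ∈ s, w i = 1) :
    f (∑ i ∈ s, w i • x i) = ∑ i ∈ s, w i • f (x i) := by
  have key : ∀ y, f y = f.linear y + f 0 := fun y => by
    have := f.linearMap_vsub y 0
    simp only [vsub_eq_sub, sub_zero] at this
    rw [this, sub_add_cancel]
  rw [key, map_sum]
  simp_rw [map_smul]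
  have : ∑ i ∈ s, w i • f (x i) = ∑ i ∈ s, (w i • f.linear (x i) + w i • f 0) :=
    Finset.sum_congr rfl fun i _ => by rw [key (x i), smul_add]
  rw [this, Finset.sum_add_distrib, ← Finset.sum_smul, h, one_smul]

lemma affine_sum {ι : Type*} (s : Finset ι) (f : E →ᵃ[ℝ] ℝ) (w : ι → ℝ) (x : ι → E)
    (h : ∑ i ∈ s, w i = 1) : f (∑ i ∈ s, w i • x i) = ∑ i ∈ s, w i * f (x i) :=
  affine_sum_vec s f w x h

lemma poly_convex (ℓ : κ → E →ᵃ[ℝ] ℝ) : Convex ℝ (poly ℓ) := by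
  intro x hx y hy a b ha hb hab j
  rw [affine_combo _ hab]
  nlinarith [hx j, hy j, mul_nonneg ha (neg_nonneg.2 (hx j)), mul_nonneg hb (neg_nonneg.2 (hy j))]

lemma strat_convex (ℓ : κ → E →ᵃ[ℝ] ℝ) (T : Set κ) : Convex ℝ (strat ℓ T) := by
  intro x hx y hy a b ha hb hab
  refine ⟨poly_convex ℓ hx.1 hy.1 ha hb hab, fun j hj => ?_⟩
  have h1 : ℓ j x = 0 := hx.2 hj
  have h2 : ℓ j y = 0 := hy.2 hj
  show ℓ j _ = 0
  rw [affine_combo _ hab, h1, h2]; ring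

lemma tight_combo {ℓ : κ → E →ᵃ[ℝ] ℝ} {x y : E} (hx : x ∈ poly ℓ) (hy : y ∈ poly ℓ) {a b : ℝ}
    (ha : 0 < a) (hb : 0 < b) (hab : a + b = 1) :
    tight ℓ (a • x + b • y) = tight ℓ x ∩ tight ℓ y := by
  ext j
  have h1 := mul_nonneg ha.le (neg_nonneg.2 (hx j))
  have h2 := mul_nonneg hb.le (neg_nonneg.2 (hy j))
  simp only [tight, mem_ofPred_eq, mem_inter_iff, affine_combo _ hab]
  constructor
  · intro h
    have h3 : a * ℓ j x = 0 := by nlinarith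
    have h4 : b * ℓ j y = 0 := by nlinarith
    exact ⟨(mul_eq_zero.1 h3).resolve_left ha.ne', (mul_eq_zero.1 h4).resolve_left hb.ne'⟩
  · rintro ⟨h, h'⟩; rw [h, h']; ring

/-- Inequalities tight at `x` are tight at `y`, hence vanish along the whole line; the others are
strict at `x` and survive a small step. This is how `x` is recognized as a relative interior point
of its stratum. -/
lemma exists_extend [Finite κ] {ℓ : κ → E →ᵃ[ℝ] ℝ} {x y : E} (hx : x ∈ poly ℓ)
    (h : tight ℓ x ⊆ tight ℓ y) : ∃ e : ℝ, 0 < e ∧ (1 + e) • x - e • y ∈ poly ℓ := by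
  have : ∀ j, ∀ᶠ e : ℝ in nhdsWithin 0 (Ioi 0), ℓ j ((1 + e) • x - e • y) ≤ 0 := by
    intro j
    simp_rw [affine_extend]
    by_cases hj : ℓ j x = 0
    · have : ℓ j y = 0 := h hj
      simp [hj, this]
    · have hlt : ℓ j x < 0 := lt_of_le_of_ne (hx j) hj
      have hc : Filter.Tendsto (fun e : ℝ => ℓ j x + e * (ℓ j x - ℓ j y)) (nhds 0)
          (nhds (ℓ j x + 0 * (ℓ j x - ℓ j y))) := by
        apply Continuous.tendsto; fun_prop
      rw [zero_mul, add_zero] at hc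
      have := hc.eventually (gt_mem_nhds hlt)
      exact (this.filter_mono nhdsWithin_le_nhds).mono fun e he => he.le
  have h2 := (Filter.eventually_all.2 this).and self_mem_nhdsWithin
  obtain ⟨e, he, he0⟩ := h2.exists
  exact ⟨e, he0, he⟩

lemma mem_strat_tight {ℓ : κ → E →ᵃ[ℝ] ℝ} {x : E} (hx : x ∈ poly ℓ) : x ∈ strat ℓ (tight ℓ x) :=
  ⟨hx, Subset.rfl⟩

lemma strat_subset_iff {ℓ : κ → E →ᵃ[ℝ] ℝ} {x : E} {T : Set κ} (hx : x ∈ poly ℓ) :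
    strat ℓ (tight ℓ x) ⊆ strat ℓ T ↔ T ⊆ tight ℓ x :=
  ⟨fun h => (h (mem_strat_tight hx)).2, fun h _ hy => ⟨hy.1, h.trans hy.2⟩⟩

lemma strat_inj {ℓ : κ → E →ᵃ[ℝ] ℝ} {x y : E} (hx : x ∈ poly ℓ) (hy : y ∈ poly ℓ) :
    strat ℓ (tight ℓ x) = strat ℓ (tight ℓ y) ↔ tight ℓ x = tight ℓ y := by
  refine ⟨fun h => ?_, fun h => by rw [h]⟩
  exact Subset.antisymm ((strat_subset_iff hy).1 h.ge) ((strat_subset_iff hx).1 h.le)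

lemma strat_empty (ℓ : κ → E →ᵃ[ℝ] ℝ) : strat ℓ ∅ = poly ℓ := by
  ext x; simp [strat]

/-- The faces of a polyhedron are its strata. -/
theorem isFace_poly_iff [FiniteDimensional ℝ E] [Finite κ] {ℓ : κ → E →ᵃ[ℝ] ℝ} {F : Set E} :
    IsFace (poly ℓ) F ↔ ∃ x ∈ poly ℓ, F = strat ℓ (tight ℓ x) := by
  constructor
  · rintro ⟨hne, hex⟩
    obtain ⟨l, rfl⟩ := hex hne
    -- A point of the exposed face with fewest tight inequalities lies in its relative interior:
    -- averaging with any other point cannot lose a tight inequality.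
    obtain ⟨x, hx, hmin⟩ := (measure fun x => (tight ℓ x).ncard).wf.has_min _ hne
    have hsub : ∀ y ∈ {x ∈ poly ℓ | ∀ y ∈ poly ℓ, l y ≤ l x}, tight ℓ x ⊆ tight ℓ y := by
      intro y hy
      have hm : (1 / 2 : ℝ) • x + (1 / 2 : ℝ) • y ∈ {x ∈ poly ℓ | ∀ y ∈ poly ℓ, l y ≤ l x} := by
        refine ⟨poly_convex ℓ hx.1 hy.1 (by norm_num) (by norm_num) (by norm_num), fun z hz => ?_⟩
        simp only [map_add, map_smul, smul_eq_mul]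
        linarith [hx.2 z hz, hy.2 z hz]
      have h1 := hmin _ hm
      have ht := tight_combo hx.1 hy.1 (a := 1 / 2) (b := 1 / 2) (by norm_num) (by norm_num)
        (by norm_num)
      have h2 : ¬ (tight ℓ ((1 / 2 : ℝ) • x + (1 / 2 : ℝ) • y)).ncard < (tight ℓ x).ncard := h1
      rw [ht] at h2
      have := Set.eq_of_subset_of_ncard_le inter_subset_left (not_lt.1 h2) (toFinite _)
      rw [← this]; exact inter_subset_right
    refine ⟨x, hx.1, Subset.antisymm (fun y hy => ⟨hy.1, hsub y hy⟩) ?_⟩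
    rintro y ⟨hy, hxy⟩
    refine ⟨hy, fun z hz => (hx.2 z hz).trans ?_⟩
    -- Moving from `y` through `x` and slightly beyond stays in the polyhedron; since `l` is maximal
    -- at `x`, it cannot be smaller at `y`.
    obtain ⟨e, he, hmem⟩ := exists_extend hx.1 hxy
    have := hx.2 _ hmem
    simp only [map_sub, map_smul, smul_eq_mul] at this
    nlinarith
  · rintro ⟨x, hx, rfl⟩
    refine ⟨⟨x, mem_strat_tight hx⟩, fun _ => ?_⟩
    classical
    have := Fintype.ofFinite κ
    -- The sum of the tight inequalities is nonpositive on the polyhedron and vanishes only where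
    -- each of them does.
    refine ⟨∑ j ∈ (tight ℓ x).toFinset, LinearMap.toContinuousLinearMap (ℓ j).linear, ?_⟩
    have key : ∀ y z, (∑ j ∈ (tight ℓ x).toFinset,
        LinearMap.toContinuousLinearMap (ℓ j).linear) y ≤
        (∑ j ∈ (tight ℓ x).toFinset, LinearMap.toContinuousLinearMap (ℓ j).linear) z ↔
        ∑ j ∈ (tight ℓ x).toFinset, ℓ j y ≤ ∑ j ∈ (tight ℓ x).toFinset, ℓ j z := by
      intro y z
      rw [← sub_nonneg, ← map_sub, ← sub_nonneg (b := ∑ j ∈ (tight ℓ x).toFinset, ℓ j y),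
        ← Finset.sum_sub_distrib, sum_apply]
      simp only [LinearMap.coe_toContinuousLinearMap', affine_linear_sub]
    ext y
    constructor
    · rintro ⟨hy, hxy⟩
      refine ⟨hy, fun z hz => (key _ _).2 ?_⟩
      rw [Finset.sum_eq_zero (s := (tight ℓ x).toFinset) (f := fun j => ℓ j y)
        fun j hj => hxy (by simpa using hj)]
      exact Finset.sum_nonpos fun j _ => hz j
    · rintro ⟨hy, hmax⟩
      refine ⟨hy, ?_⟩
      have h := (key _ _).1 (hmax x hx)
      rw [Finset.sum_eq_zero (s := (tight ℓ x).toFinset) (f := fun j => ℓ j x)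
        fun j hj => mem_tight.1 (mem_toFinset.1 hj)] at h
      have h0 := (Finset.sum_eq_zero_iff_of_nonpos fun j _ => hy j).1
        (le_antisymm (Finset.sum_nonpos fun j _ => hy j) h)
      exact fun j hj => h0 j (by simpa using hj)

/-- The faces of a face are the faces contained in it. -/
theorem isFace_face_iff [FiniteDimensional ℝ E] [Finite κ] {ℓ : κ → E →ᵃ[ℝ] ℝ} {F G : Set E}
    (hF : IsFace (poly ℓ) F) : IsFace F G ↔ IsFace (poly ℓ) G ∧ G ⊆ F := by
  obtain ⟨x, hx, rfl⟩ := isFace_poly_iff.1 hF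
  -- The face is itself a polyhedron: the tight inequalities are added with the opposite sign.
  set ℓ' : κ ⊕ tight ℓ x → E →ᵃ[ℝ] ℝ := Sum.elim ℓ (fun j => -ℓ j) with hl
  have hp : strat ℓ (tight ℓ x) = poly ℓ' := by
    ext y
    constructor
    · rintro ⟨hy, hxy⟩ (j | j)
      · exact hy j
      · have : ℓ j y = 0 := hxy j.2
        simp [hl, this]
    · intro hy
      have h1 : y ∈ poly ℓ := fun j => hy (Sum.inl j)
      refine ⟨h1, fun j hj => le_antisymm (h1 j) ?_⟩
      have := hy (Sum.inr ⟨j, hj⟩)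
      simpa [hl] using this
  have key : ∀ y ∈ strat ℓ (tight ℓ x), strat ℓ' (tight ℓ' y) = strat ℓ (tight ℓ y) := by
    intro y hy
    ext z
    constructor
    · rintro ⟨hz, hyz⟩
      rw [← hp] at hz
      refine ⟨hz.1, fun j hj => ?_⟩
      have : Sum.inl j ∈ tight ℓ' z := hyz (show Sum.inl j ∈ tight ℓ' y from hj)
      exact this
    · rintro ⟨hz, hyz⟩
      have hz' : z ∈ strat ℓ (tight ℓ x) := ⟨hz, hy.2.trans hyz⟩
      refine ⟨hp ▸ hz', ?_⟩
      rintro (j | j) hj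
      · exact hyz hj
      · have : ℓ j z = 0 := hz'.2 j.2
        show ℓ' _ z = 0
        simp [hl, this]
  rw [hp, isFace_poly_iff, ← hp, isFace_poly_iff]
  constructor
  · rintro ⟨y, hy, rfl⟩
    rw [key y hy]
    exact ⟨⟨y, hy.1, rfl⟩, (strat_subset_iff hy.1).2 hy.2⟩
  · rintro ⟨⟨y, hy, rfl⟩, hsub⟩
    have hy' := hsub (mem_strat_tight hy)
    exact ⟨y, hy', (key y hy').symm⟩

/-- A proper face has smaller dimension. -/
theorem dim_lt_of_ssubset [FiniteDimensional ℝ E] {ℓ : κ → E →ᵃ[ℝ] ℝ} {x y : E}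
    (hx : x ∈ poly ℓ) (h : tight ℓ x ⊂ tight ℓ y) (hy : y ∈ poly ℓ) :
    dim (strat ℓ (tight ℓ y)) < dim (strat ℓ (tight ℓ x)) := by
  obtain ⟨j, hj, hjx⟩ := exists_of_ssubset h
  apply Submodule.finrank_lt_finrank_of_lt
  rw [SetLike.lt_iff_le_and_exists]
  have hsub : strat ℓ (tight ℓ y) ⊆ strat ℓ (tight ℓ x) := (strat_subset_iff hy).2 h.1
  refine ⟨vectorSpan_mono ℝ hsub, x - y,
    vsub_mem_vectorSpan ℝ (mem_strat_tight hx) (hsub (mem_strat_tight hy)), fun hmem => ?_⟩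
  have hle : vectorSpan ℝ (strat ℓ (tight ℓ y)) ≤ LinearMap.ker (ℓ j).linear := by
    rw [vectorSpan, Submodule.span_le]
    rintro _ ⟨a, ha, b, hb, rfl⟩
    have h1 : ℓ j a = 0 := ha.2 hj
    have h2 : ℓ j b = 0 := hb.2 hj
    simp [affine_linear_sub, h1, h2]
  have := hle hmem
  rw [LinearMap.mem_ker, affine_linear_sub] at this
  have h1 : ℓ j y = 0 := hj
  exact hjx (show ℓ j x = 0 by linarith)

lemma continuous_affine [FiniteDimensional ℝ E] (f : E →ᵃ[ℝ] ℝ) : Continuous f :=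
  f.continuous_of_finiteDimensional

lemma strat_closed [FiniteDimensional ℝ E] (ℓ : κ → E →ᵃ[ℝ] ℝ) (T : Set κ) :
    IsClosed (strat ℓ T) := by
  have : strat ℓ T = (⋂ j, {x | ℓ j x ≤ 0}) ∩ ⋂ j ∈ T, {x | ℓ j x = 0} := by
    ext x; simp [strat, poly, tight, subset_def]
  rw [this]
  exact (isClosed_iInter fun j => isClosed_le (continuous_affine _) continuous_const).inter
    (isClosed_biInter fun j _ => isClosed_eq (continuous_affine _) continuous_const)

/-- The barycenter of a face is in its relative interior. -/
theorem tight_barycenter [FiniteDimensional ℝ E] {ℓ : κ → E →ᵃ[ℝ] ℝ} {x : E} {A : Set E}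
    (hx : x ∈ poly ℓ) (hA : A.Finite) (hconv : strat ℓ (tight ℓ x) = convexHull ℝ A) :
    barycenter (strat ℓ (tight ℓ x)) ∈ poly ℓ ∧
      tight ℓ (barycenter (strat ℓ (tight ℓ x))) = tight ℓ x := by
  set F := strat ℓ (tight ℓ x) with hF
  set V := F.extremePoints ℝ with hV
  have hVA : V ⊆ A := by rw [hV, hconv]; exact extremePoints_convexHull_subset
  have hVfin : V.Finite := hA.subset hVA
  have hFV : F = convexHull ℝ V := by
    -- Krein–Milman: the face is the hull of its vertices, so an inequality vanishing at all of them
    -- vanishes on the whole face.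
    have hc : IsCompact F := by rw [hconv]; exact hA.isCompact_convexHull ℝ
    have := closure_convexHull_extremePoints hc (strat_convex _ _)
    rw [(hVfin.isClosed_convexHull ℝ).closure_eq] at this; exact this.symm
  have hxF : x ∈ F := mem_strat_tight hx
  have hVne : V.Nonempty := by
    rw [hFV] at hxF
    exact convexHull_nonempty_iff.1 ⟨x, hxF⟩
  have hbF : barycenter F = ∑ v ∈ hVfin.toFinset, ((V.ncard : ℝ)⁻¹) • v := by
    rw [barycenter, ← Finset.smul_sum, finsum_mem_eq_finite_toFinset_sum _ hVfin]
  have hcard : 0 < (V.ncard : ℝ) := by exact_mod_cast (Set.ncard_pos hVfin).2 hVne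
  have hsum : ∑ v ∈ hVfin.toFinset, (V.ncard : ℝ)⁻¹ = 1 := by
    rw [Finset.sum_const, nsmul_eq_mul, ← Set.ncard_eq_toFinset_card V hVfin]
    exact mul_inv_cancel₀ hcard.ne'
  have hval : ∀ f : E →ᵃ[ℝ] ℝ, f (barycenter F) =
      ∑ v ∈ hVfin.toFinset, (V.ncard : ℝ)⁻¹ * f v := fun f => by
    rw [hbF]; exact affine_sum _ f _ _ hsum
  have hVF : V ⊆ F := extremePoints_subset
  have hnonpos : ∀ j, ∀ v ∈ hVfin.toFinset, (V.ncard : ℝ)⁻¹ * ℓ j v ≤ 0 := fun j v hv =>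
    mul_nonpos_of_nonneg_of_nonpos (by positivity) ((hVF (hVfin.mem_toFinset.1 hv)).1 j)
  refine ⟨fun j => ?_, ?_⟩
  · rw [hval]; exact Finset.sum_nonpos (hnonpos j)
  · ext j
    simp only [tight, mem_ofPred_eq, hval]
    rw [Finset.sum_eq_zero_iff_of_nonpos (hnonpos j)]
    constructor
    · intro h
      have hVj : V ⊆ {y | ℓ j y = 0} := fun v hv => by
        have := h v (hVfin.mem_toFinset.2 hv)
        simpa [hcard.ne'] using this
      have hcv : Convex ℝ {y | ℓ j y = 0} := by
        intro a ha b hb s t hs ht hst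
        simp only [mem_ofPred_eq] at *
        rw [affine_combo _ hst, ha, hb]; ring
      have := convexHull_min hVj hcv
      rw [← hFV] at this
      exact this hxF
    · intro h v hv
      have : ℓ j v = 0 := (hVF (hVfin.mem_toFinset.1 hv)).2 h
      rw [this, mul_zero]

end HPolyhedra

/-! ### Realizations of order complexes and their open stars -/

section OrderComplex

/-- The realization of the order complex of the set `S` in a partial order. -/
def ordReal {α : Type*} [PartialOrder α] (S : Set α) : Set (α → ℝ) :=
  {w | (∀ c, 0 ≤ w c) ∧ (Function.support w).Finite ∧ Function.support w ⊆ S ∧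
    IsChain (· ≤ ·) (Function.support w) ∧ ∑ᶠ c, w c = 1}

variable {α β : Type*} [PartialOrder α] [PartialOrder β]

lemma mem_ordReal [Fintype α] {S : Set α} {w : α → ℝ} :
    w ∈ ordReal S ↔ (∀ c, 0 ≤ w c) ∧ (∀ c, w c ≠ 0 → c ∈ S) ∧
      (∀ a b, w a ≠ 0 → w b ≠ 0 → a ≤ b ∨ b ≤ a) ∧ ∑ c, w c = 1 := by
  unfold ordReal
  constructor
  · rintro ⟨h1, -, h2, h3, h4⟩
    refine ⟨h1, fun c hc => h2 hc, fun a b ha hb => h3.total ha hb, ?_⟩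
    rwa [finsum_eq_sum_of_fintype] at h4
  · rintro ⟨h1, h2, h3, h4⟩
    refine ⟨h1, toFinite _, fun c hc => h2 c hc, fun a ha b hb _ => h3 a b ha hb, ?_⟩
    rwa [finsum_eq_sum_of_fintype]

lemma isCompact_ordReal [Finite α] (S : Set α) : IsCompact (ordReal S) := by
  classical
  have := Fintype.ofFinite α
  -- The realization is a finite union of closed simplices, one for each chain.
  have heq : ordReal S = ⋃ C ∈ {C : Set α | C ⊆ S ∧ IsChain (· ≤ ·) C},
      ({w : α → ℝ | ∀ c, 0 ≤ w c} ∩ {w | ∀ c, c ∉ C → w c = 0} ∩ {w | ∑ c, w c = 1}) := by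
    ext w
    rw [mem_ordReal]
    simp only [mem_iUnion, exists_prop]
    constructor
    · rintro ⟨h1, h2, h3, h4⟩
      exact ⟨Function.support w, ⟨fun c hc => h2 c hc, fun a ha b hb _ => h3 a b ha hb⟩,
        ⟨h1, fun c hc => by simpa using hc⟩, h4⟩
    · rintro ⟨C, ⟨hC, hch⟩, ⟨h1, h2⟩, h4⟩
      have : ∀ c, w c ≠ 0 → c ∈ C := fun c hc => by_contra fun h => hc (h2 c h)
      exact ⟨h1, fun c hc => hC (this c hc), fun a b ha hb => hch.total (this a ha) (this b hb), h4⟩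
  have hclosed : IsClosed (ordReal S) := by
    rw [heq]
    refine (toFinite _).isClosed_biUnion fun C _ => ?_
    refine IsClosed.inter (IsClosed.inter ?_ ?_) ?_
    · simp only [ofPred_forall]
      exact isClosed_iInter fun c => isClosed_le continuous_const (continuous_apply c)
    · simp only [ofPred_forall]
      exact isClosed_iInter fun c => isClosed_iInter fun _ =>
        isClosed_eq (continuous_apply c) continuous_const
    · exact isClosed_eq (continuous_finsetSum _ fun c _ => continuous_apply c) continuous_const
  refine (isCompact_univ_pi fun _ : α => isCompact_Icc (a := (0 : ℝ)) (b := 1)).of_isClosed_subset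
    hclosed fun w hw c _ => ?_
  obtain ⟨h1, -, -, h4⟩ := mem_ordReal.1 hw
  exact ⟨h1 c, h4 ▸ Finset.single_le_sum (fun i _ => h1 i) (Finset.mem_univ c)⟩

omit [PartialOrder α] in
lemma sum_eq_sum_subtype [Fintype α] (S : Set α) [Fintype S] {f : α → ℝ}
    (h : ∀ c, f c ≠ 0 → c ∈ S) : ∑ c, f c = ∑ c : S, f c := by
  classical
  rw [← Finset.sum_subtype (S.toFinset) (fun x => by simp) f]
  refine (Finset.sum_subset (Finset.subset_univ _) fun x _ hx => ?_).symm
  by_contra h0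
  exact hx (by simpa using h x h0)

open Classical in
/-- Transport of weights along a bijection of the index sets. -/
noncomputable def pushWeights {S : Set α} {S' : Set β} (e : S ≃o S') (w : α → ℝ) : β → ℝ :=
  fun b => if h : b ∈ S' then w (e.symm ⟨b, h⟩) else 0

lemma pushWeights_apply {S : Set α} {S' : Set β} (e : S ≃o S') (w : α → ℝ) (a : S) :
    pushWeights e w (e a) = w a := by
  simp [pushWeights]

lemma pushWeights_mem [Finite α] [Finite β] {S : Set α} {S' : Set β} (e : S ≃o S') {w : α → ℝ}
    (hw : w ∈ ordReal S) : pushWeights e w ∈ ordReal S' := by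
  classical
  have := Fintype.ofFinite α
  have := Fintype.ofFinite β
  rw [mem_ordReal] at hw ⊢
  obtain ⟨h1, h2, h3, h4⟩ := hw
  have hS : ∀ c, pushWeights e w c ≠ 0 → ∃ a : S, c = e a ∧ w a ≠ 0 := by
    intro c hc
    by_cases h : c ∈ S'
    · refine ⟨e.symm ⟨c, h⟩, by simp, ?_⟩
      simpa [pushWeights, h] using hc
    · simp [pushWeights, h] at hc
  refine ⟨fun c => ?_, fun c hc => ?_, fun a b ha hb => ?_, ?_⟩
  · unfold pushWeights; split_ifs
    · exact h1 _
    · exact le_rfl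
  · obtain ⟨a, rfl, -⟩ := hS c hc; exact (e a).2
  · obtain ⟨a, rfl, ha'⟩ := hS a ha
    obtain ⟨b, rfl, hb'⟩ := hS b hb
    exact (h3 a b ha' hb').imp (fun h => e.monotone h) (fun h => e.monotone h)
  · have e1 := sum_eq_sum_subtype S' (f := pushWeights e w) fun c hc => by
      obtain ⟨a, rfl, -⟩ := hS c hc; exact (e a).2
    rw [e1, ← h4, sum_eq_sum_subtype S h2, ← e.toEquiv.sum_comp]
    exact Finset.sum_congr rfl fun a _ => pushWeights_apply e w a

lemma continuous_pushWeights {S : Set α} {S' : Set β} (e : S ≃o S') :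
    Continuous (pushWeights e) := by
  refine continuous_pi fun b => ?_
  unfold pushWeights
  split_ifs
  · exact continuous_apply _
  · exact continuous_const

lemma pushWeights_symm {S : Set α} {S' : Set β} (e : S ≃o S') {w : α → ℝ}
    (hw : ∀ c, w c ≠ 0 → c ∈ S) : pushWeights e.symm (pushWeights e w) = w := by
  funext a
  by_cases h : a ∈ S
  · have := pushWeights_apply e.symm (pushWeights e w) (e ⟨a, h⟩)
    rw [e.symm_apply_apply, pushWeights_apply e w] at this
    exact this
  · have : w a = 0 := by_contra fun h0 => h (hw a h0)
    simp [pushWeights, h, this]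

/-- Isomorphic sets have homeomorphic realizations. -/
noncomputable def ordRealCongr [Finite α] [Finite β] {S : Set α} {S' : Set β} (e : S ≃o S') :
    ordReal S ≃ₜ ordReal S' where
  toFun w := ⟨pushWeights e w, pushWeights_mem e w.2⟩
  invFun w := ⟨pushWeights e.symm w, pushWeights_mem e.symm w.2⟩
  left_inv w := Subtype.ext (pushWeights_symm e fun _ hc => w.2.2.2.1 hc)
  right_inv w := Subtype.ext (pushWeights_symm e.symm fun _ hc => w.2.2.2.1 hc)
  continuous_toFun := ((continuous_pushWeights e).comp continuous_subtype_val).subtype_mk _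
  continuous_invFun := ((continuous_pushWeights e.symm).comp continuous_subtype_val).subtype_mk _

/-- The open star of a vertex in the realization of an order complex. -/
def openStar (S : Set α) (c : α) : Set (ordReal S) := {w | 0 < (w : α → ℝ) c}

lemma isOpen_openStar (S : Set α) (c : α) : IsOpen (openStar S c) :=
  isOpen_lt continuous_const ((continuous_apply c).comp continuous_subtype_val)

/-- The elements of `S` comparable to `c`. -/
def starSet (S : Set α) (c : α) : Set α := {a ∈ S | a ≤ c ∨ c ≤ a}

/-- The open star of `c` only depends on the elements comparable to `c`. -/
def openStarEquiv [Finite α] (S : Set α) (c : α) :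
    openStar S c ≃ₜ openStar (starSet S c) c where
  toFun w := ⟨⟨w.1, by
    have := Fintype.ofFinite α
    have h := mem_ordReal.1 w.1.2
    exact mem_ordReal.2 ⟨h.1, fun a ha => ⟨h.2.1 a ha, h.2.2.1 a c ha (ne_of_gt w.2)⟩, h.2.2⟩⟩, w.2⟩
  invFun w := ⟨⟨w.1, by
    have := Fintype.ofFinite α
    have h := mem_ordReal.1 w.1.2
    exact mem_ordReal.2 ⟨h.1, fun a ha => (h.2.1 a ha).1, h.2.2⟩⟩, w.2⟩
  left_inv _ := rfl
  right_inv _ := rfl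
  continuous_toFun := by fun_prop
  continuous_invFun := by fun_prop

/-- Isomorphic stars have homeomorphic open stars. -/
lemma openStar_congr [Finite α] [Finite β] {S : Set α} {S' : Set β} {c : α} {c' : β}
    (e : starSet S c ≃o starSet S' c') (hc : c ∈ starSet S c) (hcc : e ⟨c, hc⟩ = c') :
    Nonempty (openStar S c ≃ₜ openStar S' c') := by
  refine ⟨(openStarEquiv S c).trans (Homeomorph.trans ?_ (openStarEquiv S' c').symm)⟩
  refine (ordRealCongr e).subtype fun w => ?_
  show 0 < (w : α → ℝ) c ↔ 0 < pushWeights e w c'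
  have := pushWeights_apply e w ⟨c, hc⟩
  rw [hcc] at this
  rw [this]

lemma single_mem_ordReal [Finite α] [DecidableEq α] {S : Set α} {c : α} (hc : c ∈ S) :
    Pi.single c (1 : ℝ) ∈ ordReal S := by
  have := Fintype.ofFinite α
  have h : ∀ a, (Pi.single c (1 : ℝ) : α → ℝ) a ≠ 0 → a = c := fun a ha => by
    by_contra h; simp [h] at ha
  refine mem_ordReal.2 ⟨fun a => ?_, fun a ha => (h a ha).symm ▸ hc, fun a b ha hb => ?_, by simp⟩
  · by_cases h : a = c
    · subst h; simp
    · simp [h]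
  · rw [h a ha, h b hb]; exact Or.inl le_rfl

lemma combo_mem_ordReal [Finite α] {S : Set α} {C : Set α} (hC : IsChain (· ≤ ·) C)
    {w w' : α → ℝ} (hw : w ∈ ordReal S) (hw' : w' ∈ ordReal S) (h : ∀ a, w a ≠ 0 → a ∈ C)
    (h' : ∀ a, w' a ≠ 0 → a ∈ C) {s t : ℝ} (hs : 0 ≤ s) (ht : 0 ≤ t) (hst : s + t = 1) :
    s • w + t • w' ∈ ordReal S := by
  have := Fintype.ofFinite α
  rw [mem_ordReal] at hw hw' ⊢
  have key : ∀ a, (s • w + t • w') a ≠ 0 → w a ≠ 0 ∨ w' a ≠ 0 := fun a ha => by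
    by_contra hn
    push Not at hn
    simp [hn.1, hn.2] at ha
  have kC : ∀ a, (s • w + t • w') a ≠ 0 → a ∈ C := fun a ha => (key a ha).elim (h a) (h' a)
  refine ⟨fun a => ?_, fun a ha => (key a ha).elim (hw.2.1 a) (hw'.2.1 a),
    fun a b ha hb => hC.total (kC a ha) (kC b hb), ?_⟩
  · have := hw.1 a; have := hw'.1 a
    simp only [Pi.add_apply, Pi.smul_apply, smul_eq_mul]; positivity
  · simp only [Pi.add_apply, Pi.smul_apply, smul_eq_mul, Finset.sum_add_distrib, ← Finset.mul_sum,
      hw.2.2.2, hw'.2.2.2]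
    linarith

/-- The realization of a connected partial order is path connected. -/
theorem isPathConnected_ordReal [Finite α] {S : Set α} {c : α} (hc : c ∈ S)
    (hS : ∀ a b, a ≤ b → (a ∈ S ↔ b ∈ S)) (hconn : ∀ b ∈ S, Relation.EqvGen (· ≤ ·) c b) :
    IsPathConnected (ordReal S) := by
  classical
  have := Fintype.ofFinite α
  have key : ∀ a b, Relation.EqvGen (· ≤ ·) a b → (a ∈ S ↔ b ∈ S) ∧
      (a ∈ S → JoinedIn (ordReal S) (Pi.single a 1) (Pi.single b 1)) := by
    intro a b hab
    induction hab with
    | rel a b h =>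
      refine ⟨hS a b h, fun ha => JoinedIn.of_segment_subset ?_⟩
      rintro _ ⟨s, t, hs, ht, hst, rfl⟩
      refine combo_mem_ordReal (C := {a, b}) ?_ (single_mem_ordReal ha)
        (single_mem_ordReal ((hS a b h).1 ha)) (fun x hx => ?_) (fun x hx => ?_) hs ht hst
      · exact IsChain.pair h
      · by_contra hn; simp only [mem_insert_iff, not_or] at hn; simp [hn.1] at hx
      · by_contra hn; simp only [mem_insert_iff, mem_singleton_iff, not_or] at hn; simp [hn.2] at hx
    | refl a => exact ⟨Iff.rfl, fun ha => JoinedIn.refl (single_mem_ordReal ha)⟩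
    | symm a b _ ih => exact ⟨ih.1.symm, fun hb => (ih.2 (ih.1.2 hb)).symm⟩
    | trans a b d _ _ ih1 ih2 =>
      exact ⟨ih1.1.trans ih2.1, fun ha => (ih1.2 ha).trans (ih2.2 (ih1.1.1 ha))⟩
  refine ⟨Pi.single c 1, single_mem_ordReal hc, fun {w} hw => ?_⟩
  have hw' := mem_ordReal.1 hw
  obtain ⟨a, ha⟩ : ∃ a, w a ≠ 0 := by
    by_contra hn
    push Not at hn
    simpa [hn] using hw'.2.2.2
  have haS := hw'.2.1 a ha
  refine ((key c a (hconn a haS)).2 hc).trans (JoinedIn.of_segment_subset ?_)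
  rintro _ ⟨s, t, hs, ht, hst, rfl⟩
  refine combo_mem_ordReal (C := Function.support w) hw.2.2.2.1 (single_mem_ordReal haS) hw
    (fun x hx => ?_) (fun x hx => hx) hs ht hst
  have : x = a := by by_contra h; simp [h] at hx
  exact this ▸ ha

end OrderComplex

/-! ### Spaces locally modelled on a sphere -/

section LocallyEuclidean

open TopologicalSpace

/-- The chart is restricted to the preimage of a ball, and an open ball is homeomorphic to the whole
plane. -/
lemma exists_open_homeomorph_of_chart {X : Type*} [TopologicalSpace X] {x : X}
    (e : OpenPartialHomeomorph X (EuclideanSpace ℝ (Fin 2))) (hx : x ∈ e.source) :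
    ∃ U : Set X, IsOpen U ∧ x ∈ U ∧ Nonempty (U ≃ₜ EuclideanSpace ℝ (Fin 2)) := by
  obtain ⟨r, hr, hball⟩ := Metric.isOpen_iff.1 e.open_target (e x) (e.map_source hx)
  let b := OpenPartialHomeomorph.univBall (e x) r (E := EuclideanSpace ℝ (Fin 2))
  let f := e.trans b.symm
  have hb : b.target = Metric.ball (e x) r := OpenPartialHomeomorph.univBall_target _ hr
  have ht : f.target = univ := by
    rw [OpenPartialHomeomorph.trans_target]
    ext y
    simp only [OpenPartialHomeomorph.symm_target, mem_inter_iff, mem_preimage, mem_univ, iff_true]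
    have hy : y ∈ b.source := by simp [b]
    refine ⟨hy, hball ?_⟩
    rw [← hb]
    exact b.map_source hy
  refine ⟨f.source, f.open_source, ?_, ⟨f.toHomeomorphSourceTarget.trans ?_⟩⟩
  · rw [OpenPartialHomeomorph.trans_source]
    refine ⟨hx, ?_⟩
    show e x ∈ b.target
    rw [hb]; exact Metric.mem_ball_self hr
  · exact (Homeomorph.setCongr ht).trans (Homeomorph.Set.univ _)

/-- A space covered by open sets homeomorphic to open subsets of spheres is locally Euclidean. -/
theorem exists_open_homeomorph_of_sphere {X Y : Type*} [TopologicalSpace X] [TopologicalSpace Y]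
    (hY : Nonempty (Y ≃ₜ Metric.sphere (0 : EuclideanSpace ℝ (Fin 3)) 1))
    {U : Set X} (hU : IsOpen U) {V : Set Y} (hV : IsOpen V) (h : Nonempty (U ≃ₜ V)) {x : X}
    (hx : x ∈ U) :
    ∃ U : Set X, IsOpen U ∧ x ∈ U ∧ Nonempty (U ≃ₜ EuclideanSpace ℝ (Fin 2)) := by
  obtain ⟨k⟩ := hY
  obtain ⟨h⟩ := h
  have : Fact (Module.finrank ℝ (EuclideanSpace ℝ (Fin 3)) = 2 + 1) := ⟨by simp⟩
  have hne : Nonempty U := ⟨⟨x, hx⟩⟩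
  have hemb : Topology.IsOpenEmbedding (fun u : U => k (h u)) :=
    k.isOpenEmbedding.comp (hV.isOpenEmbedding_subtypeVal.comp h.isOpenEmbedding)
  let e1 := hU.isOpenEmbedding_subtypeVal.toOpenPartialHomeomorph (Subtype.val : U → X)
  let e2 := hemb.toOpenPartialHomeomorph _
  let e := e1.symm.trans (e2.trans (chartAt (EuclideanSpace ℝ (Fin 2)) (k (h ⟨x, hx⟩))))
  have hxe : e1 ⟨x, hx⟩ = x := rfl
  have hs : e1.symm x = ⟨x, hx⟩ := by
    conv_lhs => rw [← hxe]
    exact e1.left_inv (by simp [e1])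
  refine exists_open_homeomorph_of_chart e ?_
  simp only [e, OpenPartialHomeomorph.trans_source, mem_inter_iff, mem_preimage,
    OpenPartialHomeomorph.symm_source]
  refine ⟨?_, ?_, ?_⟩
  · rw [← hxe]; exact e1.map_source (by simp [e1])
  · simp [e2]
  · show e2 (e1.symm x) ∈ _
    rw [hs]
    exact mem_chart_source _ _

end LocallyEuclidean

/-! ### Barycentric subdivision: chains of faces span simplices that fit together -/

section Barycentric

variable {E : Type*} [NormedAddCommGroup E] [NormedSpace ℝ E]
variable {κ : Type*} {α : Type*} [PartialOrder α]

omit [PartialOrder α] in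
lemma affine_sum_eq [Fintype α] (f : E →ᵃ[ℝ] ℝ) {u u' : α → ℝ} (β : α → E)
    (h1 : ∑ a, u a = ∑ a, u' a) (h2 : ∑ a, u a • β a = ∑ a, u' a • β a) :
    ∑ a, u a * f (β a) = ∑ a, u' a * f (β a) := by
  have key : ∀ y, f y = f.linear y + f 0 := fun y => by
    have := affine_linear_sub f y 0; simp at this; linarith
  have h3 : ∀ u : α → ℝ, ∑ a, u a * f (β a) = f.linear (∑ a, u a • β a) + (∑ a, u a) * f 0 := by
    intro u
    rw [map_sum, Finset.sum_mul, ← Finset.sum_add_distrib]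
    refine Finset.sum_congr rfl fun a _ => ?_
    rw [key (β a), map_smul, smul_eq_mul]; ring
  rw [h3, h3, h1, h2]

omit [PartialOrder α] in
-- An inequality tight at the top of the chain of `u` is tight on the whole chain, so it vanishes on
-- the combination. As a sum of nonpositive terms, the other expression then vanishes term by term.
lemma barycentric_max_le [Fintype α] {ℓ : κ → E →ᵃ[ℝ] ℝ} {β : α → E} {u u' : α → ℝ}
    (hβ : ∀ a, u a ≠ 0 ∨ u' a ≠ 0 → β a ∈ poly ℓ) (hu' : ∀ a, 0 ≤ u' a)
    (hval : ∀ f : E →ᵃ[ℝ] ℝ, ∑ a, u a * f (β a) = ∑ a, u' a * f (β a))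
    {m m' : α} (hm : ∀ a, u a ≠ 0 → tight ℓ (β m) ⊆ tight ℓ (β a))
    (hm' : u' m' ≠ 0) : tight ℓ (β m) ⊆ tight ℓ (β m') := by
  intro j hj
  have h0 : ∑ a, u' a * ℓ j (β a) = 0 := by
    rw [← hval]
    refine Finset.sum_eq_zero fun a _ => ?_
    by_cases ha : u a = 0
    · rw [ha, zero_mul]
    · have : ℓ j (β a) = 0 := hm a ha hj
      rw [this, mul_zero]
  have hnp : ∀ a ∈ Finset.univ, u' a * ℓ j (β a) ≤ 0 := fun a _ => by
    by_cases ha : u' a = 0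
    · rw [ha, zero_mul]
    · exact mul_nonpos_of_nonneg_of_nonpos (hu' a) (hβ a (Or.inr ha) j)
  have := (Finset.sum_eq_zero_iff_of_nonpos hnp).1 h0 m' (Finset.mem_univ _)
  exact (mul_eq_zero.1 this).resolve_left hm'

lemma exists_max_of_chain [Finite α] {u : α → ℝ}
    (hc : ∀ a b, u a ≠ 0 → u b ≠ 0 → a ≤ b ∨ b ≤ a) (hne : ∃ a, u a ≠ 0) :
    ∃ m, u m ≠ 0 ∧ ∀ a, u a ≠ 0 → a ≤ m := by
  obtain ⟨m, hm⟩ := (toFinite {a | u a ≠ 0}).exists_maximal hne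
  refine ⟨m, hm.1, fun a ha => ?_⟩
  rcases hc a m ha hm.1 with h | h
  · exact h
  · exact hm.2 ha h

/-- Chains of faces have affinely independent interior points, and the simplices they span
intersect properly. -/
lemma barycentric_unique [Fintype α] {ℓ : κ → E →ᵃ[ℝ] ℝ} {S : Set α} {β : α → E}
    (hβ : ∀ a ∈ S, β a ∈ poly ℓ)
    (hord : ∀ a ∈ S, ∀ b ∈ S, a ≤ b ↔ tight ℓ (β b) ⊆ tight ℓ (β a)) :
    ∀ (n : ℕ) (u u' : α → ℝ), (Function.support u).ncard + (Function.support u').ncard ≤ n →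
      (∀ a, 0 ≤ u a) → (∀ a, 0 ≤ u' a) → (∀ a, u a ≠ 0 → a ∈ S) → (∀ a, u' a ≠ 0 → a ∈ S) →
      (∀ a b, u a ≠ 0 → u b ≠ 0 → a ≤ b ∨ b ≤ a) →
      (∀ a b, u' a ≠ 0 → u' b ≠ 0 → a ≤ b ∨ b ≤ a) →
      ∑ a, u a = ∑ a, u' a → ∑ a, u a • β a = ∑ a, u' a • β a → u = u' := by
  classical
  intro n
  induction n using Nat.strong_induction_on with
  | _ n ih =>
  have zero_of : ∀ u u' : α → ℝ, (∀ a, 0 ≤ u' a) → ∑ a, u a = ∑ a, u' a → (∀ a, u a = 0) →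
      u = u' := by
    intro u u' hu' hs h0
    funext a
    rw [h0 a]
    rw [Finset.sum_eq_zero fun a _ => h0 a] at hs
    exact ((Finset.sum_eq_zero_iff_of_nonneg fun a _ => hu' a).1 hs.symm a (Finset.mem_univ _)).symm
  have main : ∀ u u' : α → ℝ, (Function.support u).ncard + (Function.support u').ncard ≤ n →
      (∀ a, 0 ≤ u a) → (∀ a, 0 ≤ u' a) → (∀ a, u a ≠ 0 → a ∈ S) → (∀ a, u' a ≠ 0 → a ∈ S) →
      (∀ a b, u a ≠ 0 → u b ≠ 0 → a ≤ b ∨ b ≤ a) →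
      (∀ a b, u' a ≠ 0 → u' b ≠ 0 → a ≤ b ∨ b ≤ a) →
      ∑ a, u a = ∑ a, u' a → ∑ a, u a • β a = ∑ a, u' a • β a →
      ∀ m, u m ≠ 0 → u m ≤ u' m → u = u' := by
    intro u u' hn hu hu' hS hS' hc hc' h1 h2 m hm hle
    -- The smaller of the two weights at the common maximum is subtracted from both sides. It kills
    -- a support element of `u`, so the induction on the total support size applies.
    set d : α → ℝ := Pi.single m (u m)
    have hd : ∀ a, a ≠ m → d a = 0 := fun a ha => by simp [d, ha]
    have hdm : d m = u m := by simp [d]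
    have hv : ∀ a, (u - d) a ≠ 0 → u a ≠ 0 := fun a ha => by
      by_cases h : a = m
      · subst h; exact hm
      · simpa [hd a h] using ha
    have hv' : ∀ a, (u' - d) a ≠ 0 → u' a ≠ 0 := fun a ha => by
      by_cases h : a = m
      · subst h; exact ne_of_gt (lt_of_lt_of_le (lt_of_le_of_ne (hu a) (Ne.symm hm)) hle)
      · simpa [hd a h] using ha
    have hcard : (Function.support (u - d)).ncard < (Function.support u).ncard := by
      refine Set.ncard_lt_ncard ⟨fun a ha => hv a ha, fun hsub => ?_⟩ (toFinite _)
      exact (hsub (show m ∈ Function.support u from hm)) (by simp [hdm])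
    have hcard' : (Function.support (u' - d)).ncard ≤ (Function.support u').ncard :=
      Set.ncard_le_ncard (fun a ha => hv' a ha) (toFinite _)
    have := ih _ (lt_of_lt_of_le (add_lt_add_of_lt_of_le hcard hcard') hn) (u - d) (u' - d) le_rfl
      (fun a => by
        by_cases h : a = m
        · subst h; simp [hdm]
        · simpa [hd a h] using hu a)
      (fun a => by
        by_cases h : a = m
        · subst h; simpa [hdm] using hle
        · simpa [hd a h] using hu' a)
      (fun a ha => hS a (hv a ha)) (fun a ha => hS' a (hv' a ha))
      (fun a b ha hb => hc a b (hv a ha) (hv b hb)) (fun a b ha hb => hc' a b (hv' a ha) (hv' b hb))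
      (by simp only [Pi.sub_apply, Finset.sum_sub_distrib, h1])
      (by simp only [Pi.sub_apply, sub_smul, Finset.sum_sub_distrib, h2])
    simpa using this
  intro u u' hn hu hu' hS hS' hc hc' h1 h2
  by_cases h0 : ∃ a, u a ≠ 0
  swap
  · push Not at h0; exact zero_of u u' hu' h1 h0
  by_cases h0' : ∃ a, u' a ≠ 0
  swap
  · push Not at h0'; exact (zero_of u' u hu h1.symm h0').symm
  obtain ⟨m, hm, hmax⟩ := exists_max_of_chain hc h0
  obtain ⟨m', hm', hmax'⟩ := exists_max_of_chain hc' h0'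
  have hval := fun f : E →ᵃ[ℝ] ℝ => affine_sum_eq f β h1 h2
  have hβ' : ∀ a, u a ≠ 0 ∨ u' a ≠ 0 → β a ∈ poly ℓ := fun a ha =>
    hβ a (ha.elim (hS a) (hS' a))
  have e1 : m' ≤ m := (hord _ (hS' _ hm') _ (hS _ hm)).2
    (barycentric_max_le hβ' hu' hval
      (fun a ha => (hord _ (hS a ha) _ (hS _ hm)).1 (hmax a ha)) hm')
  have e2 : m ≤ m' := (hord _ (hS _ hm) _ (hS' _ hm')).2
    (barycentric_max_le (fun a ha => hβ' a ha.symm) hu (fun f => (hval f).symm)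
      (fun a ha => (hord _ (hS' a ha) _ (hS' _ hm')).1 (hmax' a ha)) hm)
  -- The maximum of the chain is the carrier face of the common point, hence the same for both
  -- expressions.
  have e : m = m' := le_antisymm e2 e1
  rcases le_total (u m) (u' m) with h | h
  · exact main u u' hn hu hu' hS hS' hc hc' h1 h2 m hm h
  · exact (main u' u (by omega) hu' hu hS' hS hc' hc h1.symm h2.symm m (e ▸ hm') h).symm

lemma barycentric_injective [Fintype α] {ℓ : κ → E →ᵃ[ℝ] ℝ} {S : Set α} {β : α → E}
    (hβ : ∀ a ∈ S, β a ∈ poly ℓ)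
    (hord : ∀ a ∈ S, ∀ b ∈ S, a ≤ b ↔ tight ℓ (β b) ⊆ tight ℓ (β a)) {w w' : α → ℝ}
    (hw : w ∈ ordReal S) (hw' : w' ∈ ordReal S) (h : ∑ a, w a • β a = ∑ a, w' a • β a) :
    w = w' := by
  rw [mem_ordReal] at hw hw'
  exact barycentric_unique hβ hord _ w w' le_rfl hw.1 hw'.1 hw.2.1 hw'.2.1 hw.2.2.1 hw'.2.2.1
    (hw.2.2.2.trans hw'.2.2.2.symm) h

/-- The inequalities tight at a barycentric combination of a chain of faces. -/
lemma exists_tight_sum_eq [Fintype α] {ℓ : κ → E →ᵃ[ℝ] ℝ} {S : Set α} {β : α → E}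
    (hβ : ∀ a ∈ S, β a ∈ poly ℓ)
    (hord : ∀ a ∈ S, ∀ b ∈ S, a ≤ b → tight ℓ (β b) ⊆ tight ℓ (β a)) {w : α → ℝ}
    (hw : w ∈ ordReal S) :
    ∃ m, w m ≠ 0 ∧ ∑ a, w a • β a ∈ poly ℓ ∧ tight ℓ (∑ a, w a • β a) = tight ℓ (β m) := by
  obtain ⟨h1, h2, h3, h4⟩ := mem_ordReal.1 hw
  obtain ⟨m, hm, hmax⟩ := exists_max_of_chain h3 (by
    by_contra hn; push Not at hn; simp [hn] at h4)
  have hval := fun j => affine_sum Finset.univ (ℓ j) w β h4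
  have hnp : ∀ j, ∀ a ∈ Finset.univ, w a * ℓ j (β a) ≤ 0 := fun j a _ => by
    by_cases ha : w a = 0
    · rw [ha, zero_mul]
    · exact mul_nonpos_of_nonneg_of_nonpos (h1 a) (hβ a (h2 a ha) j)
  refine ⟨m, hm, fun j => ?_, ?_⟩
  · rw [hval]; exact Finset.sum_nonpos (hnp j)
  · ext j
    rw [mem_tight, hval, Finset.sum_eq_zero_iff_of_nonpos (hnp j), mem_tight]
    constructor
    · intro h
      exact (mul_eq_zero.1 (h m (Finset.mem_univ _))).resolve_left hm
    · intro h a _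
      by_cases ha : w a = 0
      · rw [ha, zero_mul]
      · have : ℓ j (β a) = 0 := hord _ (h2 a ha) _ (h2 m hm) (hmax a ha) h
        rw [this, mul_zero]

/-- A ray from a relative interior point of a face leaves the face. -/
lemma exists_ray_exit [FiniteDimensional ℝ E] [Finite κ] {ℓ : κ → E →ᵃ[ℝ] ℝ}
    (hb : Bornology.IsBounded (poly ℓ)) {b x : E} (hx : x ∈ poly ℓ)
    (hbx : tight ℓ b = tight ℓ x) (hne : x ≠ b) :
    ∃ t : ℝ, 1 ≤ t ∧ (1 - t) • b + t • x ∈ poly ℓ ∧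
      tight ℓ x ⊂ tight ℓ ((1 - t) • b + t • x) := by
  set A : Set ℝ := {t | 1 ≤ t ∧ (1 - t) • b + t • x ∈ poly ℓ} with hA
  have hsub : ∀ t : ℝ, tight ℓ x ⊆ tight ℓ ((1 - t) • b + t • x) := fun t j hj => by
    have h1 : ℓ j x = 0 := hj
    have h2 : ℓ j b = 0 := by rw [← hbx] at hj; exact hj
    rw [mem_tight, affine_combo _ (by ring), h1, h2]; ring
  have hclosed : IsClosed A := by
    have : A = Ici 1 ∩ (fun t : ℝ => (1 - t) • b + t • x) ⁻¹' (strat ℓ ∅) := by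
      rw [strat_empty]; rfl
    rw [this]
    exact isClosed_Ici.inter ((strat_closed ℓ ∅).preimage (by fun_prop))
  obtain ⟨R, hR⟩ := hb.exists_norm_le
  have hpos : 0 < ‖x - b‖ := norm_pos_iff.2 (sub_ne_zero.2 hne)
  have hbd : A ⊆ Icc 1 ((R + ‖b‖) / ‖x - b‖) := by
    rintro t ⟨ht, htp⟩
    refine ⟨ht, ?_⟩
    rw [le_div_iff₀ hpos]
    have e : t • (x - b) = ((1 - t) • b + t • x) - b := by module
    calc t * ‖x - b‖ = ‖t • (x - b)‖ := by
          rw [norm_smul, Real.norm_of_nonneg (by linarith)]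
      _ ≤ ‖(1 - t) • b + t • x‖ + ‖b‖ := by rw [e]; exact norm_sub_le _ _
      _ ≤ R + ‖b‖ := by gcongr; exact hR _ htp
  have hcomp : IsCompact A := isCompact_Icc.of_isClosed_subset hclosed hbd
  obtain ⟨t, ht, hmax⟩ := hcomp.exists_isMaxOn ⟨1, le_rfl, by simpa using hx⟩ continuousOn_id
  refine ⟨t, ht.1, ht.2, hsub t, fun hle => ?_⟩
  obtain ⟨e, he, hmem⟩ := exists_extend (x := (1 - t) • b + t • x) (y := b) ht.2 (hbx ▸ hle)
  have hA' : t + e * t ∈ A := by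
    refine ⟨by nlinarith [ht.1], ?_⟩
    convert hmem using 1
    module
  have := hmax hA'
  simp only [id, mem_ofPred_eq] at this
  nlinarith [ht.1]

/-- Radial projection from the marked point of the carrier face: the ray from `β a` through `x`
leaves the face at a point of a smaller face, which has a chain by induction, and `a` is added on
top. The hyperplane `h = 0` contains all marked points, so the ray stays in it. -/
lemma barycentric_surjective [FiniteDimensional ℝ E] [Finite κ] [Fintype α]
    {ℓ : κ → E →ᵃ[ℝ] ℝ} (hb : Bornology.IsBounded (poly ℓ)) (h : E →ᵃ[ℝ] ℝ)
    {S : Set α} {β : α → E} (hβ : ∀ a ∈ S, h (β a) = 0)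
    (hord : ∀ a ∈ S, ∀ b ∈ S, a ≤ b ↔ tight ℓ (β b) ⊆ tight ℓ (β a))
    (hcov : ∀ x ∈ poly ℓ, h x = 0 → (tight ℓ x).Nonempty → ∃ a ∈ S, tight ℓ (β a) = tight ℓ x) :
    ∀ (a : α), a ∈ S → ∀ x ∈ poly ℓ, h x = 0 → (tight ℓ x).Nonempty → tight ℓ (β a) = tight ℓ x →
      ∃ w ∈ ordReal S, (∀ c, w c ≠ 0 → c ≤ a) ∧ ∑ a, w a • β a = x := by
  classical
  intro a
  induction a using WellFoundedLT.induction with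
  | _ a ih =>
  intro ha x hx hhx hne hta
  by_cases hxa : x = β a
  · refine ⟨Pi.single a 1, single_mem_ordReal ha, fun c hc => ?_, ?_⟩
    · have : c = a := by by_contra h; simp [h] at hc
      exact this.le
    · rw [Finset.sum_eq_single a (fun c _ hc => by simp [hc]) (by simp), hxa]; simp
  · obtain ⟨t, ht1, hyp, hyt⟩ := exists_ray_exit hb hx hta hxa
    set y := (1 - t) • β a + t • x with hy
    have hhy : h y = 0 := by rw [hy, affine_combo _ (by ring), hβ a ha, hhx]; ring
    have hyne := hne.mono hyt.1
    obtain ⟨c, hc, hcy⟩ := hcov y hyp hhy hyne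
    have hca : c < a := by
      refine lt_of_le_not_ge ((hord _ hc _ ha).2 ?_) fun hle => ?_
      · rw [hta, hcy]; exact hyt.1
      · have := (hord _ ha _ hc).1 hle
        rw [hta, hcy] at this
        exact hyt.2 this
    obtain ⟨w, hw, hwc, hws⟩ := ih c hca hc y hyp hhy hyne hcy
    have ht0 : 0 < t := by linarith
    have ht' : 1 / t ≤ 1 := by rw [div_le_one ht0]; exact ht1
    refine ⟨(1 - 1 / t) • (Pi.single a 1 : α → ℝ) + (1 / t) • w,
      combo_mem_ordReal (C := insert a {c | w c ≠ 0}) ?_ (single_mem_ordReal ha) hw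
        (fun x hx => ?_) (fun x hx => Or.inr hx) (by linarith) (by positivity) (by ring), ?_, ?_⟩
    · refine IsChain.insert hw.2.2.2.1 fun b hb _ => Or.inr ((hwc b hb).trans hca.le)
    · left; by_contra h; simp [h] at hx
    · intro b hbb
      by_cases hba : b = a
      · exact hba.le
      · have : w b ≠ 0 := fun h0 => by simp [hba, h0] at hbb
        exact (hwc b this).trans hca.le
    · simp only [Pi.add_apply, Pi.smul_apply, add_smul, Finset.sum_add_distrib, smul_eq_mul,
        mul_smul, ← Finset.smul_sum, hws]
      rw [Finset.sum_eq_single a (fun c _ hc => by simp [hc]) (by simp)]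
      rw [hy, Pi.single_eq_same, one_smul, smul_add, smul_smul, smul_smul,
        one_div_mul_cancel ht0.ne', one_smul, ← add_assoc, ← add_smul]
      have : (1 - 1 / t) + 1 / t * (1 - t) = 0 := by field_simp; ring
      rw [this, zero_smul, zero_add]

end Barycentric

/-! ### Hyperplane sections of a 4-polytope are 2-spheres -/

section Sections

variable {E : Type*} [NormedAddCommGroup E] [NormedSpace ℝ E]
variable {κ : Type*}

/-- The proper faces of a convex set, ordered by inclusion. -/
abbrev ProperFace (P : Set E) : Type _ := {F : Set E // IsFace P F ∧ F ≠ P}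

lemma finite_properFace [FiniteDimensional ℝ E] [Finite κ] (ℓ : κ → E →ᵃ[ℝ] ℝ) :
    Finite (ProperFace (poly ℓ)) := by
  have : (range (strat ℓ)).Finite := finite_range _
  have hfin : {F : Set E | IsFace (poly ℓ) F ∧ F ≠ poly ℓ}.Finite := by
    refine this.subset ?_
    rintro F ⟨hF, -⟩
    obtain ⟨x, -, rfl⟩ := isFace_poly_iff.1 hF
    exact mem_range_self _
  exact hfin.to_subtype

lemma strat_ne_poly {ℓ : κ → E →ᵃ[ℝ] ℝ} {x x0 : E} (hx0 : ∀ j, ℓ j x0 < 0)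
    (hne : (tight ℓ x).Nonempty) : strat ℓ (tight ℓ x) ≠ poly ℓ := by
  obtain ⟨j, hj⟩ := hne
  intro h
  have : x0 ∈ strat ℓ (tight ℓ x) := by rw [h]; exact fun j => (hx0 j).le
  exact (hx0 j).ne (this.2 hj)

/-- The proper faces whose relative interior meets the hyperplane `h = 0`. -/
def sectionFaces (ℓ : κ → E →ᵃ[ℝ] ℝ) (h : E →ᵃ[ℝ] ℝ) : Set (ProperFace (poly ℓ)) :=
  {F | ∃ x ∈ poly ℓ, h x = 0 ∧ F.1 = strat ℓ (tight ℓ x)}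

/-- The boundary of the section of a polyhedron by the hyperplane `h = 0`. -/
def sectionBoundary (ℓ : κ → E →ᵃ[ℝ] ℝ) (h : E →ᵃ[ℝ] ℝ) : Set E :=
  {x | x ∈ poly ℓ ∧ h x = 0 ∧ (tight ℓ x).Nonempty}

/-- The boundary of a section of a bounded 4-dimensional polyhedron is a sphere. -/
theorem sectionBoundary_sphere [FiniteDimensional ℝ E] [Finite κ] (hE : Module.finrank ℝ E = 4)
    {ℓ : κ → E →ᵃ[ℝ] ℝ} (hb : Bornology.IsBounded (poly ℓ)) {h : E →ᵃ[ℝ] ℝ} (hlin : h.linear ≠ 0)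
    {x0 : E} (hx0 : ∀ j, ℓ j x0 < 0) (hhx0 : h x0 = 0) :
    Nonempty (sectionBoundary ℓ h ≃ₜ Metric.sphere (0 : EuclideanSpace ℝ (Fin 3)) 1) := by
  have hker : Module.finrank ℝ (LinearMap.ker h.linear) = 3 := by
    have h1 := Module.Dual.finrank_ker_add_one_of_ne_zero hlin
    omega
  have e : EuclideanSpace ℝ (Fin 3) ≃L[ℝ] LinearMap.ker h.linear :=
    ContinuousLinearEquiv.ofFinrankEq (by rw [hker]; simp)
  -- The hyperplane is parametrized with the interior point `x0` as origin, so the section becomes a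
  -- convex body with `0` in its interior, whose frontier is a sphere.
  let ψ : EuclideanSpace ℝ (Fin 3) → E := fun u => x0 + (e u : E)
  have hψ : Continuous ψ := by fun_prop
  have hemb : Topology.IsEmbedding ψ :=
    (Homeomorph.addLeft x0).isEmbedding.comp
      (Topology.IsEmbedding.subtypeVal.comp e.toHomeomorph.isEmbedding)
  have hmem : ∀ x, h x = 0 → ∃ u, ψ u = x := fun x hx => by
    have : x - x0 ∈ LinearMap.ker h.linear := by
      rw [LinearMap.mem_ker, affine_linear_sub, hx, hhx0, sub_zero]
    exact ⟨e.symm ⟨x - x0, this⟩, by simp [ψ]⟩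
  have hhψ : ∀ u, h (ψ u) = 0 := fun u => by
    have h1 := affine_linear_sub h (ψ u) x0
    have h2 : ψ u - x0 = e u := by simp [ψ]
    rw [h2, LinearMap.mem_ker.1 (e u).2, hhx0] at h1
    linarith
  have hψadd : ∀ (a : ℝ) u, ψ (a • u) = (1 - a) • x0 + a • ψ u := fun a u => by
    simp only [ψ, map_smul, Submodule.coe_smul]; module
  set R : Set (EuclideanSpace ℝ (Fin 3)) := ψ ⁻¹' poly ℓ with hR
  have hRconv : Convex ℝ R := by
    intro u hu v hv a b ha hb hab
    have : ψ (a • u + b • v) = a • ψ u + b • ψ v := by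
      simp only [ψ, map_add, map_smul, Submodule.coe_add, Submodule.coe_smul, smul_add]
      have : x0 = a • x0 + b • x0 := by rw [← add_smul, hab, one_smul]
      nth_rw 1 [this]; abel
    show ψ _ ∈ poly ℓ
    rw [this]
    exact poly_convex ℓ hu hv ha hb hab
  have hopen : IsOpen {u | ∀ j, ℓ j (ψ u) < 0} := by
    simp only [ofPred_forall]
    exact isOpen_iInter_of_finite fun j =>
      isOpen_lt ((continuous_affine _).comp hψ) continuous_const
  have hint : interior R = {u | ∀ j, ℓ j (ψ u) < 0} := by
    refine Subset.antisymm (fun u hu j => ?_)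
      (interior_maximal (fun u hu j => (hu j).le) hopen)
    refine lt_of_le_of_ne (interior_subset hu j) fun h0 => ?_
    -- If an inequality were tight at `u`, going slightly beyond `u` on the ray from the origin
    -- would violate it, because it is strict at `x0`.
    have hev : ∀ᶠ a : ℝ in nhdsWithin 1 (Ioi 1), a • u ∈ R := by
      have hc : Filter.Tendsto (fun a : ℝ => a • u) (nhds 1) (nhds u) := by
        have : Continuous (fun a : ℝ => a • u) := by fun_prop
        simpa using this.tendsto 1
      exact ((hc.eventually (mem_interior_iff_mem_nhds.1 hu)).filter_mono nhdsWithin_le_nhds)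
    obtain ⟨a, ha, ha1⟩ := (hev.and self_mem_nhdsWithin).exists
    have h2 : ℓ j (ψ (a • u)) ≤ 0 := ha j
    rw [hψadd, affine_combo _ (by ring), h0] at h2
    have h3 := hx0 j
    have h4 : 1 < a := ha1
    nlinarith
  have hRbdd : Bornology.IsBounded R := by
    obtain ⟨M, hM⟩ := hb.exists_norm_le
    have hlip := e.symm.lipschitz
    have hsub : R ⊆ e.symm '' {y | ‖y‖ ≤ M + ‖x0‖} := by
      intro u hu
      refine ⟨e u, ?_, by simp⟩
      have h1 := hM _ hu
      have h2 : ((e u : LinearMap.ker h.linear) : E) = ψ u - x0 := by simp [ψ]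
      show ‖((e u : LinearMap.ker h.linear) : E)‖ ≤ _
      rw [h2]
      exact (norm_sub_le _ _).trans (by gcongr)
    refine (hlip.isBounded_image ?_).subset hsub
    exact (Metric.isBounded_closedBall (x := (0 : LinearMap.ker h.linear))
      (r := M + ‖x0‖)).subset fun y hy => by simpa using hy
  have hRclosed : IsClosed R := by
    have := strat_closed ℓ ∅
    rw [strat_empty] at this
    exact this.preimage hψ
  have h0 : (0 : EuclideanSpace ℝ (Fin 3)) ∈ interior R := by
    rw [hint]; intro j; simpa [ψ] using hx0 j
  obtain ⟨k, -, -, hk⟩ := exists_homeomorph_image_interior_closure_frontier_eq_unitBall hRconv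
    ⟨0, h0⟩ hRbdd
  have himg : ψ '' frontier R = sectionBoundary ℓ h := by
    rw [hRclosed.frontier_eq, hint]
    ext x
    constructor
    · rintro ⟨u, ⟨hu, hn⟩, rfl⟩
      simp only [mem_ofPred_eq, not_forall, not_lt] at hn
      obtain ⟨j, hj⟩ := hn
      exact ⟨hu, hhψ u, j, le_antisymm (hu j) hj⟩
    · rintro ⟨hx, hhx, j, hj⟩
      obtain ⟨u, rfl⟩ := hmem x hhx
      exact ⟨u, ⟨hx, fun hlt => (hlt j).ne hj⟩, rfl⟩
  exact ⟨(((hemb.homeomorphImage (frontier R)).trans (Homeomorph.setCongr himg)).symm).trans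
    ((k.image (frontier R)).trans (Homeomorph.setCongr hk))⟩

/-- The order complex of the faces met by a hyperplane section is a sphere. -/
theorem sectionFaces_sphere [FiniteDimensional ℝ E] [Finite κ] (hE : Module.finrank ℝ E = 4)
    {ℓ : κ → E →ᵃ[ℝ] ℝ} (hb : Bornology.IsBounded (poly ℓ)) {h : E →ᵃ[ℝ] ℝ} (hlin : h.linear ≠ 0)
    {x0 : E} (hx0 : ∀ j, ℓ j x0 < 0) (hhx0 : h x0 = 0) :
    Nonempty (ordReal (sectionFaces ℓ h) ≃ₜ
      Metric.sphere (0 : EuclideanSpace ℝ (Fin 3)) 1) := by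
  classical
  obtain ⟨k⟩ := sectionBoundary_sphere hE hb hlin hx0 hhx0
  have := finite_properFace ℓ
  have := Fintype.ofFinite (ProperFace (poly ℓ))
  set S := sectionFaces ℓ h
  -- Each face that is met is marked by a point of its relative interior on the hyperplane; these
  -- points play the role of barycenters.
  choose! β hβ using fun (F : ProperFace (poly ℓ)) (hF : F ∈ S) => hF
  have htight : ∀ F ∈ S, (tight ℓ (β F)).Nonempty := fun F hF => by
    by_contra hn
    rw [not_nonempty_iff_eq_empty] at hn
    have := (hβ F hF).2.2
    rw [hn, strat_empty] at this
    exact F.2.2 this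
  have hord : ∀ a ∈ S, ∀ b ∈ S, a ≤ b ↔ tight ℓ (β b) ⊆ tight ℓ (β a) := fun a ha b hb => by
    rw [← strat_subset_iff (hβ a ha).1, ← (hβ a ha).2.2, ← (hβ b hb).2.2]; rfl
  have hcov : ∀ x ∈ poly ℓ, h x = 0 → (tight ℓ x).Nonempty →
      ∃ a ∈ S, tight ℓ (β a) = tight ℓ x := by
    intro x hx hhx hne
    let F : ProperFace (poly ℓ) :=
      ⟨strat ℓ (tight ℓ x), isFace_poly_iff.2 ⟨x, hx, rfl⟩, strat_ne_poly hx0 hne⟩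
    have hF : F ∈ S := ⟨x, hx, hhx, rfl⟩
    exact ⟨F, hF, ((strat_inj (hβ F hF).1 hx).1 (hβ F hF).2.2.symm)⟩
  have hmaps : ∀ w : ordReal S, ∑ a, (w : _ → ℝ) a • β a ∈ sectionBoundary ℓ h := by
    intro w
    obtain ⟨m, hm, h1, h2⟩ := exists_tight_sum_eq (β := β) (ℓ := ℓ) (fun a ha => (hβ a ha).1)
      (fun a ha b hb => (hord a ha b hb).1) w.2
    have hw := mem_ordReal.1 w.2
    refine ⟨h1, ?_, h2 ▸ htight m (hw.2.1 m hm)⟩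
    rw [affine_sum _ _ _ _ hw.2.2.2]
    refine Finset.sum_eq_zero fun a _ => ?_
    by_cases ha : (w : _ → ℝ) a = 0
    · rw [ha, zero_mul]
    · rw [(hβ a (hw.2.1 a ha)).2.1, mul_zero]
  let Ψ : ordReal S → sectionBoundary ℓ h := fun w => ⟨_, hmaps w⟩
  have hΨ : Function.Bijective Ψ := by
    constructor
    · intro w w' hww
      exact Subtype.ext (barycentric_injective (fun a ha => (hβ a ha).1) hord w.2 w'.2
        (congrArg Subtype.val hww))
    · rintro ⟨x, hx, hhx, hne⟩
      obtain ⟨a, ha, hax⟩ := hcov x hx hhx hne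
      obtain ⟨w, hw, -, hws⟩ := barycentric_surjective hb h (fun a ha => (hβ a ha).2.1) hord hcov a ha
        x hx hhx hne hax
      exact ⟨⟨w, hw⟩, Subtype.ext hws⟩
  have hcont : Continuous Ψ := by
    refine Continuous.subtype_mk (continuous_finsetSum _ fun a _ => ?_) _
    exact ((continuous_apply a).comp continuous_subtype_val).smul continuous_const
  have : CompactSpace (ordReal S) := isCompact_iff_compactSpace.1 (isCompact_ordReal S)
  exact ⟨(Continuous.homeoOfEquivCompactToT2 (f := Equiv.ofBijective Ψ hΨ) hcont).trans k⟩

/-- If the polytope has points on both sides of a hyperplane inside a face, then the hyperplane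
meets the relative interior of the face. -/
lemma exists_tight_eq_of_signs {ℓ : κ → E →ᵃ[ℝ] ℝ} {h : E →ᵃ[ℝ] ℝ} {b y z : E}
    (hb : b ∈ poly ℓ) (hy : y ∈ strat ℓ (tight ℓ b)) (hz : z ∈ strat ℓ (tight ℓ b))
    (hhy : h y < 0) (hhz : 0 < h z) : ∃ x ∈ poly ℓ, h x = 0 ∧ tight ℓ x = tight ℓ b := by
  have key : ∀ c ∈ strat ℓ (tight ℓ b), h b * h c < 0 →
      ∃ x ∈ poly ℓ, h x = 0 ∧ tight ℓ x = tight ℓ b := by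
    intro c hc hbc
    have hne : h c - h b ≠ 0 := fun h0 => by
      rw [sub_eq_zero.1 h0] at hbc; nlinarith [mul_self_nonneg (h b)]
    have hs : 0 < h c / (h c - h b) := by
      rw [div_pos_iff]
      rcases lt_or_gt_of_ne (show h b ≠ 0 from fun h0 => by simp [h0] at hbc) with h1 | h1
      · left; constructor <;> nlinarith
      · right; constructor <;> nlinarith
    have ht : 0 < -h b / (h c - h b) := by
      rw [div_pos_iff]
      rcases lt_or_gt_of_ne (show h b ≠ 0 from fun h0 => by simp [h0] at hbc) with h1 | h1
      · left; constructor <;> nlinarith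
      · right; constructor <;> nlinarith
    have hst : h c / (h c - h b) + -h b / (h c - h b) = 1 := by field_simp; ring
    refine ⟨_, poly_convex ℓ hb hc.1 hs.le ht.le hst, ?_, ?_⟩
    · rw [affine_combo _ hst]; field_simp; ring
    · rw [tight_combo hb hc.1 hs ht hst]; exact inter_eq_left.2 hc.2
  rcases lt_trichotomy (h b) 0 with h1 | h1 | h1
  · exact key z hz (mul_neg_of_neg_of_pos h1 hhz)
  · exact ⟨b, hb, h1, rfl⟩
  · exact key y hy (mul_neg_of_pos_of_neg h1 hhy)

end Sections

/-! ### Sign vectors: the combinatorics of one copy -/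

section Codes

/-- A face of the 5-cube as a sign vector. -/
abbrev Code := Fin 5 → SignType

/-- The face `f` of the 5-cube is contained in the face `f'`. -/
def Below (f f' : Code) : Prop := ∀ i, f' i = 0 ∨ f i = f' i

infix:50 " ≼ " => Below

instance (f f' : Code) : Decidable (f ≼ f') := by unfold Below; infer_instance

/-- The faces of the 5-cube that form the boundary complex of the polytope
`|xᵢ| ≤ 2`, `|xᵢ| + |xⱼ| ≤ 3` (`i = 0, 1`, `j = 2, 3`). -/
def Valid (f : Code) : Prop := (f 4 ≠ 1 → f 2 ≠ 0 ∨ f 3 ≠ 0) ∧ (f 4 ≠ -1 → f 0 ≠ 0 ∨ f 1 ≠ 0)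

instance (f : Code) : Decidable (Valid f) := by unfold Valid; infer_instance

/-- The dimension of a face of the 5-cube. -/
def rank (f : Code) : ℕ := (Finset.univ.filter fun i => f i = 0).card

/-- The codes of the facets. -/
def FacetCode (j : Code) : Prop := Valid j ∧ rank j = 3

instance (f : Code) : Decidable (FacetCode f) := by unfold FacetCode; infer_instance

/-- The codes of the vertices. -/
def VertexCode (v : Code) : Prop := ∀ i, v i ≠ 0

instance (f : Code) : Decidable (VertexCode f) := by unfold VertexCode; infer_instance

/-- The reflection in the coordinate `0`. -/
def flip (f : Code) : Code := Function.update f 0 (-f 0)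

/-- The facet glued to the next copy. -/
def topW : Code := ![1, 0, 1, 0, 0]

/-- The facet glued to the previous copy. -/
def botW : Code := ![-1, 0, 1, 0, 0]

/-- Puts statements about codes into a form that can be settled by running through the `3 ^ 5` sign
vectors. -/
lemma forall_code {p : Code → Prop} (h : ∀ a b c d e : SignType, p ![a, b, c, d, e]) (f : Code) :
    p f := by
  have : f = ![f 0, f 1, f 2, f 3, f 4] := by
    funext i; fin_cases i <;> rfl
  rw [this]; exact h _ _ _ _ _

lemma Below.refl (f : Code) : f ≼ f := fun _ => Or.inr rfl

lemma Below.trans {f g h : Code} (h1 : f ≼ g) (h2 : g ≼ h) : f ≼ h := fun i => by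
  rcases h2 i with h2 | h2
  · exact Or.inl h2
  · rcases h1 i with h1 | h1
    · left; rw [← h2, h1]
    · right; rw [h1, h2]

lemma Below.antisymm {f g : Code} (h1 : f ≼ g) (h2 : g ≼ f) : f = g := funext fun i => by
  rcases h1 i with h | h
  · rcases h2 i with h' | h'
    · rw [h, h']
    · exact h'.symm
  · exact h

lemma Below.apply_ne_zero {f g : Code} (h : f ≼ g) {i : Fin 5} (hi : g i ≠ 0) : f i = g i :=
  (h i).resolve_left hi

lemma Below.apply_eq_zero {f g : Code} (h : f ≼ g) {i : Fin 5} (hi : f i = 0) : g i = 0 :=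
  (h i).elim id fun h => by rw [← h, hi]

lemma Valid.of_below {f g : Code} (h : f ≼ g) (hg : Valid g) : Valid f := by
  have key : ∀ i, g i ≠ 0 → f i ≠ 0 := fun i hi => by rwa [h.apply_ne_zero hi]
  have k4 : ∀ s : SignType, s ≠ 0 → f 4 ≠ s → g 4 ≠ s := fun s hs h4 h5 => by
    rw [← h5] at hs h4; exact h4 (h.apply_ne_zero hs)
  exact ⟨fun h4 => (hg.1 (k4 1 (by decide) h4)).imp (key 2) (key 3),
    fun h4 => (hg.2 (k4 (-1) (by decide) h4)).imp (key 0) (key 1)⟩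

lemma flip_apply_zero (f : Code) : flip f 0 = -f 0 := by simp [flip]

lemma flip_apply_ne (f : Code) {i : Fin 5} (h : i ≠ 0) : flip f i = f i := by simp [flip, h]

lemma flip_apply_eq_zero (f : Code) (i : Fin 5) : flip f i = 0 ↔ f i = 0 := by
  by_cases h : i = 0
  · subst h; rw [flip_apply_zero]; generalize f 0 = s; revert s; decide
  · rw [flip_apply_ne f h]

@[simp] lemma flip_flip (f : Code) : flip (flip f) = f := by
  funext i
  by_cases h : i = 0
  · subst h; simp [flip_apply_zero]
  · simp [flip_apply_ne _ h]

lemma Below.flip {f g : Code} (h : f ≼ g) : flip f ≼ flip g := fun i => by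
  by_cases h0 : i = 0
  · subst h0
    rw [flip_apply_eq_zero, flip_apply_zero, flip_apply_zero, neg_inj]
    exact h 0
  · rw [flip_apply_ne _ h0, flip_apply_ne _ h0]; exact h i

lemma flip_below_iff {f g : Code} : CubicalPolytope.flip f ≼ CubicalPolytope.flip g ↔ f ≼ g :=
  ⟨fun h => by simpa using h.flip, fun h => h.flip⟩

lemma flip_topW : flip topW = botW := by decide

lemma flip_botW : flip botW = topW := by decide

lemma Valid.flip {f : Code} (h : Valid f) : Valid (flip f) := by
  unfold Valid at *
  simpa only [Ne, flip_apply_eq_zero, flip_apply_ne f (show (4 : Fin 5) ≠ 0 by decide)] using h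

lemma rank_flip (f : Code) : rank (flip f) = rank f := by
  unfold rank; simp only [flip_apply_eq_zero]

lemma FacetCode.flip {f : Code} (h : FacetCode f) : FacetCode (flip f) :=
  ⟨h.1.flip, by rw [rank_flip]; exact h.2⟩

lemma VertexCode.flip {f : Code} (h : VertexCode f) : VertexCode (flip f) := fun i => by
  rw [Ne, flip_apply_eq_zero]; exact h i

lemma facetCode_topW : FacetCode topW := by decide

lemma facetCode_botW : FacetCode botW := by decide

lemma Below.rank_le {f g : Code} (h : f ≼ g) : rank f ≤ rank g :=
  Finset.card_le_card fun i hi => by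
    simp only [Finset.mem_filter, Finset.mem_univ, true_and] at *
    exact h.apply_eq_zero hi

lemma Below.eq_of_rank_le {f g : Code} (h : f ≼ g) (hr : rank g ≤ rank f) : f = g := by
  have := Finset.eq_of_subset_of_card_le (s := Finset.univ.filter fun i => f i = 0)
    (t := Finset.univ.filter fun i => g i = 0) (fun i hi => by
      simp only [Finset.mem_filter, Finset.mem_univ, true_and] at *
      exact h.apply_eq_zero hi) hr
  funext i
  rcases h i with h1 | h1
  · have : i ∈ Finset.univ.filter fun i => f i = 0 := by rw [this]; simp [h1]
    rw [h1]; simpa using this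
  · exact h1

lemma rank_le_three {f : Code} (h : Valid f) : rank f ≤ 3 := by
  have : ∀ f : Code, Valid f → rank f ≤ 3 := by
    refine forall_code ?_
    decide +kernel
  exact this f h

lemma facetCode_eq {f j : Code} (hj : FacetCode j) (hf : Valid f) (h : j ≼ f) : f = j :=
  (h.eq_of_rank_le (by rw [hj.2]; exact rank_le_three hf)).symm

/-- The code that keeps the coordinates `p` and `q`. -/
def keep (f : Code) (p q : Fin 5) : Code := fun i => if i = p ∨ i = q then f i else 0

lemma below_keep (f : Code) (p q : Fin 5) : f ≼ keep f p q := fun i => by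
  unfold keep; split_ifs <;> simp

/-- A facet code has exactly two nonzero entries. Every fixed coordinate of a face is therefore
visible in some facet containing the face, which is what `below_of_facets` needs. -/
lemma exists_keep : ∀ f : Code, Valid f → ∀ i, f i ≠ 0 →
    ∃ q, FacetCode (keep f i q) := by
  refine forall_code ?_
  decide +kernel

/-- A face is the intersection of the facets that contain it. -/
lemma below_of_facets {f h : Code} (hf : Valid f) (hh : ∀ j, FacetCode j → f ≼ j → h ≼ j) :
    h ≼ f := fun i => by
  by_cases hi : f i = 0
  · exact Or.inl hi
  · obtain ⟨q, hq⟩ := exists_keep f hf i hi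
    have hk : keep f i q i = f i := by simp [keep]
    right
    rw [← hk]
    exact (hh _ hq (below_keep _ _ _)).apply_ne_zero (by rwa [hk])

/-- Gluing removes walls from the list of facets; every other face still lies in a facet that
survives in its copy. -/
lemma exists_facet_ne_wall : ∀ f : Code, Valid f → f ≠ topW → f ≠ botW →
    ∃ j, FacetCode j ∧ f ≼ j ∧ j ≠ topW ∧ j ≠ botW := by
  have : ∀ f : Code, Valid f → f ≠ topW → f ≠ botW →
    ∃ p q, FacetCode (keep f p q) ∧ keep f p q ≠ topW ∧ keep f p q ≠ botW := by
    refine forall_code ?_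
    decide +kernel
  intro f h1 h2 h3
  obtain ⟨p, q, h4, h5⟩ := this f h1 h2 h3
  exact ⟨_, h4, below_keep _ _ _, h5⟩

end Codes

/-! ### Coordinates, facet inequalities, and the maps that move the copies -/

section Geometry

/-- The scaling of the coordinate `i` at the vertex `v`. -/
def scale (v : Code) (i : Fin 5) : ℤ := if (v 4 = 1 ↔ i = 0 ∨ i = 1) then 2 else 1

/-- Homogeneous coordinates of the vertices of `|xᵢ| ≤ 2`, `|xᵢ| + |xⱼ| ≤ 3`; the homogenizing
coordinate is the last one. -/
noncomputable def hvert (v : Code) : Fin 5 → ℝ :=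
  ![(v 0 : ℝ) * scale v 0, v 1 * scale v 1, v 2 * scale v 2, v 3 * scale v 3, 1]

/-- The inequality of a facet in homogeneous coordinates. -/
noncomputable def fac (j : Code) : (Fin 5 → ℝ) →ₗ[ℝ] ℝ where
  toFun x := j 0 * x 0 + j 1 * x 1 + j 2 * x 2 + j 3 * x 3 - (if j 4 = 0 then 3 else 2) * x 4
  map_add' x y := by simp only [Pi.add_apply]; ring
  map_smul' c x := by simp only [Pi.smul_apply, smul_eq_mul, RingHom.id_apply]; ring

/-- The integer value of a facet inequality at a vertex. -/
def facInt (j v : Code) : ℤ :=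
  j 0 * (v 0 * scale v 0) + j 1 * (v 1 * scale v 1) + j 2 * (v 2 * scale v 2) +
    j 3 * (v 3 * scale v 3) - (if j 4 = 0 then 3 else 2)

lemma fac_hvert_eq (j v : Code) : fac j (hvert v) = facInt j v := by
  simp only [fac, hvert, facInt, LinearMap.coe_mk, AddHom.coe_mk]
  push_cast
  split_ifs <;> simp

/-- The list of the facets. -/
def facetList : List Code :=
  [![1, 0, 0, 0, 1], ![-1, 0, 0, 0, 1], ![0, 1, 0, 0, 1], ![0, -1, 0, 0, 1],
    ![0, 0, 1, 0, -1], ![0, 0, -1, 0, -1], ![0, 0, 0, 1, -1], ![0, 0, 0, -1, -1],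
    ![1, 0, 1, 0, 0], ![1, 0, -1, 0, 0], ![-1, 0, 1, 0, 0], ![-1, 0, -1, 0, 0],
    ![1, 0, 0, 1, 0], ![1, 0, 0, -1, 0], ![-1, 0, 0, 1, 0], ![-1, 0, 0, -1, 0],
    ![0, 1, 1, 0, 0], ![0, 1, -1, 0, 0], ![0, -1, 1, 0, 0], ![0, -1, -1, 0, 0],
    ![0, 1, 0, 1, 0], ![0, 1, 0, -1, 0], ![0, -1, 0, 1, 0], ![0, -1, 0, -1, 0]]

lemma mem_facetList : ∀ j : Code, FacetCode j → j ∈ facetList := by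
  refine forall_code ?_
  decide +kernel

lemma sign_cases {s : SignType} (h : s ≠ 0) : s = 1 ∨ s = -1 := by
  revert h; revert s; decide

/-- All data are integers, so convex position of the single copy is a check over 24 facets and 32
vertices. -/
lemma facInt_spec (j : Code) (hj : FacetCode j) (v : Code) (hv : VertexCode v) :
    facInt j v ≤ 0 ∧ (facInt j v = 0 ↔ v ≼ j) := by
  have key : ∀ j ∈ facetList, ∀ a ∈ [(1 : SignType), -1], ∀ b ∈ [(1 : SignType), -1],
      ∀ c ∈ [(1 : SignType), -1], ∀ d ∈ [(1 : SignType), -1], ∀ e ∈ [(1 : SignType), -1],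
      facInt j ![a, b, c, d, e] ≤ 0 ∧ (facInt j ![a, b, c, d, e] = 0 ↔ ![a, b, c, d, e] ≼ j) := by
    decide +kernel
  have h : ∀ i, v i ∈ [(1 : SignType), -1] := fun i => by simpa using sign_cases (hv i)
  have e : v = ![v 0, v 1, v 2, v 3, v 4] := by funext i; fin_cases i <;> rfl
  have := key j (mem_facetList j hj) _ (h 0) _ (h 1) _ (h 2) _ (h 3) _ (h 4)
  rwa [← e] at this

lemma fac_hvert_nonpos {j v : Code} (hj : FacetCode j) (hv : VertexCode v) :
    fac j (hvert v) ≤ 0 := by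
  rw [fac_hvert_eq]; exact_mod_cast (facInt_spec j hj v hv).1

lemma fac_hvert_eq_zero {j v : Code} (hj : FacetCode j) (hv : VertexCode v) :
    fac j (hvert v) = 0 ↔ v ≼ j := by
  rw [fac_hvert_eq]; exact_mod_cast (facInt_spec j hj v hv).2

/-- The projective transformations that move the copies of the polytope along the chain. -/
noncomputable def boost (r : ℝ) : (Fin 5 → ℝ) →ₗ[ℝ] (Fin 5 → ℝ) where
  toFun x :=
    -- A hyperbolic rotation: `a` and `b` are multiplied by `r` and `r⁻¹`, while `x 1`, `x 3` and `8
    -- * x 4 - 7 * s` are fixed. The walls lie in `x 0 = s` and `x 0 = -s`, that is `a = 9 * b` and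
    -- `b = 9 * a`, so the factor `9` carries the bottom hyperplane to the top one. There `s' = s`,
    -- so the coefficient `7 / 8` does not affect the gluing; it is chosen for the strict
    -- inequalities of `fac_boost_neg_aux`.
    let s := 3 * x 4 - x 2
    let a := 5 * s + 4 * x 0
    let b := 5 * s - 4 * x 0
    let s' := (r * a + r⁻¹ * b) / 10
    let z := x 4 + 7 / 8 * (s' - s)
    ![(r * a - r⁻¹ * b) / 8, x 1, 3 * z - s', x 3, z]
  map_add' x y := by
    funext i; fin_cases i <;> simp <;> ring
  map_smul' c x := by
    funext i; fin_cases i <;> simp <;> ring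

lemma boost_one (x : Fin 5 → ℝ) : boost 1 x = x := by
  funext i; fin_cases i <;> simp [boost] <;> ring

lemma boost_boost {r t : ℝ} (hr : r ≠ 0) (ht : t ≠ 0) (x : Fin 5 → ℝ) :
    boost r (boost t x) = boost (r * t) x := by
  funext i; fin_cases i <;> simp [boost] <;> field_simp <;> ring

/-- The reflection in the coordinate `0`. -/
def mirror (x : Fin 5 → ℝ) : Fin 5 → ℝ := ![-x 0, x 1, x 2, x 3, x 4]

/-- The reflection exchanges `a` and `b`. Statements about earlier copies thus follow from those
about later copies. -/
lemma boost_mirror (r : ℝ) (x : Fin 5 → ℝ) : boost r⁻¹ (mirror x) = mirror (boost r x) := by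
  funext i; fin_cases i <;> simp [boost, mirror] <;> ring

lemma fac_mirror (j : Code) (x : Fin 5 → ℝ) : fac (flip j) (mirror x) = fac j x := by
  have hc : ((-(j 0) : SignType) : ℝ) = -(j 0 : ℝ) := by cases j 0 <;> simp
  simp [fac, mirror, flip_apply_zero, flip_apply_ne, hc]

lemma hvert_flip (v : Code) : hvert (flip v) = mirror (hvert v) := by
  have hc : ((-(v 0) : SignType) : ℝ) = -(v 0 : ℝ) := by cases v 0 <;> simp
  by_cases h4 : v 4 = 1 <;> funext i <;> fin_cases i <;>
    simp [h4, hvert, mirror, flip_apply_zero, flip_apply_ne, hc, scale, neg_mul]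

lemma below_botW_iff {v : Code} : v ≼ botW ↔ v 0 = -1 ∧ v 2 = 1 := by
  constructor
  · intro h; exact ⟨h.apply_ne_zero (by decide), h.apply_ne_zero (by decide)⟩
  · rintro ⟨h0, h2⟩ i
    fin_cases i
    · right; exact h0
    · left; rfl
    · right; exact h2
    · left; rfl
    · left; rfl

lemma below_topW_iff {v : Code} : v ≼ topW ↔ v 0 = 1 ∧ v 2 = 1 := by
  constructor
  · intro h; exact ⟨h.apply_ne_zero (by decide), h.apply_ne_zero (by decide)⟩
  · rintro ⟨h0, h2⟩ i
    fin_cases i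
    · right; exact h0
    · left; rfl
    · right; exact h2
    · left; rfl
    · left; rfl

/-- The bottom wall of a copy is the top wall of the previous one. -/
lemma boost_hvert_wall {v : Code} (hv : VertexCode v) (hb : v ≼ botW) :
    boost 9 (hvert v) = hvert (flip v) := by
  obtain ⟨h0, h2⟩ := below_botW_iff.1 hb
  rw [hvert_flip]
  rcases sign_cases (hv 4) with h4 | h4 <;>
  · funext i; fin_cases i <;> simp [boost, hvert, mirror, scale, h0, h2, h4] <;> norm_num

/-- The hypotheses bundle the 24 facet inequalities without the one of `topW`, namely `y 0 + y 2 ≤ 3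
* y 4`; that one fails beyond the top wall. -/
lemma fac_neg_of_bounds {y : Fin 5 → ℝ} (h0 : |y 0| < 2 * y 4) (h1 : |y 1| < 2 * y 4)
    (h2 : |y 2| < 2 * y 4) (h3 : |y 3| < 2 * y 4) (h02 : |y 0 - y 2| < 3 * y 4)
    (h02' : -y 0 - y 2 < 3 * y 4) (h03 : |y 0| + |y 3| < 3 * y 4) (h12 : |y 1| + |y 2| < 3 * y 4)
    (h13 : |y 1| + |y 3| < 3 * y 4) {j : Code} (hj : FacetCode j) (hjt : j ≠ topW) :
    fac j y < 0 := by
  have a0 := le_abs_self (y 0)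
  have a1 := le_abs_self (y 1)
  have a2 := le_abs_self (y 2)
  have a3 := le_abs_self (y 3)
  have b0 := neg_abs_le (y 0)
  have b1 := neg_abs_le (y 1)
  have b2 := neg_abs_le (y 2)
  have b3 := neg_abs_le (y 3)
  rw [abs_lt] at h02
  have hl := mem_facetList j hj
  simp only [facetList, List.mem_cons, List.not_mem_nil, or_false] at hl
  rcases hl with rfl | rfl | rfl | rfl | rfl | rfl | rfl | rfl | rfl | rfl | rfl | rfl | rfl |
    rfl | rfl | rfl | rfl | rfl | rfl | rfl | rfl | rfl | rfl | rfl
  case inr.inr.inr.inr.inr.inr.inr.inr.inl => exact absurd rfl hjt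
  all_goals simp [fac]; linarith

/-- The convexity estimate: seen from a given copy, the vertices of all later copies are strictly
inside every facet except the top wall. For fixed vertex coordinates the required bounds are linear
in `r` and `u`. Either two copies are at least two steps apart (`81 ≤ r`), or the vertex is off the
shared wall. -/
lemma fac_boost_neg_aux {x0 x1 x2 x3 r u : ℝ} (hu : 0 < u) (hr : 9 ≤ r) (hur : u ≤ 1 / 9)
    (hc : (|x1| = 1 ∧ |x3| = 2 ∧ (x0 = 1 ∨ x0 = -1) ∧ (x2 = 2 ∨ x2 = -2)) ∨
      (|x1| = 2 ∧ |x3| = 1 ∧ (x0 = 2 ∨ x0 = -2) ∧ (x2 = 1 ∨ x2 = -1)))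
    (hw : (81 ≤ r ∧ u ≤ 1 / 81) ∨ ¬ (x0 < 0 ∧ 0 < x2)) {p q : ℝ}
    (hp : p = r * (5 * (3 - x2) + 4 * x0)) (hq : q = u * (5 * (3 - x2) - 4 * x0))
    (y : Fin 5 → ℝ) (hy0 : y 0 = (p - q) / 8) (hy1 : y 1 = x1) (hy3 : y 3 = x3)
    (hy4 : y 4 = 1 + 7 / 8 * ((p + q) / 10 - (3 - x2)))
    (hy2 : y 2 = 3 * y 4 - (p + q) / 10)
    {j : Code} (hj : FacetCode j) (hjt : j ≠ topW) : fac j y < 0 := by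
  have hpq : 0 < p - q ∧ 0 < q ∧
      (p - q) / 8 < 2 * (1 + 7 / 8 * ((p + q) / 10 - (3 - x2))) ∧
      (p - q) / 8 + |x3| < 3 * (1 + 7 / 8 * ((p + q) / 10 - (3 - x2))) ∧
      (p - q) / 8 + (p + q) / 10 < 6 * (1 + 7 / 8 * ((p + q) / 10 - (3 - x2))) ∧
      (1 + 7 / 8 * ((p + q) / 10 - (3 - x2))) < (p + q) / 10 ∧
      (3 - x2) < (p + q) / 10 := by
    subst hp hq
    rcases hc with ⟨-, h3, rfl | rfl, rfl | rfl⟩ | ⟨-, h3, rfl | rfl, rfl | rfl⟩ <;>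
    · rw [h3]
      norm_num at hw
      refine ⟨?_, ?_, ?_, ?_, ?_, ?_, ?_⟩ <;> linarith
  obtain ⟨k1, k2, k3, k4, k5, k6, k7⟩ := hpq
  have hb : |x1| ≤ 2 ∧ |x3| ≤ 2 ∧ |x1| + |x3| = 3 ∧ -2 ≤ x2 ∧ x2 ≤ 2 ∧ |x1| + x2 ≤ 3 ∧
      |x1| - x2 ≤ 3 := by
    rcases hc with ⟨h1, h3, -, rfl | rfl⟩ | ⟨h1, h3, -, rfl | rfl⟩ <;> rw [h1, h3] <;> norm_num
  obtain ⟨m1, m2, m3, m4, m5, m6, m7⟩ := hb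
  have hy0' : 0 < y 0 := by rw [hy0]; linarith
  have hy4' : 1 < y 4 := by rw [hy4]; linarith
  refine fac_neg_of_bounds ?_ ?_ ?_ ?_ ?_ ?_ ?_ ?_ ?_ hj hjt
  · rw [abs_of_pos hy0', hy0, hy4]; exact k3
  · rw [hy1]; linarith
  · rw [abs_lt]; constructor <;> linarith
  · rw [hy3]; linarith
  · rw [abs_lt]; constructor <;> linarith
  · linarith
  · rw [abs_of_pos hy0', hy3, hy0, hy4]; exact k4
  · rw [hy1]
    have : |y 2| < 3 * y 4 - |x1| := by rw [abs_lt]; constructor <;> linarith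
    linarith
  · rw [hy1, hy3]; linarith

lemma fac_boost_neg {v j : Code} (hv : VertexCode v) (hj : FacetCode j) (hjt : j ≠ topW) {r : ℝ}
    (hr : 9 ≤ r) (hw : 81 ≤ r ∨ ¬ v ≼ botW) : fac j (boost r (hvert v)) < 0 := by
  have hr0 : 0 < r := by linarith
  refine fac_boost_neg_aux (x0 := hvert v 0) (x1 := hvert v 1) (x2 := hvert v 2) (x3 := hvert v 3)
    (inv_pos.2 hr0) hr (by rw [one_div]; exact inv_anti₀ (by norm_num) hr) ?_ ?_ rfl rfl _
    (by simp [boost, hvert]) (by simp [boost]) (by simp [boost])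
    (by simp [boost, hvert]) (by simp [boost, hvert]) hj hjt
  · rcases sign_cases (hv 4) with h4 | h4 <;> rcases sign_cases (hv 0) with h0 | h0 <;>
      rcases sign_cases (hv 2) with h2 | h2 <;> rcases sign_cases (hv 1) with h1 | h1 <;>
      rcases sign_cases (hv 3) with h3 | h3 <;> simp [hvert, scale, h4, h0, h1, h2, h3]
  · refine hw.imp (fun h => ⟨h, ?_⟩) fun h => ?_
    · rw [one_div]; exact inv_anti₀ (by norm_num) h
    · rw [below_botW_iff] at h
      rcases sign_cases (hv 4) with h4 | h4 <;> rcases sign_cases (hv 0) with h0 | h0 <;>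
        rcases sign_cases (hv 2) with h2 | h2 <;> simp [h0, h2] at h <;>
        simp [hvert, scale, h4, h0, h2]

/-- The mirror image of `fac_boost_neg`. -/
lemma fac_boost_inv_neg {v j : Code} (hv : VertexCode v) (hj : FacetCode j) (hjt : j ≠ botW) {r : ℝ}
    (hr : 9 ≤ r) (hw : 81 ≤ r ∨ ¬ v ≼ topW) : fac j (boost r⁻¹ (hvert v)) < 0 := by
  have h := fac_boost_neg hv.flip hj.flip (fun h => hjt (by rw [← flip_flip j, h, flip_topW])) hr
    (hw.imp_right fun h h' => h (by rw [← flip_botW, ← flip_flip v]; exact h'.flip))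
  rw [hvert_flip] at h
  have e := boost_mirror r⁻¹ (hvert v)
  rw [inv_inv] at e
  rwa [e, fac_mirror] at h

end Geometry

/-! ### One copy is the hull of its 32 vertices -/

section Cone

/-- The cone over the vertices. -/
def InCone (f : Code) (x : Fin 5 → ℝ) : Prop :=
  ∃ c : Code → ℝ, (∀ v, 0 ≤ c v) ∧ (∀ v, c v ≠ 0 → VertexCode v ∧ v ≼ f) ∧ ∑ v, c v • hvert v = x

lemma InCone.combo {f : Code} {x y : Fin 5 → ℝ} (hx : InCone f x) (hy : InCone f y) {a b : ℝ}
    (ha : 0 ≤ a) (hb : 0 ≤ b) : InCone f (a • x + b • y) := by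
  obtain ⟨c, hc, hc', rfl⟩ := hx
  obtain ⟨d, hd, hd', rfl⟩ := hy
  refine ⟨fun v => a * c v + b * d v, fun v => by have := hc v; have := hd v; positivity,
    fun v hv => ?_, ?_⟩
  · by_cases h : c v = 0
    · refine hd' v fun h' => hv ?_
      simp only [h, h']; ring
    · exact hc' v h
  · simp only [add_smul, Finset.sum_add_distrib, mul_smul, ← Finset.smul_sum]

lemma inCone_hvert {f v : Code} (hv : VertexCode v) (h : v ≼ f) : InCone f (hvert v) := by
  refine ⟨Pi.single v 1, fun w => ?_, fun w hw => ?_, ?_⟩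
  · by_cases h : w = v
    · subst h; simp
    · simp [h]
  · by_cases h' : w = v
    · subst h'; exact ⟨hv, h⟩
    · simp [h'] at hw
  · rw [Finset.sum_eq_single v (fun w _ hw => by simp [hw]) (by simp)]; simp

lemma InCone.interpolate {p : ℝ → Fin 5 → ℝ} {m : ℝ} (hm : 0 < m)
    (hp : ∀ y, p y = ((m + y) / (2 * m)) • p m + ((m - y) / (2 * m)) • p (-m))
    (h1 : InCone 0 (p m)) (h2 : InCone 0 (p (-m))) {y : ℝ} (hy : |y| ≤ m) : InCone 0 (p y) := by
  rw [abs_le] at hy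
  rw [hp y]
  exact h1.combo h2 (div_nonneg (by linarith) (by linarith)) (div_nonneg (by linarith) (by linarith))

lemma below_zero (f : Code) : f ≼ 0 := fun _ => Or.inl rfl

/-- The two extreme boxes, one for each value of the last sign. Starting from the corners, the four
coordinates are freed one at a time by interpolating between opposite sides. -/
lemma inCone_box {m n : ℝ} (hm : 0 < m) (hn : 0 < n) {s : SignType} (hs : s ≠ 0)
    (hsc : (s = 1 ∧ m = 2 ∧ n = 1) ∨ (s ≠ 1 ∧ m = 1 ∧ n = 2)) {a b c d : ℝ} (ha : |a| ≤ m)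
    (hb : |b| ≤ m) (hc : |c| ≤ n) (hd : |d| ≤ n) : InCone 0 ![a, b, c, d, 1] := by
  have h0 : ∀ e0 e1 e2 e3 : SignType, e0 ≠ 0 → e1 ≠ 0 → e2 ≠ 0 → e3 ≠ 0 →
      InCone 0 ![(e0 : ℝ) * m, e1 * m, e2 * n, e3 * n, 1] := by
    intro e0 e1 e2 e3 h0 h1 h2 h3
    have hv : VertexCode ![e0, e1, e2, e3, s] := by
      intro i; fin_cases i <;> assumption
    convert inCone_hvert hv (below_zero _) using 1
    rcases hsc with ⟨hs, rfl, rfl⟩ | ⟨hs, rfl, rfl⟩ <;>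
    · funext i; fin_cases i <;> simp [hvert, scale, hs]
  have hone : ∀ (y k t : ℝ), 0 < k → ((k + y) / (2 * k)) * t + ((k - y) / (2 * k)) * t = t := by
    intro y k t hk; field_simp; ring
  have e1 : (1 : SignType) ≠ 0 := by decide
  have e2 : (-1 : SignType) ≠ 0 := by decide
  have h1 : ∀ e1 e2 e3 : SignType, e1 ≠ 0 → e2 ≠ 0 → e3 ≠ 0 →
      InCone 0 ![a, e1 * m, e2 * n, e3 * n, 1] := by
    intro f1 f2 f3 h1 h2 h3
    refine InCone.interpolate (p := fun y => ![y, f1 * m, f2 * n, f3 * n, 1]) hm ?_ ?_ ?_ ha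
    · intro y; funext i; fin_cases i <;> simp [hone _ _ _ hm] <;> field_simp <;> ring
    · simpa using h0 1 f1 f2 f3 e1 h1 h2 h3
    · simpa using h0 (-1) f1 f2 f3 e2 h1 h2 h3
  have h2 : ∀ e2 e3 : SignType, e2 ≠ 0 → e3 ≠ 0 →
      InCone 0 ![a, b, e2 * n, e3 * n, 1] := by
    intro f2 f3 h2 h3
    refine InCone.interpolate (p := fun y => ![a, y, f2 * n, f3 * n, 1]) hm ?_ ?_ ?_ hb
    · intro y; funext i; fin_cases i <;> simp [hone _ _ _ hm] <;> field_simp <;> ring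
    · simpa using h1 1 f2 f3 e1 h2 h3
    · simpa using h1 (-1) f2 f3 e2 h2 h3
  have h3 : ∀ e3 : SignType, e3 ≠ 0 → InCone 0 ![a, b, c, e3 * n, 1] := by
    intro f3 h3
    refine InCone.interpolate (p := fun y => ![a, b, y, f3 * n, 1]) hn ?_ ?_ ?_ hc
    · intro y; funext i; fin_cases i <;> simp [hone _ _ _ hn] <;> field_simp <;> ring
    · simpa using h2 1 f3 e1 h3
    · simpa using h2 (-1) f3 e2 h3
  refine InCone.interpolate (p := fun y => ![a, b, c, y, 1]) hn ?_ ?_ ?_ hd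
  · intro y; funext i; fin_cases i <;> simp [hone _ _ _ hn] <;> field_simp <;> ring
  · simpa using h3 1 e1
  · simpa using h3 (-1) e2

/-- The facet inequalities define the cone over the vertices. -/
theorem inCone_of_fac_nonpos {x : Fin 5 → ℝ} (h : ∀ j, FacetCode j → fac j x ≤ 0)
    (hs : 0 < 3 * x 4 - x 2) : InCone 0 x := by
  have k0 := h ![1, 0, 0, 0, 1] (by decide)
  have k0' := h ![-1, 0, 0, 0, 1] (by decide)
  have k1 := h ![0, 1, 0, 0, 1] (by decide)
  have k1' := h ![0, -1, 0, 0, 1] (by decide)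
  have k2 := h ![0, 0, 1, 0, -1] (by decide)
  have k2' := h ![0, 0, -1, 0, -1] (by decide)
  have k3 := h ![0, 0, 0, 1, -1] (by decide)
  have k3' := h ![0, 0, 0, -1, -1] (by decide)
  have l1 := h ![1, 0, 1, 0, 0] (by decide)
  have l2 := h ![1, 0, -1, 0, 0] (by decide)
  have l3 := h ![-1, 0, 1, 0, 0] (by decide)
  have l4 := h ![-1, 0, -1, 0, 0] (by decide)
  have l5 := h ![1, 0, 0, 1, 0] (by decide)
  have l6 := h ![1, 0, 0, -1, 0] (by decide)
  have l7 := h ![-1, 0, 0, 1, 0] (by decide)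
  have l8 := h ![-1, 0, 0, -1, 0] (by decide)
  have m1 := h ![0, 1, 1, 0, 0] (by decide)
  have m2 := h ![0, 1, -1, 0, 0] (by decide)
  have m3 := h ![0, -1, 1, 0, 0] (by decide)
  have m4 := h ![0, -1, -1, 0, 0] (by decide)
  have m5 := h ![0, 1, 0, 1, 0] (by decide)
  have m6 := h ![0, 1, 0, -1, 0] (by decide)
  have m7 := h ![0, -1, 0, 1, 0] (by decide)
  have m8 := h ![0, -1, 0, -1, 0] (by decide)
  simp [fac] at k0 k0' k1 k1' k2 k2' k3 k3' l1 l2 l3 l4 l5 l6 l7 l8 m1 m2 m3 m4 m5 m6 m7 m8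
  have hpos : 0 < x 4 := by linarith
  -- The point lies in the box with half-lengths `t, t, 3 * x 4 - t, 3 * x 4 - t`. This box
  -- interpolates between the extreme ones with weights `2 * x 4 - t` and `t - x 4`.
  obtain ⟨t, ht1, ht2, hA, hB, hC, hD⟩ : ∃ t, x 4 ≤ t ∧ t ≤ 2 * x 4 ∧ |x 0| ≤ t ∧ |x 1| ≤ t ∧
      |x 2| ≤ 3 * x 4 - t ∧ |x 3| ≤ 3 * x 4 - t := by
    refine ⟨max (max |x 0| |x 1|) (x 4), le_max_right _ _, ?_, ?_, ?_, ?_, ?_⟩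
    · refine max_le (max_le ?_ ?_) (by linarith) <;> rw [abs_le] <;> constructor <;> linarith
    · exact (le_max_left _ _).trans (le_max_left _ _)
    · exact (le_max_right _ _).trans (le_max_left _ _)
    · rw [le_sub_comm]
      refine max_le (max_le ?_ ?_) ?_
      · have : |x 2| ≤ 3 * x 4 - |x 0| := by
          rcases abs_cases (x 0) with ⟨e, -⟩ | ⟨e, -⟩ <;> rw [abs_le] <;> constructor <;> linarith
        linarith
      · have : |x 2| ≤ 3 * x 4 - |x 1| := by
          rcases abs_cases (x 1) with ⟨e, -⟩ | ⟨e, -⟩ <;> rw [abs_le] <;> constructor <;> linarith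
        linarith
      · have : |x 2| ≤ 2 * x 4 := by rw [abs_le]; constructor <;> linarith
        linarith
    · rw [le_sub_comm]
      refine max_le (max_le ?_ ?_) ?_
      · have : |x 3| ≤ 3 * x 4 - |x 0| := by
          rcases abs_cases (x 0) with ⟨e, -⟩ | ⟨e, -⟩ <;> rw [abs_le] <;> constructor <;> linarith
        linarith
      · have : |x 3| ≤ 3 * x 4 - |x 1| := by
          rcases abs_cases (x 1) with ⟨e, -⟩ | ⟨e, -⟩ <;> rw [abs_le] <;> constructor <;> linarith
        linarith
      · have : |x 3| ≤ 2 * x 4 := by rw [abs_le]; constructor <;> linarith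
        linarith
  have htpos : 0 < t := by linarith
  have htpos' : 0 < 3 * x 4 - t := by linarith
  have hdiv : ∀ {y k m : ℝ}, 0 < k → |y| ≤ k → 0 < m → |m * (y / k)| ≤ m := by
    intro y k m hk hy hm
    rw [abs_mul, abs_of_pos hm, abs_div, abs_of_pos hk]
    have : |y| / k ≤ 1 := (div_le_one hk).2 hy
    nlinarith
  have hp := inCone_box (m := 1) (n := 2) (by norm_num) (by norm_num) (s := -1) (by decide)
    (Or.inr ⟨by decide, rfl, rfl⟩) (hdiv htpos hA one_pos) (hdiv htpos hB one_pos)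
    (hdiv htpos' hC two_pos) (hdiv htpos' hD two_pos)
  have hq := inCone_box (m := 2) (n := 1) (by norm_num) (by norm_num) (s := 1) (by decide)
    (Or.inl ⟨by decide, rfl, rfl⟩) (hdiv htpos hA two_pos) (hdiv htpos hB two_pos)
    (hdiv htpos' hC one_pos) (hdiv htpos' hD one_pos)
  have hne := htpos'.ne'
  have hne' := htpos.ne'
  have key1 : ∀ y, (2 * x 4 - t) * (1 * (y / t)) + (t - x 4) * (2 * (y / t)) = y := by
    intro y; field_simp; ring
  have key2 : ∀ y, (2 * x 4 - t) * (2 * (y / (3 * x 4 - t))) +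
      (t - x 4) * (1 * (y / (3 * x 4 - t))) = y := by
    intro y
    calc _ = (3 * x 4 - t) * (y / (3 * x 4 - t)) := by ring
      _ = y := mul_div_cancel₀ y hne
  have hr := hp.combo hq (a := 2 * x 4 - t) (b := t - x 4) (by linarith) (by linarith)
  have e : x = (2 * x 4 - t) • ![1 * (x 0 / t), 1 * (x 1 / t), 2 * (x 2 / (3 * x 4 - t)),
      2 * (x 3 / (3 * x 4 - t)), 1] + (t - x 4) • ![2 * (x 0 / t), 2 * (x 1 / t),
      1 * (x 2 / (3 * x 4 - t)), 1 * (x 3 / (3 * x 4 - t)), 1] := by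
    funext i
    fin_cases i
    · exact (key1 (x 0)).symm
    · exact (key1 (x 1)).symm
    · exact (key2 (x 2)).symm
    · exact (key2 (x 3)).symm
    · show x 4 = (2 * x 4 - t) * 1 + (t - x 4) * 1
      ring
  rw [e]
  exact hr

end Cone

/-! ### The chain of copies as a convex polyhedron -/

section Chain

/-- The ambient space of the polytopes. -/
abbrev E4 := EuclideanSpace ℝ (Fin 4)

/-- The affine chart in homogeneous coordinates. -/
noncomputable def chart : E4 →ᵃ[ℝ] (Fin 5 → ℝ) where
  -- The chart is the hyperplane `size = 1`. The functional `size` depends only on the wall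
  -- coordinates `a` and `b`, and is positive at the vertices of every copy.
  toFun X := ![X 0, X 2, 3 * X 1 - 1, X 3, X 1]
  linear :=
    { toFun := fun X => ![X 0, X 2, 3 * X 1, X 3, X 1]
      map_add' := fun X Y => by funext i; fin_cases i <;> simp ; ring
      map_smul' := fun c X => by funext i; fin_cases i <;> simp ; ring }
  map_vadd' X Y := by funext i; fin_cases i <;> simp ; ring

/-- A facet inequality of a copy of the polytope in the chain. -/
noncomputable def pieceIneq (k : ℕ) (j : Code) : E4 →ᵃ[ℝ] ℝ :=
  ((fac j).comp (boost ((9 : ℝ) ^ k)⁻¹)).toAffineMap.comp chart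

lemma pieceIneq_apply (k : ℕ) (j : Code) (x : E4) :
    pieceIneq k j x = fac j (boost ((9 : ℝ) ^ k)⁻¹ (chart x)) := rfl

/-- The facets of the chain of `g` copies. -/
abbrev FacetIndex (g : ℕ) : Type :=
  {p : Fin g × Code // FacetCode p.2 ∧ (p.2 = botW → p.1.val = 0) ∧ (p.2 = topW → p.1.val + 1 = g)}

/-- The facet inequalities of the chain. -/
noncomputable def ineq (g : ℕ) (J : FacetIndex g) : E4 →ᵃ[ℝ] ℝ := pieceIneq J.1.1 J.1.2

/-- Incidence of the face `f` of the copy `k` with the facet `j` of the copy `k'`. -/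
def Inc (k : ℕ) (f : Code) (k' : ℕ) (j : Code) : Prop :=
  (k = k' ∧ f ≼ j) ∨ (k = k' + 1 ∧ f ≼ botW ∧ flip f ≼ j) ∨ (k' = k + 1 ∧ f ≼ topW ∧ flip f ≼ j)

/-- The facets that contain a face. -/
def facetsOf (g k : ℕ) (f : Code) : Set (FacetIndex g) := {J | Inc k f J.1.1 J.1.2}

/-- The value at `x` of the positive functional of the chart. -/
def size (x : Fin 5 → ℝ) : ℝ := 3 * x 4 - x 2

/-- The vertices of the chain. -/
noncomputable def vpt (k : ℕ) (v : Code) : E4 :=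
  let V := boost ((9 : ℝ) ^ k) (hvert v)
  !₂[V 0 / size V, V 4 / size V, V 1 / size V, V 3 / size V]

lemma size_boost (r : ℝ) (x : Fin 5 → ℝ) : size (boost r x) =
    (r * (5 * size x + 4 * x 0) + r⁻¹ * (5 * size x - 4 * x 0)) / 10 := by
  simp [size, boost]

lemma size_pos {r : ℝ} (hr : 0 < r) {v : Code} (hv : VertexCode v) :
    0 < size (boost r (hvert v)) := by
  have hr' := inv_pos.2 hr
  have : 0 < 5 * size (hvert v) + 4 * hvert v 0 ∧ 0 < 5 * size (hvert v) - 4 * hvert v 0 := by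
    rcases sign_cases (hv 4) with h4 | h4 <;> rcases sign_cases (hv 0) with h0 | h0 <;>
      rcases sign_cases (hv 2) with h2 | h2 <;> simp [size, hvert, scale, h4, h0, h2] <;> norm_num
  obtain ⟨h1, h2⟩ := this
  rw [size_boost]
  positivity

lemma chart_vpt (k : ℕ) {v : Code} (hv : VertexCode v) :
    chart (vpt k v) = (size (boost ((9 : ℝ) ^ k) (hvert v)))⁻¹ • boost ((9 : ℝ) ^ k) (hvert v) := by
  have h := (size_pos (r := (9 : ℝ) ^ k) (by positivity) hv).ne'
  unfold vpt
  set V := boost ((9 : ℝ) ^ k) (hvert v)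
  have h2 : V 2 = 3 * V 4 - size V := by unfold size; ring
  funext i
  fin_cases i
  · simp [chart]; ring
  · simp [chart]; ring
  · simp [chart, h2]; field_simp
  · simp [chart]; ring
  · simp [chart]; ring

lemma pow_ratio {k m : ℕ} : ((9 : ℝ) ^ k)⁻¹ * 9 ^ (k + m) = 9 ^ m := by
  rw [pow_add]; field_simp

lemma nine_le_pow {d : ℕ} (hd : d ≠ 0) : (9 : ℝ) ≤ 9 ^ d := by
  calc (9 : ℝ) = 9 ^ 1 := by norm_num
    _ ≤ 9 ^ d := pow_le_pow_right₀ (by norm_num) (by omega)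

lemma eighty_one_le_pow {d : ℕ} (hd : 2 ≤ d) : (81 : ℝ) ≤ 9 ^ d := by
  calc (81 : ℝ) = 9 ^ 2 := by norm_num
    _ ≤ 9 ^ d := pow_le_pow_right₀ (by norm_num) hd

lemma flip_below_topW {v : Code} : flip v ≼ topW ↔ v ≼ botW := by
  rw [← flip_botW, flip_below_iff]

lemma flip_below_botW {v : Code} : flip v ≼ botW ↔ v ≼ topW := by
  rw [← flip_topW, flip_below_iff]

lemma boost_hvert_wall_inv {v : Code} (hv : VertexCode v) (hb : v ≼ topW) :
    boost 9⁻¹ (hvert v) = hvert (flip v) := by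
  have := boost_hvert_wall hv.flip (flip_below_botW.2 hb)
  rw [flip_flip] at this
  rw [← this, boost_boost (by norm_num) (by norm_num), inv_mul_cancel₀ (by norm_num), boost_one]

/-- The position of a vertex of one copy with respect to a facet of another one. -/
lemma fac_boost_spec {g : ℕ} (J : FacetIndex g) {k : ℕ} (hk : k < g) {v : Code}
    (hv : VertexCode v) :
    fac J.1.2 (boost (((9 : ℝ) ^ (J.1.1 : ℕ))⁻¹ * 9 ^ k) (hvert v)) ≤ 0 ∧
      (fac J.1.2 (boost (((9 : ℝ) ^ (J.1.1 : ℕ))⁻¹ * 9 ^ k) (hvert v)) = 0 ↔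
        Inc k v J.1.1 J.1.2) := by
  obtain ⟨⟨⟨k', hk'⟩, j⟩, hj, hb, ht⟩ := J
  simp only at hj hb ht ⊢
  rcases lt_trichotomy k k' with h | h | h
  · obtain ⟨m, rfl⟩ := Nat.exists_eq_add_of_lt h
    have e : ((9 : ℝ) ^ (k + m + 1))⁻¹ * 9 ^ k = (9 ^ (m + 1))⁻¹ := by
      rw [add_assoc, pow_add]; field_simp
    -- The bottom wall is a facet of the chain only for copy `0`, and here an earlier copy exists.
    have hjb : j ≠ botW := fun h => by have := hb h; omega
    rw [e]
    -- A vertex on the wall shared by adjacent copies is a reflected vertex of the other copy; all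
    -- other vertices fall under the strict estimate.
    by_cases hw : m = 0 ∧ v ≼ topW
    · obtain ⟨rfl, hw⟩ := hw
      rw [zero_add, pow_one, boost_hvert_wall_inv hv hw]
      refine ⟨fac_hvert_nonpos hj hv.flip, (fac_hvert_eq_zero hj hv.flip).trans ?_⟩
      refine ⟨fun h => Or.inr (Or.inr ⟨rfl, hw, h⟩), ?_⟩
      rintro (⟨h, -⟩ | ⟨h, -⟩ | ⟨-, -, h⟩)
      · omega
      · omega
      · exact h
    · have := fac_boost_inv_neg hv hj hjb (nine_le_pow (Nat.succ_ne_zero m)) (by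
        by_cases hm : m = 0
        · right; exact fun h => hw ⟨hm, h⟩
        · left; exact eighty_one_le_pow (by omega))
      refine ⟨this.le, fun h => absurd h this.ne, ?_⟩
      rintro (⟨h, -⟩ | ⟨h, -⟩ | ⟨h, h', -⟩)
      · omega
      · omega
      · exact absurd ⟨by omega, h'⟩ hw
  · subst h
    rw [inv_mul_cancel₀ (by positivity), boost_one]
    refine ⟨fac_hvert_nonpos hj hv, (fac_hvert_eq_zero hj hv).trans ?_⟩
    refine ⟨fun h => Or.inl ⟨rfl, h⟩, ?_⟩
    rintro (⟨-, h⟩ | ⟨h, -⟩ | ⟨h, -⟩)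
    · exact h
    · omega
    · omega
  · obtain ⟨m, rfl⟩ := Nat.exists_eq_add_of_lt h
    rw [add_assoc, pow_ratio]
    have hjt : j ≠ topW := fun h => by have := ht h; omega
    by_cases hw : m = 0 ∧ v ≼ botW
    · obtain ⟨rfl, hw⟩ := hw
      rw [zero_add, pow_one, boost_hvert_wall hv hw]
      refine ⟨fac_hvert_nonpos hj hv.flip, (fac_hvert_eq_zero hj hv.flip).trans ?_⟩
      refine ⟨fun h => Or.inr (Or.inl ⟨by omega, hw, h⟩), ?_⟩
      rintro (⟨h, -⟩ | ⟨-, -, h⟩ | ⟨h, -⟩)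
      · omega
      · exact h
      · omega
    · have := fac_boost_neg hv hj hjt (nine_le_pow (Nat.succ_ne_zero m)) (by
        by_cases hm : m = 0
        · right; exact fun h => hw ⟨hm, h⟩
        · left; exact eighty_one_le_pow (by omega))
      refine ⟨this.le, fun h => absurd h this.ne, ?_⟩
      rintro (⟨h, -⟩ | ⟨h, h', -⟩ | ⟨h, -⟩)
      · omega
      · exact absurd ⟨by omega, h'⟩ hw
      · omega

lemma ineq_vpt {g : ℕ} (J : FacetIndex g) (k : ℕ) {v : Code} (hv : VertexCode v) :
    ineq g J (vpt k v) = (size (boost ((9 : ℝ) ^ k) (hvert v)))⁻¹ *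
      fac J.1.2 (boost (((9 : ℝ) ^ (J.1.1 : ℕ))⁻¹ * 9 ^ k) (hvert v)) := by
  rw [ineq, pieceIneq_apply, chart_vpt k hv, map_smul, map_smul, smul_eq_mul,
    boost_boost (by positivity) (by positivity)]

lemma vpt_mem {g k : ℕ} (hk : k < g) {v : Code} (hv : VertexCode v) :
    vpt k v ∈ poly (ineq g) := fun J => by
  rw [ineq_vpt J k hv]
  exact mul_nonpos_of_nonneg_of_nonpos
    (inv_nonneg.2 (size_pos (by positivity) hv).le) (fac_boost_spec J hk hv).1

lemma tight_vpt {g k : ℕ} (hk : k < g) {v : Code} (hv : VertexCode v) :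
    tight (ineq g) (vpt k v) = facetsOf g k v := by
  ext J
  rw [mem_tight, ineq_vpt J k hv, mul_eq_zero,
    or_iff_right (inv_ne_zero (size_pos (by positivity) hv).ne'), (fac_boost_spec J hk hv).2]
  rfl

lemma botW_ne_topW : botW ≠ topW := by decide

/-- Every point of the chain lies in one of the copies. -/
lemma exists_piece {g : ℕ} (hg : 0 < g) {x : E4} (hx : x ∈ poly (ineq g)) :
    ∃ k < g, InCone 0 (boost ((9 : ℝ) ^ k)⁻¹ (chart x)) := by
  have hsize : size (chart x) = 1 := by simp [size, chart]
  have hx0 : chart x 0 = x 0 := rfl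
  have htop : ∀ r, fac topW (boost r (chart x)) =
      (r * (5 + 4 * x 0) - r⁻¹ * (5 - 4 * x 0)) / 8 - size (boost r (chart x)) := by
    intro r; simp [fac, topW, boost, size, chart]; ring
  have hbot : ∀ r, fac botW (boost r (chart x)) =
      -(r * (5 + 4 * x 0) - r⁻¹ * (5 - 4 * x 0)) / 8 - size (boost r (chart x)) := by
    intro r; simp [fac, botW, boost, size, chart]; ring
  have hsz : ∀ r, size (boost r (chart x)) =
      (r * (5 + 4 * x 0) + r⁻¹ * (5 - 4 * x 0)) / 10 := by
    intro r; rw [size_boost, hsize, hx0]; ring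
  set a := 5 + 4 * x 0 with ha
  set b := 5 - 4 * x 0 with hb
  have hab : a + b = 10 := by rw [ha, hb]; ring
  -- The two end walls bound the ratio `a / b`. Copy `k` fills the slab `81 ^ k / 9 ≤ a / b ≤ 9 * 81
  -- ^ k`.
  have h0 : b ≤ 9 * a := by
    have := hx ⟨(⟨0, hg⟩, botW), facetCode_botW, fun _ => rfl, fun h => absurd h botW_ne_topW⟩
    rw [ineq, pieceIneq_apply, hbot, hsz] at this
    norm_num at this
    linarith
  have h1 : a ≤ 9 * 81 ^ (g - 1) * b := by
    have := hx ⟨(⟨g - 1, by omega⟩, topW), facetCode_topW, fun h => absurd h botW_ne_topW.symm,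
      fun _ => by simp only; omega⟩
    rw [ineq, pieceIneq_apply, htop, hsz] at this
    simp only [inv_inv] at this
    have e : (81 : ℝ) ^ (g - 1) = 9 ^ (g - 1) * 9 ^ (g - 1) := by
      rw [← mul_pow]; norm_num
    have hp : (0 : ℝ) < 9 ^ (g - 1) := by positivity
    set t := (9 : ℝ) ^ (g - 1)
    have h2 : t⁻¹ * a ≤ 9 * (t * b) := by linarith
    calc a = t * (t⁻¹ * a) := by field_simp
      _ ≤ t * (9 * (t * b)) := by gcongr
      _ = 9 * 81 ^ (g - 1) * b := by rw [e]; ring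
  have ha0 : 0 < a := by linarith
  have hb0 : 0 < b := by
    by_contra hn
    have : 9 * 81 ^ (g - 1) * b ≤ 0 := mul_nonpos_of_nonneg_of_nonpos (by positivity) (not_lt.1 hn)
    linarith
  classical
  have hex : ∃ k, a ≤ 9 * 81 ^ k * b := ⟨_, h1⟩
  -- The first copy whose top wall is not exceeded; minimality says that the top wall of the copy
  -- below, which is the bottom wall of copy `k`, is reached.
  set k := Nat.find hex with hk
  have hkg : k < g := by
    have := Nat.find_le (h := hex) h1
    omega
  have hk1 : a ≤ 9 * 81 ^ k * b := Nat.find_spec hex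
  have hk2 : 81 ^ k * b ≤ 9 * a := by
    rcases Nat.eq_zero_or_pos k with h | h
    · rw [h]; linarith
    · obtain ⟨m, hm⟩ := Nat.exists_eq_add_of_lt h
      have := Nat.find_min hex (m := m) (by omega)
      rw [hm]
      push Not at this
      rw [show 0 + m + 1 = m + 1 by ring, pow_succ]
      linarith
  have hp : (0 : ℝ) < 9 ^ k := by positivity
  have e : (81 : ℝ) ^ k = 9 ^ k * 9 ^ k := by rw [← mul_pow]; norm_num
  have hk1' : ((9 : ℝ) ^ k)⁻¹ * a ≤ 9 * (9 ^ k * b) := by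
    rw [inv_mul_le_iff₀ hp]; rw [e] at hk1; linarith
  have hk2' : 9 ^ k * b ≤ 9 * (((9 : ℝ) ^ k)⁻¹ * a) := by
    rw [← mul_le_mul_iff_right₀ hp]
    rw [e] at hk2
    calc 9 ^ k * (9 ^ k * b) ≤ 9 * a := by linarith
      _ = 9 ^ k * (9 * (((9 : ℝ) ^ k)⁻¹ * a)) := by field_simp
  refine ⟨k, hkg, inCone_of_fac_nonpos (fun j hj => ?_) ?_⟩
  · by_cases ht : j = topW
    · subst ht
      rw [htop, hsz, inv_inv]
      linarith
    · by_cases hb : j = botW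
      · subst hb
        rw [hbot, hsz, inv_inv]
        linarith
      · exact hx ⟨(⟨k, hkg⟩, j), hj, fun h => absurd h hb, fun h => absurd h ht⟩
  · show 0 < size _
    rw [hsz, inv_inv]
    positivity

/-- The smallest face of the 5-cube that contains the vertices in `S`. -/
noncomputable def joinCode (S : Set Code) : Code := by
  classical
  exact fun i => if h : ∃ s : SignType, ∀ v ∈ S, v i = s then h.choose else 0

lemma joinCode_below_iff {S : Set Code} (hS : S.Nonempty) {g : Code} :
    joinCode S ≼ g ↔ ∀ v ∈ S, v ≼ g := by
  obtain ⟨v0, hv0⟩ := hS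
  have hval : ∀ i, ∀ v ∈ S, joinCode S i = 0 ∨ v i = joinCode S i := by
    intro i v hv
    unfold joinCode
    split_ifs with h
    · right; exact h.choose_spec v hv
    · left; rfl
  constructor
  · intro h v hv
    exact Below.trans (fun i => hval i v hv) h
  · intro h i
    by_cases hi : g i = 0
    · exact Or.inl hi
    · right
      have hall : ∀ v ∈ S, v i = g i := fun v hv => (h v hv).apply_ne_zero hi
      have hex : ∃ s : SignType, ∀ v ∈ S, v i = s := ⟨_, hall⟩
      have : joinCode S i = hex.choose := by unfold joinCode; rw [dif_pos hex]
      rw [this, ← hex.choose_spec v0 hv0, hall v0 hv0]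

lemma flip_below_comm {f j : Code} : flip f ≼ j ↔ f ≼ flip j := by
  rw [← flip_below_iff, flip_flip]

/-- The three alternatives of `Inc` exclude each other through the difference of `k` and `k'`, so
all vertices use the same one, and there the claim is about `≼` alone. -/
lemma inc_iff_forall {S : Set Code} (hS : S.Nonempty) {f : Code}
    (hf : ∀ g, f ≼ g ↔ ∀ v ∈ S, v ≼ g) {k k' : ℕ} {j : Code} :
    Inc k f k' j ↔ ∀ v ∈ S, Inc k v k' j := by
  obtain ⟨v0, hv0⟩ := hS
  unfold Inc
  simp only [flip_below_comm, hf]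
  constructor
  · rintro (⟨h, h'⟩ | ⟨h, h', h''⟩ | ⟨h, h', h''⟩) v hv
    · exact Or.inl ⟨h, h' v hv⟩
    · exact Or.inr (Or.inl ⟨h, h' v hv, h'' v hv⟩)
    · exact Or.inr (Or.inr ⟨h, h' v hv, h'' v hv⟩)
  · intro h
    rcases h v0 hv0 with ⟨e, -⟩ | ⟨e, -⟩ | ⟨e, -⟩
    · refine Or.inl ⟨e, fun v hv => ?_⟩
      rcases h v hv with ⟨-, h⟩ | ⟨e', -⟩ | ⟨e', -⟩
      · exact h
      · omega
      · omega
    · refine Or.inr (Or.inl ⟨e, fun v hv => ?_, fun v hv => ?_⟩) <;>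
      · rcases h v hv with ⟨e', h⟩ | ⟨e', h, h'⟩ | ⟨e', -⟩
        · omega
        · assumption
        · omega
    · refine Or.inr (Or.inr ⟨e, fun v hv => ?_, fun v hv => ?_⟩) <;>
      · rcases h v hv with ⟨e', h⟩ | ⟨e', -⟩ | ⟨e', h, h'⟩
        · omega
        · omega
        · assumption

/-- The vertices of a face. -/
def verts (f : Code) : Set Code := {v | VertexCode v ∧ v ≼ f}

/-- Every point of the chain is in the relative interior of a face of one of the copies. -/
theorem exists_code_of_mem {g : ℕ} (hg : 0 < g) {x : E4} (hx : x ∈ poly (ineq g)) :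
    ∃ k < g, ∃ f, tight (ineq g) x = facetsOf g k f ∧ x ∈ convexHull ℝ (vpt k '' verts f) := by
  obtain ⟨k, hk, c, hc, hcv, hcx⟩ := exists_piece hg hx
  -- The carrier is the smallest face containing the vertices that occur. A sum of nonpositive terms
  -- vanishes exactly when every occurring vertex is incident with the facet.
  set S : Set Code := {v | c v ≠ 0} with hS
  have hch : chart x = ∑ v, c v • boost ((9 : ℝ) ^ k) (hvert v) := by
    have := congrArg (boost ((9 : ℝ) ^ k)) hcx
    rw [boost_boost (by positivity) (by positivity), mul_inv_cancel₀ (by positivity), boost_one,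
      map_sum] at this
    rw [← this]
    exact Finset.sum_congr rfl fun v _ => by rw [map_smul]
  have hSne : S.Nonempty := by
    by_contra hn
    rw [not_nonempty_iff_eq_empty] at hn
    have h0 : ∀ v, c v = 0 := fun v => by
      by_contra h; exact (hn ▸ (show v ∈ S from h) : v ∈ (∅ : Set Code))
    have h2 : size (chart x) = 1 := by simp [size, chart]
    rw [hch] at h2
    simp [h0, size] at h2
  have hval : ∀ J, ineq g J x = ∑ v, c v *
      fac J.1.2 (boost (((9 : ℝ) ^ (J.1.1 : ℕ))⁻¹ * 9 ^ k) (hvert v)) := by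
    intro J
    rw [ineq, pieceIneq_apply, hch, map_sum, map_sum]
    refine Finset.sum_congr rfl fun v _ => ?_
    rw [map_smul, map_smul, smul_eq_mul, boost_boost (by positivity) (by positivity)]
  refine ⟨k, hk, joinCode S, ?_, ?_⟩
  · ext J
    rw [mem_tight, hval, Finset.sum_eq_zero_iff_of_nonpos]
    · show _ ↔ Inc k _ _ _
      rw [inc_iff_forall hSne (fun g => joinCode_below_iff hSne)]
      constructor
      · intro h v hv
        exact (fac_boost_spec J hk (hcv v hv).1).2.1
          ((mul_eq_zero.1 (h v (Finset.mem_univ v))).resolve_left hv)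
      · intro h v _
        by_cases hv : c v = 0
        · rw [hv, zero_mul]
        · rw [(fac_boost_spec J hk (hcv v hv).1).2.2 (h v hv), mul_zero]
    · intro v _
      by_cases hv : c v = 0
      · rw [hv, zero_mul]
      · exact mul_nonpos_of_nonneg_of_nonpos (hc v) (fac_boost_spec J hk (hcv v hv).1).1
  -- Passing from the cone to the affine chart rescales each vertex by its `size`; the rescaled
  -- weights sum to one because `size` equals one on the chart.
  · set σ : Code → ℝ := fun v => size (boost ((9 : ℝ) ^ k) (hvert v)) with hσ
    have hσpos : ∀ v, c v ≠ 0 → 0 < σ v := fun v hv => size_pos (by positivity) (hcv v hv).1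
    have hsum : ∑ v, c v * σ v = 1 := by
      have h2 : size (chart x) = 1 := by simp [size, chart]
      rw [← h2, hch]
      simp only [size, hσ, Finset.sum_apply, Pi.smul_apply, smul_eq_mul, Finset.mul_sum,
        ← Finset.sum_sub_distrib]
      exact Finset.sum_congr rfl fun v _ => by ring
    have hinj : Function.Injective chart := by
      intro X Y h
      have e := fun i => congrFun h i
      ext i
      fin_cases i
      · simpa [chart] using e 0
      · simpa [chart] using e 4
      · simpa [chart] using e 1
      · simpa [chart] using e 3
    have hxe : x = ∑ v, (c v * σ v) • vpt k v := by
      apply hinj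
      rw [affine_sum_vec Finset.univ chart _ _ hsum, hch]
      refine Finset.sum_congr rfl fun v _ => ?_
      by_cases hv : c v = 0
      · simp [hv]
      · rw [chart_vpt k (hcv v hv).1, smul_smul, mul_assoc, mul_inv_cancel₀ (hσpos v hv).ne',
          mul_one]
    rw [hxe]
    have hfil : ∑ v, (c v * σ v) • vpt k v =
        ∑ v ∈ Finset.univ.filter (fun v => c v ≠ 0), (c v * σ v) • vpt k v := by
      refine (Finset.sum_subset (Finset.filter_subset _ _) fun v _ hv => ?_).symm
      have : c v = 0 := by simpa using hv
      simp [this]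
    rw [hfil]
    refine (convex_convexHull ℝ _).sum_mem (fun v hv => ?_) ?_ (fun v hv => ?_)
    · have hv' := (Finset.mem_filter.1 hv).2
      exact mul_nonneg (hc v) (hσpos v hv').le
    · rw [← hsum]
      refine Finset.sum_subset (Finset.filter_subset _ _) fun v _ hv => ?_
      have : c v = 0 := by simpa using hv
      simp [this]
    · have hv' := (Finset.mem_filter.1 hv).2
      exact subset_convexHull ℝ _
        ⟨v, ⟨(hcv v hv').1, (joinCode_below_iff hSne).1 (Below.refl _) v hv'⟩, rfl⟩

end Chain

/-! ### The face lattice of the chain -/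

section Faces

/-- The codes of the proper faces of the chain. -/
def IsFaceCode (g k : ℕ) (f : Code) : Prop :=
  k < g ∧ Valid f ∧ (f = botW → k = 0) ∧ (f = topW → k + 1 = g)

/-- The face with a given code. -/
def Fc (g k : ℕ) (f : Code) : Set E4 := strat (ineq g) (facetsOf g k f)

lemma not_topW_below_botW : ¬ topW ≼ botW := by decide

lemma not_botW_below_topW : ¬ botW ≼ topW := by decide

lemma not_below_both {f : Code} (h : f ≼ topW) (h' : f ≼ botW) : False := by
  have h1 := (below_topW_iff.1 h).1
  rw [(below_botW_iff.1 h').1] at h1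
  exact absurd h1 (by decide)

lemma IsFaceCode.of_below {g k : ℕ} {f h : Code} (hf : IsFaceCode g k f) (hh : h ≼ f) :
    IsFaceCode g k h := by
  refine ⟨hf.1, hf.2.1.of_below hh, fun e => ?_, fun e => ?_⟩
  · subst e
    exact hf.2.2.1 (facetCode_eq facetCode_botW hf.2.1 hh)
  · subst e
    exact hf.2.2.2 (facetCode_eq facetCode_topW hf.2.1 hh)

/-- A glued wall lies in no outer facet: in its own copy the only facet containing it is itself, and
likewise for its reflection in the neighbouring copy. -/
lemma isFaceCode_of_facetsOf {g k : ℕ} {f : Code} (hk : k < g) (h : (facetsOf g k f).Nonempty) :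
    IsFaceCode g k f := by
  obtain ⟨⟨⟨⟨k', hk'⟩, j⟩, hj, hb, ht⟩, hJ⟩ := h
  change Inc k f k' j at hJ
  simp only at hj hb ht
  refine ⟨hk, ?_, fun e => ?_, fun e => ?_⟩
  · rcases hJ with ⟨-, h⟩ | ⟨-, h, -⟩ | ⟨-, h, -⟩
    · exact hj.1.of_below h
    · exact facetCode_botW.1.of_below h
    · exact facetCode_topW.1.of_below h
  · subst e
    rcases hJ with ⟨rfl, h⟩ | ⟨e, h, h'⟩ | ⟨-, h, -⟩
    · exact hb (facetCode_eq facetCode_botW hj.1 h)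
    · rw [flip_botW] at h'
      have := ht (facetCode_eq facetCode_topW hj.1 h')
      omega
    · exact absurd h not_botW_below_topW
  · subst e
    rcases hJ with ⟨rfl, h⟩ | ⟨-, h, h'⟩ | ⟨e, h, h'⟩
    · exact ht (facetCode_eq facetCode_topW hj.1 h)
    · exact absurd h not_topW_below_botW
    · rw [flip_topW] at h'
      have := hb (facetCode_eq facetCode_botW hj.1 h')
      omega

lemma verts_below_iff {f h : Code} : f ≼ h ↔ ∀ v ∈ verts f, v ≼ h := by
  refine ⟨fun hf v hv => hv.2.trans hf, fun hall i => ?_⟩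
  by_cases hi : h i = 0
  · exact Or.inl hi
  right
  by_contra hne
  -- A vertex of `f` whose sign in the coordinate `i` disagrees with `h` contradicts the assumption.
  obtain ⟨s, hs, hsh, hsf⟩ : ∃ s : SignType, s ≠ 0 ∧ s ≠ h i ∧ (f i = 0 ∨ s = f i) := by
    have : ∀ a b : SignType, a ≠ 0 → b ≠ a → ∃ s : SignType, s ≠ 0 ∧ s ≠ a ∧ (b = 0 ∨ s = b) := by
      decide
    exact this _ _ hi hne
  have hv : (fun j => if j = i then s else if f j = 0 then 1 else f j) ∈ verts f := by
    constructor
    · intro j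
      by_cases hj : j = i
      · simp [hj, hs]
      · by_cases h0 : f j = 0 <;> simp [hj, h0]
    · intro j
      by_cases hj : j = i
      · subst hj; simpa using hsf
      · by_cases h0 : f j = 0 <;> simp [hj, h0]
  have := (hall _ hv).apply_ne_zero hi
  simp at this
  exact hsh this

lemma verts_nonempty (f : Code) : (verts f).Nonempty := by
  by_contra hn
  rw [not_nonempty_iff_eq_empty] at hn
  have h1 : f ≼ topW := verts_below_iff.2 (by simp [hn])
  have h2 : f ≼ botW := verts_below_iff.2 (by simp [hn])
  exact not_below_both h1 h2

/-- The average of the vertices of a face is a relative interior point. -/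
lemma exists_tight_eq {g k : ℕ} (hk : k < g) (f : Code) :
    ∃ x ∈ poly (ineq g), tight (ineq g) x = facetsOf g k f := by
  classical
  set s := (verts f).toFinset with hs
  have hne : s.Nonempty := by rw [hs, toFinset_nonempty]; exact verts_nonempty f
  have hcard : (0 : ℝ) < s.card := by exact_mod_cast hne.card_pos
  have hsum : ∑ _v ∈ s, (s.card : ℝ)⁻¹ = 1 := by
    rw [Finset.sum_const, nsmul_eq_mul, mul_inv_cancel₀ hcard.ne']
  have hmem : ∀ v ∈ s, v ∈ verts f := fun v hv => by simpa [hs] using hv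
  have hnp : ∀ J, ∀ v ∈ s, (s.card : ℝ)⁻¹ * ineq g J (vpt k v) ≤ 0 := fun J v hv =>
    mul_nonpos_of_nonneg_of_nonpos (by positivity) (vpt_mem hk (hmem v hv).1 J)
  refine ⟨∑ v ∈ s, (s.card : ℝ)⁻¹ • vpt k v, fun J => ?_, ?_⟩
  · rw [affine_sum _ _ _ _ hsum]; exact Finset.sum_nonpos (hnp J)
  · ext J
    rw [mem_tight, affine_sum _ _ _ _ hsum, Finset.sum_eq_zero_iff_of_nonpos (hnp J)]
    show _ ↔ Inc k f _ _
    rw [inc_iff_forall (verts_nonempty f) fun g => verts_below_iff]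
    have key : ∀ v ∈ verts f, (s.card : ℝ)⁻¹ * ineq g J (vpt k v) = 0 ↔
        Inc k v J.1.1 J.1.2 := fun v hv => by
      rw [mul_eq_zero, or_iff_right (inv_ne_zero hcard.ne'), ← mem_tight, tight_vpt hk hv.1]; rfl
    exact ⟨fun h v hv => (key v hv).1 (h v (by simpa [hs] using hv)),
      fun h v hv => (key v (hmem v hv)).2 (h v (hmem v hv))⟩

lemma exists_interior {g : ℕ} (hg : 0 < g) : ∃ x, ∀ J, ineq g J x < 0 := by
  -- The code `0` is the whole 5-cube, so `x` is the average of all vertices of copy `0`; `0` is not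
  -- valid and hence lies in no facet.
  obtain ⟨x, hx, hxt⟩ := exists_tight_eq hg 0
  refine ⟨x, fun J => lt_of_le_of_ne (hx J) fun h => ?_⟩
  have h1 : J ∈ facetsOf g 0 0 := hxt ▸ h
  exact (isFaceCode_of_facetsOf hg ⟨J, h1⟩).2.1.1 (by simp) |>.elim (by simp) (by simp)

lemma Inc.mono {k k' : ℕ} {f h j : Code} (hi : Inc k f k' j) (hh : h ≼ f) : Inc k h k' j := by
  rcases hi with ⟨e, h1⟩ | ⟨e, h1, h2⟩ | ⟨e, h1, h2⟩
  · exact Or.inl ⟨e, hh.trans h1⟩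
  · exact Or.inr (Or.inl ⟨e, hh.trans h1, hh.flip.trans h2⟩)
  · exact Or.inr (Or.inr ⟨e, hh.trans h1, hh.flip.trans h2⟩)

lemma flip_eq_topW {f : Code} : flip f = topW ↔ f = botW := by
  rw [← flip_botW]
  exact ⟨fun h => by simpa using congrArg flip h, fun h => h ▸ rfl⟩

lemma flip_eq_botW {f : Code} : flip f = botW ↔ f = topW := by
  rw [← flip_topW]
  exact ⟨fun h => by simpa using congrArg flip h, fun h => h ▸ rfl⟩

/-- A face is the intersection of its facets within its copy. The difficulty is a facet that is a
glued wall: then `f` lies in the wall but is not the wall, and a surviving facet of the neighbouring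
copy that contains the reflected face detects the wall, because incidence across copies presupposes
lying in it. -/
lemma facetsOf_subset_iff {g k : ℕ} {f h : Code} (hf : IsFaceCode g k f) :
    facetsOf g k f ⊆ facetsOf g k h ↔ h ≼ f := by
  refine ⟨fun hsub => below_of_facets hf.2.1 fun j hj hfj => ?_, fun hh J hJ => Inc.mono hJ hh⟩
  have main : ∀ (hb : j = botW → k = 0) (ht : j = topW → k + 1 = g), h ≼ j := fun hb ht => by
    have : (⟨(⟨k, hf.1⟩, j), hj, hb, ht⟩ : FacetIndex g) ∈ facetsOf g k h :=
      hsub (Or.inl ⟨rfl, hfj⟩)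
    rcases this with ⟨-, h⟩ | ⟨e, -⟩ | ⟨e, -⟩
    · exact h
    · simp only at e; omega
    · simp only at e; omega
  by_cases hb : j = botW ∧ k ≠ 0
  · obtain ⟨rfl, hk⟩ := hb
    obtain ⟨j', h1, h2, h3, h4⟩ := exists_facet_ne_wall (flip f) hf.2.1.flip
      (fun e => hk (hf.2.2.1 (flip_eq_topW.1 e)))
      (fun e => by
        have : f = topW := flip_eq_botW.1 e
        exact not_topW_below_botW (this ▸ hfj))
    have : (⟨(⟨k - 1, by have := hf.1; omega⟩, j'), h1, fun e => absurd e h4, fun e => absurd e h3⟩ :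
        FacetIndex g) ∈ facetsOf g k h :=
      hsub (Or.inr (Or.inl ⟨by simp only; omega, hfj, h2⟩))
    rcases this with ⟨e, -⟩ | ⟨-, h, -⟩ | ⟨e, -⟩
    · simp only at e; omega
    · exact h
    · simp only at e; omega
  · by_cases ht : j = topW ∧ k + 1 ≠ g
    · obtain ⟨rfl, hk⟩ := ht
      obtain ⟨j', h1, h2, h3, h4⟩ := exists_facet_ne_wall (flip f) hf.2.1.flip
        (fun e => by
          have : f = botW := flip_eq_topW.1 e
          exact not_botW_below_topW (this ▸ hfj))
        (fun e => hk (hf.2.2.2 (flip_eq_botW.1 e)))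
      have : (⟨(⟨k + 1, by have := hf.1; omega⟩, j'), h1, fun e => absurd e h4,
          fun e => absurd e h3⟩ : FacetIndex g) ∈ facetsOf g k h :=
        hsub (Or.inr (Or.inr ⟨rfl, hfj, h2⟩))
      rcases this with ⟨e, -⟩ | ⟨e, -⟩ | ⟨-, h, -⟩
      · simp only at e; omega
      · simp only at e; omega
      · exact h
    · exact main (fun e => by_contra fun e' => hb ⟨e, e'⟩) (fun e => by_contra fun e' => ht ⟨e, e'⟩)

lemma facetsOf_glue (g k : ℕ) {f : Code} (h : f ≼ topW) :
    facetsOf g k f = facetsOf g (k + 1) (flip f) := by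
  ext J
  show Inc k f J.1.1 J.1.2 ↔ Inc (k + 1) (flip f) J.1.1 J.1.2
  have h1 : ¬ f ≼ botW := fun h' => not_below_both h h'
  have h2 : ¬ flip f ≼ topW := fun h' => h1 (flip_below_topW.1 h')
  have h3 : flip f ≼ botW := flip_below_botW.2 h
  simp only [Inc, h, h1, h2, h3, flip_flip, false_and, and_false, true_and, or_false, false_or,
    add_left_inj]
  constructor
  · rintro (h | ⟨h, h'⟩)
    · exact Or.inr h
    · exact Or.inl ⟨h.symm, h'⟩
  · rintro (⟨h, h'⟩ | h)
    · exact Or.inr ⟨h.symm, h'⟩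
    · exact Or.inl h

/-- Two codes of the same face, in the same or in consecutive copies. -/
def SameFace (k : ℕ) (f : Code) (k' : ℕ) (f' : Code) : Prop :=
  (k = k' ∧ f = f') ∨ (k' = k + 1 ∧ f ≼ topW ∧ f' = flip f) ∨ (k = k' + 1 ∧ f ≼ botW ∧ f' = flip f)

lemma SameFace.facetsOf_eq (g : ℕ) {k k' : ℕ} {f f' : Code} (h : SameFace k f k' f') :
    facetsOf g k f = facetsOf g k' f' := by
  rcases h with ⟨rfl, rfl⟩ | ⟨rfl, h, rfl⟩ | ⟨rfl, h, rfl⟩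
  · rfl
  · exact facetsOf_glue g k h
  · rw [facetsOf_glue g k' (flip_below_topW.2 h), flip_flip]

lemma exists_facet_index {g k : ℕ} {f : Code} (hf : IsFaceCode g k f) :
    ∃ j, FacetCode j ∧ f ≼ j ∧ (j = botW → k = 0) ∧ (j = topW → k + 1 = g) := by
  by_cases hb : f = botW
  · subst hb
    exact ⟨botW, facetCode_botW, Below.refl _, hf.2.2.1, hf.2.2.2⟩
  by_cases ht : f = topW
  · subst ht
    exact ⟨topW, facetCode_topW, Below.refl _, hf.2.2.1, hf.2.2.2⟩
  obtain ⟨j, h1, h2, h3, h4⟩ := exists_facet_ne_wall f hf.2.1 ht hb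
  exact ⟨j, h1, h2, fun e => absurd e h4, fun e => absurd e h3⟩

/-- Every subface of a face has a code in the same copy. -/
lemma exists_code_below {g k k' : ℕ} {f f' : Code} (hf : IsFaceCode g k f)
    (hsub : facetsOf g k f ⊆ facetsOf g k' f') : ∃ h, h ≼ f ∧ SameFace k' f' k h := by
  obtain ⟨j, hj, hfj, hb, ht⟩ := exists_facet_index hf
  have hJ : (⟨(⟨k, hf.1⟩, j), hj, hb, ht⟩ : FacetIndex g) ∈ facetsOf g k' f' :=
    hsub (Or.inl ⟨rfl, hfj⟩)
  obtain ⟨h, hh⟩ : ∃ h, SameFace k' f' k h := by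
    rcases hJ with ⟨e, -⟩ | ⟨e, h, -⟩ | ⟨e, h, -⟩
    · exact ⟨f', Or.inl ⟨e, rfl⟩⟩
    · exact ⟨flip f', Or.inr (Or.inr ⟨e, h, rfl⟩)⟩
    · exact ⟨flip f', Or.inr (Or.inl ⟨e, h, rfl⟩)⟩
  refine ⟨h, ?_, hh⟩
  rw [hh.facetsOf_eq] at hsub
  exact (facetsOf_subset_iff hf).1 hsub

lemma Fc_subset_iff' {g k k' : ℕ} {f f' : Code} (hk' : k' < g) :
    Fc g k' f' ⊆ Fc g k f ↔ facetsOf g k f ⊆ facetsOf g k' f' := by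
  obtain ⟨x, hx, hxt⟩ := exists_tight_eq hk' f'
  rw [Fc, ← hxt]
  exact strat_subset_iff hx

lemma Fc_subset_iff {g k : ℕ} {f h : Code} (hf : IsFaceCode g k f) :
    Fc g k h ⊆ Fc g k f ↔ h ≼ f := by
  rw [Fc_subset_iff' hf.1, facetsOf_subset_iff hf]

lemma exists_code_of_subset {g k k' : ℕ} {f f' : Code} (hf : IsFaceCode g k f) (hk' : k' < g)
    (hsub : Fc g k' f' ⊆ Fc g k f) : ∃ h, h ≼ f ∧ SameFace k' f' k h :=
  exists_code_below hf ((Fc_subset_iff' hk').1 hsub)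

lemma SameFace.Fc_eq (g : ℕ) {k k' : ℕ} {f f' : Code} (h : SameFace k f k' f') :
    Fc g k f = Fc g k' f' := by rw [Fc, h.facetsOf_eq]; rfl

/-- The only ambiguity of codes is the gluing of consecutive copies along walls. -/
lemma Fc_eq_iff {g k k' : ℕ} {f f' : Code} (hf : IsFaceCode g k f) (hf' : IsFaceCode g k' f') :
    Fc g k f = Fc g k' f' ↔ SameFace k f k' f' := by
  refine ⟨fun h => ?_, fun h => h.Fc_eq g⟩
  obtain ⟨h1, hh, hs⟩ := exists_code_of_subset hf' hf.1 h.le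
  have := hs.Fc_eq g
  rw [h] at this
  have e : f' ≼ h1 := (Fc_subset_iff (hf'.of_below hh)).1 this.le
  rwa [hh.antisymm e] at hs

lemma Fc_injective {g k : ℕ} {f f' : Code} (hf : IsFaceCode g k f) (hf' : IsFaceCode g k f')
    (h : Fc g k f = Fc g k f') : f = f' :=
  ((Fc_subset_iff hf').1 h.le).antisymm ((Fc_subset_iff hf).1 h.ge)

/-- The faces of the chain. -/
lemma isFace_ne_iff {g : ℕ} (hg : 0 < g) {F : Set E4} :
    IsFace (poly (ineq g)) F ∧ F ≠ poly (ineq g) ↔ ∃ k f, IsFaceCode g k f ∧ F = Fc g k f := by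
  constructor
  · rintro ⟨hF, hne⟩
    obtain ⟨x, hx, rfl⟩ := isFace_poly_iff.1 hF
    obtain ⟨k, hk, f, hkf, -⟩ := exists_code_of_mem hg hx
    refine ⟨k, f, isFaceCode_of_facetsOf hk ?_, by rw [hkf]; rfl⟩
    by_contra hn
    rw [not_nonempty_iff_eq_empty] at hn
    rw [hkf, hn, strat_empty] at hne
    exact hne rfl
  · rintro ⟨k, f, hf, rfl⟩
    obtain ⟨x, hx, hxt⟩ := exists_tight_eq hf.1 f
    obtain ⟨j, h1, h2, h3, h4⟩ := exists_facet_index hf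
    have hne : (tight (ineq g) x).Nonempty := by
      rw [hxt]
      exact ⟨⟨(⟨k, hf.1⟩, j), h1, h3, h4⟩, Or.inl ⟨rfl, h2⟩⟩
    obtain ⟨x0, hx0⟩ := exists_interior hg
    rw [Fc, ← hxt]
    exact ⟨isFace_poly_iff.2 ⟨x, hx, rfl⟩, strat_ne_poly hx0 hne⟩

lemma isFace_Fc {g k : ℕ} {f : Code} (hf : IsFaceCode g k f) :
    IsFace (poly (ineq g)) (Fc g k f) :=
  ((isFace_ne_iff (by have := hf.1; omega)).2 ⟨k, f, hf, rfl⟩).1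

lemma Fc_ne_poly {g k : ℕ} {f : Code} (hf : IsFaceCode g k f) : Fc g k f ≠ poly (ineq g) :=
  ((isFace_ne_iff (by have := hf.1; omega)).2 ⟨k, f, hf, rfl⟩).2

lemma isFace_Fc_iff {g k : ℕ} {f : Code} (hf : IsFaceCode g k f) {G : Set E4} :
    IsFace (Fc g k f) G ↔ ∃ h, h ≼ f ∧ G = Fc g k h := by
  rw [isFace_face_iff (isFace_Fc hf)]
  constructor
  · rintro ⟨hG, hsub⟩
    have hne : G ≠ poly (ineq g) := by
      rintro rfl
      exact Fc_ne_poly hf (Subset.antisymm (fun x hx => hx.1) hsub)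
    obtain ⟨k', f', hf', rfl⟩ := (isFace_ne_iff (by have := hf.1; omega)).1 ⟨hG, hne⟩
    obtain ⟨h, hh, hs⟩ := exists_code_of_subset hf hf'.1 hsub
    exact ⟨h, hh, hs.Fc_eq g⟩
  · rintro ⟨h, hh, rfl⟩
    exact ⟨isFace_Fc (hf.of_below hh), (Fc_subset_iff hf).2 hh⟩

lemma vpt_glue (k : ℕ) {v : Code} (hv : VertexCode v) (h : v ≼ botW) :
    vpt (k + 1) v = vpt k (flip v) := by
  unfold vpt
  rw [← boost_hvert_wall hv h, boost_boost (by positivity) (by positivity), pow_succ]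

lemma vpt_sameFace {k k' : ℕ} {f f' : Code} (h : SameFace k f k' f') :
    vpt k '' verts f ⊆ vpt k' '' verts f' := by
  rintro _ ⟨v, ⟨hv, hvf⟩, rfl⟩
  rcases h with ⟨rfl, rfl⟩ | ⟨rfl, h, rfl⟩ | ⟨rfl, h, rfl⟩
  · exact ⟨v, ⟨hv, hvf⟩, rfl⟩
  · refine ⟨flip v, ⟨hv.flip, hvf.flip⟩, ?_⟩
    rw [vpt_glue k hv.flip (flip_below_botW.2 (hvf.trans h)), flip_flip]
  · exact ⟨flip v, ⟨hv.flip, hvf.flip⟩, (vpt_glue k' hv (hvf.trans h)).symm⟩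

lemma verts_mono {f h : Code} (hh : h ≼ f) : verts h ⊆ verts f := fun _ hv => ⟨hv.1, hv.2.trans hh⟩

lemma vpt_mem_Fc {g k : ℕ} (hk : k < g) {f v : Code} (hv : v ∈ verts f) : vpt k v ∈ Fc g k f := by
  refine ⟨vpt_mem hk hv.1, ?_⟩
  rw [tight_vpt hk hv.1]
  exact fun J hJ => Inc.mono hJ hv.2

/-- A face is the convex hull of its vertices. -/
lemma Fc_eq_convexHull {g k : ℕ} {f : Code} (hf : IsFaceCode g k f) :
    Fc g k f = convexHull ℝ (vpt k '' verts f) := by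
  refine Subset.antisymm (fun x hx => ?_) (convexHull_min ?_ (strat_convex _ _))
  · obtain ⟨m, hm, f', hmf, hxm⟩ := exists_code_of_mem (by have := hf.1; omega) hx.1
    obtain ⟨h, hh, hs⟩ := exists_code_below hf (hmf ▸ hx.2)
    exact convexHull_mono ((vpt_sameFace hs).trans (image_mono (verts_mono hh))) hxm
  · rintro _ ⟨v, hv, rfl⟩
    exact vpt_mem_Fc hf.1 hv

/-- The set of the vertices of the chain. -/
def vertexSet (g : ℕ) : Set E4 := {x | ∃ k < g, ∃ v, VertexCode v ∧ x = vpt k v}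

lemma vertexSet_finite (g : ℕ) : (vertexSet g).Finite := by
  refine (((finite_lt_nat g).prod (finite_univ (α := Code))).image fun p => vpt p.1 p.2).subset ?_
  rintro x ⟨k, hk, v, -, rfl⟩
  exact ⟨(k, v), ⟨hk, trivial⟩, rfl⟩

lemma poly_eq_convexHull {g : ℕ} (hg : 0 < g) :
    poly (ineq g) = convexHull ℝ (vertexSet g) := by
  refine Subset.antisymm (fun x hx => ?_) (convexHull_min ?_ (poly_convex _))
  · obtain ⟨m, hm, f', -, hxm⟩ := exists_code_of_mem hg hx
    refine convexHull_mono ?_ hxm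
    rintro _ ⟨v, hv, rfl⟩
    exact ⟨m, hm, v, hv.1, rfl⟩
  · rintro _ ⟨k, hk, v, hv, rfl⟩
    exact vpt_mem hk hv

lemma poly_bounded {g : ℕ} (hg : 0 < g) : Bornology.IsBounded (poly (ineq g)) := by
  rw [poly_eq_convexHull hg]
  exact ((vertexSet_finite g).isCompact_convexHull ℝ).isBounded

end Faces

/-! ### Dimensions of faces -/

section Dimension

lemma exists_below_rank : ∀ f : Code, rank f ≠ 0 → ∃ i : Fin 5, rank (Function.update f i 1) + 1 = rank f ∧
    f i = 0 := by
  refine forall_code ?_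
  decide +kernel

/-- The larger face avoids both walls, so it is a face of the chain whichever walls have been glued.
-/
lemma exists_above_rank : ∀ f : Code, Valid f → rank f < 3 →
    ∃ i : Fin 5, rank (Function.update f i 0) = rank f + 1 ∧ Valid (Function.update f i 0) ∧
      Function.update f i 0 ≠ topW ∧ Function.update f i 0 ≠ botW := by
  refine forall_code ?_
  decide +kernel

lemma below_update_zero (f : Code) (i : Fin 5) : f ≼ Function.update f i 0 := fun j => by
  by_cases h : j = i
  · subst h; simp
  · right; simp [h]

lemma update_below {f : Code} {i : Fin 5} (hi : f i = 0) (s : SignType) :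
    Function.update f i s ≼ f := fun j => by
  by_cases h : j = i
  · subst h; exact Or.inl hi
  · right; simp [h]

lemma dim_Fc_lt {g k : ℕ} {f h : Code} (hf : IsFaceCode g k f) (hh : h ≼ f)
    (hr : rank h < rank f) : dim (Fc g k h) < dim (Fc g k f) := by
  obtain ⟨x, hx, hxt⟩ := exists_tight_eq hf.1 f
  obtain ⟨y, hy, hyt⟩ := exists_tight_eq hf.1 h
  rw [Fc, Fc, ← hxt, ← hyt]
  refine dim_lt_of_ssubset hx ?_ hy
  rw [hxt, hyt]
  refine ⟨(facetsOf_subset_iff hf).2 hh, fun hsub => ?_⟩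
  have := (facetsOf_subset_iff (hf.of_below hh)).1 hsub
  have := this.rank_le
  omega

lemma dim_Fc_lt_poly {g k : ℕ} {f : Code} (hf : IsFaceCode g k f) :
    dim (Fc g k f) < dim (poly (ineq g)) := by
  obtain ⟨x, hx⟩ := exists_interior (g := g) (by have := hf.1; omega)
  obtain ⟨y, hy, hyt⟩ := exists_tight_eq hf.1 f
  obtain ⟨j, h1, h2, h3, h4⟩ := exists_facet_index hf
  have hxt : tight (ineq g) x = ∅ := by
    ext J; simpa using (hx J).ne
  have hne : (facetsOf g k f).Nonempty := ⟨⟨(⟨k, hf.1⟩, j), h1, h3, h4⟩, Or.inl ⟨rfl, h2⟩⟩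
  have := dim_lt_of_ssubset (ℓ := ineq g) (x := x) (y := y) (fun J => (hx J).le) (by
    rw [hxt, hyt]
    exact ssubset_of_subset_of_ne (empty_subset _)
      hne.ne_empty.symm) hy
  rwa [hxt, hyt, strat_empty] at this

lemma dim_poly_le (g : ℕ) : dim (poly (ineq g)) ≤ 4 := by
  have := Submodule.finrank_le (vectorSpan ℝ (poly (ineq g)))
  rw [finrank_euclideanSpace_fin] at this
  exact this

lemma le_dim_Fc {g k : ℕ} : ∀ (n : ℕ) (f : Code), rank f = n → IsFaceCode g k f →
    n ≤ dim (Fc g k f) := by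
  intro n
  induction n with
  | zero => intro f _ _; exact Nat.zero_le _
  | succ n ih =>
    intro f hn hf
    obtain ⟨i, hi, hi0⟩ := exists_below_rank f (by omega)
    have hb := update_below hi0 1
    have h1 := ih _ (by omega) (hf.of_below hb)
    have h2 := dim_Fc_lt hf hb (by omega)
    omega

lemma dim_Fc_le {g k : ℕ} : ∀ (n : ℕ) (f : Code), rank f + n = 3 → IsFaceCode g k f →
    dim (Fc g k f) + n < dim (poly (ineq g)) := by
  intro n
  induction n with
  | zero => intro f _ hf; exact dim_Fc_lt_poly hf
  | succ n ih =>
    intro f hn hf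
    obtain ⟨i, h1, h2, h3, h4⟩ := exists_above_rank f hf.2.1 (by omega)
    have hf' : IsFaceCode g k (Function.update f i 0) :=
      ⟨hf.1, h2, fun e => absurd e h4, fun e => absurd e h3⟩
    have h5 := ih _ (by omega) hf'
    have h6 := dim_Fc_lt hf' (below_update_zero f i) (by omega)
    omega

/-- Dimension grows strictly along inclusions of faces. A chain of subfaces down to a vertex bounds
it below, and a chain up to the polytope, whose dimension is at most 4, bounds it above. -/
lemma dim_Fc {g k : ℕ} {f : Code} (hf : IsFaceCode g k f) : dim (Fc g k f) = rank f := by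
  have h1 := le_dim_Fc _ f rfl hf
  have h2 := dim_Fc_le (3 - rank f) f (by have := rank_le_three hf.2.1; omega) hf
  have h3 := dim_poly_le g
  have := rank_le_three hf.2.1
  omega

lemma dim_poly {g : ℕ} (hg : 0 < g) : dim (poly (ineq g)) = 4 := by
  have hf : IsFaceCode g 0 ![0, 0, 1, 0, -1] :=
    ⟨hg, by decide, fun e => absurd e (by decide), fun e => absurd e (by decide)⟩
  have h1 := dim_Fc_lt_poly hf
  rw [dim_Fc hf, show rank ![0, 0, 1, 0, -1] = 3 by decide] at h1
  have := dim_poly_le g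
  omega

end Dimension

/-! ### Proper faces are combinatorial cubes -/

section Cubes

/-- Two partial orders parametrized by the same labels with the same induced preorder are
isomorphic; the labels are typically sign vectors or cells. -/
lemma orderIso_of_surjective {A B C : Type*} [PartialOrder B] [PartialOrder C] {φ : A → B}
    {ψ : A → C} (hφ : Function.Surjective φ) (hψ : Function.Surjective ψ)
    (h : ∀ a a', φ a ≤ φ a' ↔ ψ a ≤ ψ a') :
    ∃ e : B ≃o C, ∀ a, e (φ a) = ψ a := by
  choose s hs using hφ
  have hle : ∀ b b', ψ (s b) ≤ ψ (s b') ↔ b ≤ b' := fun b b' => by rw [← h, hs, hs]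
  have hval : ∀ a, ψ (s (φ a)) = ψ a := fun a =>
    le_antisymm ((h _ _).1 (hs _).le) ((h _ _).1 (hs _).ge)
  refine ⟨RelIso.ofSurjective (OrderEmbedding.ofMapLEIff (fun b => ψ (s b)) hle) fun c => ?_, hval⟩
  obtain ⟨a, rfl⟩ := hψ c
  exact ⟨φ a, hval a⟩

/-- The inequalities `± xᵢ ≤ 1` of the standard cube. -/
noncomputable def cubeIneq (n : ℕ) (p : Fin n × ℤˣ) : EuclideanSpace ℝ (Fin n) →ᵃ[ℝ] ℝ :=
  (((p.2 : ℤ) : ℝ) • (EuclideanSpace.proj (𝕜 := ℝ) p.1).toLinearMap).toAffineMap -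
    AffineMap.const ℝ _ 1

lemma cubeIneq_apply (n : ℕ) (p : Fin n × ℤˣ) (x : EuclideanSpace ℝ (Fin n)) :
    cubeIneq n p x = ((p.2 : ℤ) : ℝ) * x p.1 - 1 := by
  simp [cubeIneq]

lemma poly_cubeIneq (n : ℕ) : poly (cubeIneq n) = stdCube n := by
  ext x
  simp only [poly, stdCube, mem_ofPred_eq, cubeIneq_apply]
  constructor
  · intro h i
    have h1 := h (i, 1)
    have h2 := h (i, -1)
    simp at h1 h2
    exact ⟨by linarith, by linarith⟩
  · rintro h ⟨i, s⟩
    obtain ⟨h1, h2⟩ := h i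
    rcases Int.units_eq_one_or s with rfl | rfl
    · simp; linarith
    · simp; linarith

/-- The center of the face of the standard cube with the given signs. -/
noncomputable def cubePoint {n : ℕ} (c : Fin n → SignType) : EuclideanSpace ℝ (Fin n) :=
  WithLp.toLp 2 fun i => (c i : ℝ)

lemma cubePoint_mem {n : ℕ} (c : Fin n → SignType) : cubePoint c ∈ poly (cubeIneq n) := by
  rw [poly_cubeIneq]
  intro i
  have : cubePoint c i = (c i : ℝ) := rfl
  rw [this]
  generalize c i = s
  rcases s with _ | _ | _ <;> norm_num [SignType.cast]

lemma mem_tight_cubePoint {n : ℕ} (c : Fin n → SignType) (i : Fin n) (s : ℤˣ) :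
    (i, s) ∈ tight (cubeIneq n) (cubePoint c) ↔ c i ≠ 0 ∧ ((c i : ℤ) = s) := by
  have : cubePoint c i = (c i : ℝ) := rfl
  rw [mem_tight, cubeIneq_apply, this]
  generalize c i = t
  rcases Int.units_eq_one_or s with rfl | rfl <;> cases t <;>
    norm_num [SignType.cast]

lemma tight_cubePoint_subset_iff {n : ℕ} (c c' : Fin n → SignType) :
    tight (cubeIneq n) (cubePoint c') ⊆ tight (cubeIneq n) (cubePoint c) ↔
      ∀ i, c' i = 0 ∨ c i = c' i := by
  have key : ∀ a b : SignType, (∀ s : ℤˣ, (b ≠ 0 ∧ (b : ℤ) = s) → (a ≠ 0 ∧ (a : ℤ) = s)) ↔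
      (b = 0 ∨ a = b) := by decide
  constructor
  · intro h i
    rw [← key]
    intro s hs
    exact (mem_tight_cubePoint c i s).1 (h ((mem_tight_cubePoint c' i s).2 hs))
  · rintro h ⟨i, s⟩ hs
    rw [mem_tight_cubePoint] at hs ⊢
    exact (key _ _).2 (h i) s hs

lemma exists_cubePoint {n : ℕ} (x : EuclideanSpace ℝ (Fin n)) :
    ∃ c, tight (cubeIneq n) (cubePoint c) = tight (cubeIneq n) x := by
  refine ⟨fun i => if x i = 1 then 1 else if x i = -1 then -1 else 0, ?_⟩
  ext ⟨i, s⟩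
  rw [mem_tight_cubePoint, mem_tight, cubeIneq_apply]
  rcases Int.units_eq_one_or s with rfl | rfl
  · by_cases h1 : x i = 1
    · simp [h1]
    · by_cases h2 : x i = -1
      · simp [h2]; norm_num
      · simp [h1, h2, sub_eq_zero]
  · by_cases h1 : x i = 1
    · simp [h1]; norm_num
    · by_cases h2 : x i = -1
      · have : (-1 : ℝ) ≠ 1 := by norm_num
        simp [h2, this]
      · have : -x i - 1 ≠ 0 := fun h => h2 (by linarith)
        simp [h1, h2, this]

/-- The face of the standard cube with the given signs. -/
noncomputable def cubeFace {n : ℕ} (c : Fin n → SignType) :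
    {G : Set (EuclideanSpace ℝ (Fin n)) // IsFace (stdCube n) G} :=
  ⟨strat (cubeIneq n) (tight (cubeIneq n) (cubePoint c)), by
    rw [← poly_cubeIneq]; exact isFace_poly_iff.2 ⟨_, cubePoint_mem c, rfl⟩⟩

lemma cubeFace_surjective (n : ℕ) : Function.Surjective (cubeFace (n := n)) := by
  rintro ⟨G, hG⟩
  have hG' := hG
  rw [← poly_cubeIneq] at hG'
  obtain ⟨x, hx, rfl⟩ := isFace_poly_iff.1 hG'
  obtain ⟨c, hc⟩ := exists_cubePoint x
  exact ⟨c, Subtype.ext (congrArg (strat (cubeIneq n)) hc)⟩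

lemma cubeFace_le_iff {n : ℕ} (c c' : Fin n → SignType) :
    cubeFace c ≤ cubeFace c' ↔ ∀ i, c' i = 0 ∨ c i = c' i :=
  (strat_subset_iff (cubePoint_mem c)).trans (tight_cubePoint_subset_iff c c')

/-- Every proper face of the chain is a combinatorial cube. -/
lemma isCombinatorialCube_Fc {g k : ℕ} {f : Code} (hf : IsFaceCode g k f) :
    IsCombinatorialCube (dim (Fc g k f)) (Fc g k f) := by
  rw [dim_Fc hf]
  have hcard : Fintype.card {i // f i = 0} = rank f := by
    rw [Fintype.card_subtype]; rfl
  let e : Fin (rank f) ≃ {i // f i = 0} := (Fintype.equivFinOfCardEq hcard).symm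
  -- The subfaces of `f` are the sign vectors on its free coordinates, exactly as for the standard
  -- cube.
  let fill : (Fin (rank f) → SignType) → Code := fun c i =>
    if h : f i = 0 then c (e.symm ⟨i, h⟩) else f i
  have hfill : ∀ c, fill c ≼ f := fun c i => by
    by_cases h : f i = 0
    · exact Or.inl h
    · right; simp [fill, h]
  have hle : ∀ c c', fill c ≼ fill c' ↔ ∀ i, c' i = 0 ∨ c i = c' i := fun c c' => by
    constructor
    · intro h i
      have := h (e i).1
      simpa [fill, (e i).2] using this
    · intro h i
      by_cases h0 : f i = 0
      · simpa [fill, h0] using h (e.symm ⟨i, h0⟩)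
      · right; simp [fill, h0]
  let φ : (Fin (rank f) → SignType) → {G : Set E4 // IsFace (Fc g k f) G} := fun c =>
    ⟨Fc g k (fill c), (isFace_Fc_iff hf).2 ⟨_, hfill c, rfl⟩⟩
  have hφ : Function.Surjective φ := by
    rintro ⟨G, hG⟩
    obtain ⟨h, hh, rfl⟩ := (isFace_Fc_iff hf).1 hG
    refine ⟨fun i => h (e i).1, Subtype.ext ?_⟩
    show Fc g k _ = _
    congr 1
    funext i
    by_cases h0 : f i = 0
    · simp [fill, h0]
    · simpa [fill, h0] using (hh.apply_ne_zero h0).symm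
  obtain ⟨e, -⟩ := orderIso_of_surjective hφ (cubeFace_surjective _) fun c c' => by
    rw [cubeFace_le_iff, ← hle]
    exact Fc_subset_iff (hf.of_below (hfill c'))
  exact ⟨e⟩

lemma isCubicalPolytope_chain {g : ℕ} (hg : 0 < g) : IsCubicalPolytope 4 (poly (ineq g)) := by
  refine ⟨⟨?_, ⟨vertexSet g, vertexSet_finite g, poly_eq_convexHull hg⟩, dim_poly hg⟩,
    fun F hF hne => ?_⟩
  · obtain ⟨x, hx⟩ := exists_interior hg
    exact ⟨x, fun J => (hx J).le⟩
  · obtain ⟨k, f, hf, rfl⟩ := (isFace_ne_iff hg).1 ⟨hF, hne⟩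
    exact isCombinatorialCube_Fc hf

end Cubes

/-! ### Counting faces -/

section Counting

/-- A face in a shared wall is always named from the later copy, so that each face gets exactly one
name. -/
lemma exists_normal_code {g k : ℕ} {f : Code} (hf : IsFaceCode g k f) :
    ∃ k' f', IsFaceCode g k' f' ∧ SameFace k f k' f' ∧ (f' ≼ topW → k' + 1 = g) := by
  by_cases h : f ≼ topW ∧ k + 1 ≠ g
  · obtain ⟨h, hk⟩ := h
    refine ⟨k + 1, flip f, ⟨by have := hf.1; omega, hf.2.1.flip, fun e => ?_, fun e => ?_⟩,
      Or.inr (Or.inl ⟨rfl, h, rfl⟩), fun h' => ?_⟩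
    · exact absurd (hf.2.2.2 (flip_eq_botW.1 e)) hk
    · rw [flip_eq_topW.1 e] at h
      exact absurd h not_botW_below_topW
    · exact (not_below_both h (flip_below_topW.1 h')).elim
  · exact ⟨k, f, hf, Or.inl ⟨rfl, rfl⟩, fun h' => by_contra fun hk => h ⟨h', hk⟩⟩

lemma SameFace.eq_of_normal {g k k' : ℕ} {f f' : Code} (h : SameFace k f k' f') (hk : k < g)
    (hk' : k' < g) (hn : f ≼ topW → k + 1 = g) (hn' : f' ≼ topW → k' + 1 = g) :
    k = k' ∧ f = f' := by
  rcases h with h | ⟨rfl, h, -⟩ | ⟨rfl, h, rfl⟩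
  · exact h
  · have := hn h; omega
  · have := hn' (flip_below_topW.2 h); omega

lemma SameFace.iff_of_flip {p : Code → Prop} (hp : ∀ f, p (flip f) ↔ p f) {k k' : ℕ} {f f' : Code}
    (h : SameFace k f k' f') : p f ↔ p f' := by
  rcases h with ⟨-, rfl⟩ | ⟨-, -, rfl⟩ | ⟨-, -, rfl⟩
  · rfl
  · exact (hp f).symm
  · exact (hp f).symm

/-- The number of the faces of the chain whose codes satisfy `p`. -/
lemma ncard_faces {g : ℕ} (hg : 0 < g) (p : Code → Prop) [DecidablePred p]
    (hp : ∀ f, p (flip f) ↔ p f) :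
    {F | ∃ k f, IsFaceCode g k f ∧ p f ∧ F = Fc g k f}.ncard =
      g * (Finset.univ.filter fun f => Valid f ∧ p f ∧ ¬ f ≼ topW ∧ f ≠ botW).card +
      (Finset.univ.filter fun f => Valid f ∧ p f ∧ (f ≼ topW ∨ f = botW)).card := by
  classical
  -- Every copy contributes its faces off the top wall, the bottom wall itself excluded. The
  -- remaining faces are the bottom wall of copy `0` and the top wall of copy `g - 1` with its
  -- subfaces.
  set N : Finset (ℕ × Code) := (Finset.range g ×ˢ
      Finset.univ.filter fun f => Valid f ∧ p f ∧ ¬ f ≼ topW ∧ f ≠ botW) ∪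
    (Finset.univ.filter fun f => Valid f ∧ p f ∧ (f ≼ topW ∨ f = botW)).image
      (fun f => (if f = botW then 0 else g - 1, f)) with hN
  have hmem : ∀ k f, (k, f) ∈ N ↔ IsFaceCode g k f ∧ p f ∧ (f ≼ topW → k + 1 = g) := by
    intro k f
    simp only [hN, Finset.mem_union, Finset.mem_product, Finset.mem_range, Finset.mem_filter,
      Finset.mem_univ, true_and, Finset.mem_image, Prod.mk.injEq, IsFaceCode]
    constructor
    · rintro (⟨h1, h2, h3, h4, h5⟩ | ⟨f', ⟨h2, h3, h4⟩, h5, rfl⟩)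
      · exact ⟨⟨h1, h2, fun e => absurd e h5, fun e => absurd (e ▸ Below.refl _) h4⟩, h3,
          fun e => absurd e h4⟩
      · by_cases hb : f' = botW
        · rw [if_pos hb] at h5
          subst h5 hb
          exact ⟨⟨hg, h2, fun _ => rfl, fun e => absurd e botW_ne_topW⟩, h3,
            fun e => absurd e not_botW_below_topW⟩
        · rw [if_neg hb] at h5
          subst h5
          exact ⟨⟨by omega, h2, fun e => absurd e hb, fun _ => by omega⟩, h3, fun _ => by omega⟩
    · rintro ⟨⟨h1, h2, h3, h4⟩, h5, h6⟩
      by_cases hb : f = botW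
      · right
        exact ⟨f, ⟨h2, h5, Or.inr hb⟩, by rw [if_pos hb, h3 hb], rfl⟩
      · by_cases ht : f ≼ topW
        · right
          refine ⟨f, ⟨h2, h5, Or.inl ht⟩, ?_, rfl⟩
          have := h6 ht
          rw [if_neg hb]; omega
        · exact Or.inl ⟨h1, h2, h5, ht, hb⟩
  have hset : {F | ∃ k f, IsFaceCode g k f ∧ p f ∧ F = Fc g k f} =
      (fun q : ℕ × Code => Fc g q.1 q.2) '' (N : Set (ℕ × Code)) := by
    ext F
    constructor
    · rintro ⟨k, f, hf, hpf, rfl⟩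
      obtain ⟨k', f', hf', hs, hn⟩ := exists_normal_code hf
      exact ⟨(k', f'), (hmem _ _).2 ⟨hf', (hs.iff_of_flip hp).1 hpf, hn⟩, (hs.Fc_eq g).symm⟩
    · rintro ⟨⟨k, f⟩, h, rfl⟩
      obtain ⟨h1, h2, -⟩ := (hmem _ _).1 h
      exact ⟨k, f, h1, h2, rfl⟩
  have hinj : InjOn (fun q : ℕ × Code => Fc g q.1 q.2) (N : Set (ℕ × Code)) := by
    rintro ⟨k, f⟩ h ⟨k', f'⟩ h' e
    obtain ⟨h1, -, h2⟩ := (hmem _ _).1 h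
    obtain ⟨h3, -, h4⟩ := (hmem _ _).1 h'
    obtain ⟨rfl, rfl⟩ := ((Fc_eq_iff h1 h3).1 e).eq_of_normal h1.1 h3.1 h2 h4
    rfl
  rw [hset, hinj.ncard_image, ncard_coe_finset, hN, Finset.card_union_of_disjoint,
    Finset.card_product, Finset.card_range, Finset.card_image_of_injective]
  · exact fun f f' h => congrArg Prod.snd h
  · rw [Finset.disjoint_left]
    rintro ⟨k, f⟩ h h'
    simp only [Finset.mem_product, Finset.mem_filter, Finset.mem_image, Prod.mk.injEq] at h h'
    obtain ⟨f', ⟨-, -, -, h1⟩, -, rfl⟩ := h'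
    exact h1.elim h.2.2.2.2.1 h.2.2.2.2.2

/-- The number of the faces of a copy whose codes satisfy `p`. -/
lemma ncard_faces_copy {g k : ℕ} (hk : k < g) (p : Code → Prop) [DecidablePred p]
    (hp : ∀ f, p f → f ≠ botW ∧ f ≠ topW) :
    {F | ∃ f, IsFaceCode g k f ∧ p f ∧ F = Fc g k f}.ncard =
      (Finset.univ.filter fun f => Valid f ∧ p f).card := by
  have hcode : ∀ f, Valid f ∧ p f → IsFaceCode g k f := fun f h =>
    ⟨hk, h.1, fun e => absurd e (hp f h.2).1, fun e => absurd e (hp f h.2).2⟩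
  have hset : {F | ∃ f, IsFaceCode g k f ∧ p f ∧ F = Fc g k f} =
      Fc g k '' ((Finset.univ.filter fun f => Valid f ∧ p f : Finset Code) : Set Code) := by
    ext F
    simp only [Finset.coe_filter, Finset.mem_univ, true_and]
    constructor
    · rintro ⟨f, hf, hpf, rfl⟩
      exact ⟨f, ⟨hf.2.1, hpf⟩, rfl⟩
    · rintro ⟨f, hf, rfl⟩
      exact ⟨f, hcode f hf, hf.2, rfl⟩
  rw [hset, InjOn.ncard_image, ncard_coe_finset]
  intro f hf f' hf' e
  simp only [Finset.coe_filter, Finset.mem_univ, true_and] at hf hf'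
  exact Fc_injective (hcode f hf) (hcode f' hf') e

lemma fNum_chain {g : ℕ} (hg : 0 < g) {n : ℕ} (hn : n ≤ 3) : fNum (poly (ineq g)) n =
      g * (Finset.univ.filter fun f => Valid f ∧ rank f = n ∧ ¬ f ≼ topW ∧ f ≠ botW).card +
      (Finset.univ.filter fun f => Valid f ∧ rank f = n ∧ (f ≼ topW ∨ f = botW)).card := by
  rw [← ncard_faces hg (fun f => rank f = n) (fun f => by rw [rank_flip]), fNum]
  congr 1
  ext F
  constructor
  · rintro ⟨hF, hd⟩
    obtain ⟨k, f, hf, rfl⟩ := (isFace_ne_iff hg).1 ⟨hF, fun e => by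
      rw [e, dim_poly hg] at hd; omega⟩
    exact ⟨k, f, hf, (dim_Fc hf).symm.trans hd, rfl⟩
  · rintro ⟨k, f, hf, hr, rfl⟩
    exact ⟨isFace_Fc hf, (dim_Fc hf).trans hr⟩

lemma fVector_chain {g : ℕ} (hg : 0 < g) :
    fNum (poly (ineq g)) 0 = 24 * g + 8 ∧ fNum (poly (ineq g)) 1 = 68 * g + 12 ∧
      fNum (poly (ineq g)) 2 = 66 * g + 6 ∧ fNum (poly (ineq g)) 3 = 22 * g + 2 := by
  have h0 : (Finset.univ.filter fun f : Code => Valid f ∧ rank f = 0 ∧ ¬ f ≼ topW ∧ f ≠ botW).card = 24 ∧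
    (Finset.univ.filter fun f => Valid f ∧ rank f = 0 ∧ (f ≼ topW ∨ f = botW)).card = 8 := by
    decide +kernel
  have h1 : (Finset.univ.filter fun f : Code => Valid f ∧ rank f = 1 ∧ ¬ f ≼ topW ∧ f ≠ botW).card = 68 ∧
    (Finset.univ.filter fun f => Valid f ∧ rank f = 1 ∧ (f ≼ topW ∨ f = botW)).card = 12 := by
    decide +kernel
  have h2 : (Finset.univ.filter fun f : Code => Valid f ∧ rank f = 2 ∧ ¬ f ≼ topW ∧ f ≠ botW).card = 66 ∧
    (Finset.univ.filter fun f => Valid f ∧ rank f = 2 ∧ (f ≼ topW ∨ f = botW)).card = 6 := by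
    decide +kernel
  have h3 : (Finset.univ.filter fun f : Code => Valid f ∧ rank f = 3 ∧ ¬ f ≼ topW ∧ f ≠ botW).card = 22 ∧
    (Finset.univ.filter fun f => Valid f ∧ rank f = 3 ∧ (f ≼ topW ∨ f = botW)).card = 2 := by
    decide +kernel
  rw [fNum_chain hg (by norm_num), fNum_chain hg (by norm_num), fNum_chain hg (by norm_num),
    fNum_chain hg (by norm_num), h0.1, h0.2, h1.1, h1.2, h2.1, h2.2, h3.1, h3.2]
  omega

end Counting

/-! ### Parallel classes are coordinate directions -/

section Cells

/-- The carrier of a common point would be a subface of both and would need two different signs in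
the coordinate `i`. -/
lemma disjoint_Fc {g k : ℕ} {f h : Code} (hf : IsFaceCode g k f) (hh : IsFaceCode g k h)
    {i : Fin 5} (hfi : f i ≠ 0) (hhi : h i ≠ 0) (hne : f i ≠ h i) :
    Disjoint (Fc g k f) (Fc g k h) := by
  rw [Set.disjoint_left]
  intro x hx hx'
  obtain ⟨m, hm, c, hc, -⟩ := exists_code_of_mem (by have := hf.1; omega) hx.1
  obtain ⟨c', h1, h2⟩ := exists_code_below hf (hc ▸ hx.2)
  have h3 : facetsOf g k h ⊆ facetsOf g k c' := by
    rw [← h2.facetsOf_eq, ← hc]; exact hx'.2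
  have h4 := (facetsOf_subset_iff hh).1 h3
  exact hne ((h1.apply_ne_zero hfi).symm.trans (h4.apply_ne_zero hhi))

/-- One sign vector is turned into the other by changing one coordinate at a time. -/
lemma eqv_of_update {r : Code → Code → Prop} (hr : Equivalence r) {e e' : Code}
    (h : ∀ e1 i, (∀ j, e1 j = e j ∨ e1 j = e' j) → e i ≠ e' i → e1 i = e i →
      r e1 (Function.update e1 i (e' i))) : r e e' := by
  have key : ∀ (n : ℕ) (e1 : Code), (∀ j, e1 j = e j ∨ e1 j = e' j) →
      (Finset.univ.filter fun i => e1 i ≠ e' i).card = n → r e1 e' := by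
    intro n
    induction n with
    | zero =>
      intro e1 _ h0
      rw [Finset.card_eq_zero, Finset.filter_eq_empty_iff] at h0
      have : e1 = e' := funext fun i => by simpa using h0 (Finset.mem_univ i)
      rw [this]; exact hr.refl _
    | succ n ih =>
      intro e1 he1 hn
      obtain ⟨i, hi⟩ : (Finset.univ.filter fun i => e1 i ≠ e' i).Nonempty := by
        rw [← Finset.card_pos]; omega
      have hi' : e1 i ≠ e' i := (Finset.mem_filter.1 hi).2
      have hei : e1 i = e i := (he1 i).resolve_right hi'
      refine hr.trans (h e1 i he1 (hei ▸ hi') hei) (ih _ (fun j => ?_) ?_)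
      · by_cases hj : j = i
        · subst hj; right; simp
        · simpa [hj] using he1 j
      · have : (Finset.univ.filter fun j => Function.update e1 i (e' i) j ≠ e' j) =
            (Finset.univ.filter fun i => e1 i ≠ e' i).erase i := by
          ext j
          by_cases hj : j = i
          · subst hj; simp
          · simp [hj]
        rw [this, Finset.card_erase_of_mem hi, hn]; rfl
  exact key _ e (fun _ => Or.inl rfl) rfl

/-- The edges of direction `d` of a face. -/
def dirEdges (g k : ℕ) (f : Code) (d : Fin 5) : Set (Set E4) :=
  {G | ∃ e, e ≼ f ∧ rank e = 1 ∧ e d = 0 ∧ G = Fc g k e}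

lemma isEdge_Fc_iff {g k : ℕ} {f : Code} (hf : IsFaceCode g k f) {G : Set E4} :
    IsEdge (Fc g k f) G ↔ ∃ e, e ≼ f ∧ rank e = 1 ∧ G = Fc g k e := by
  rw [IsEdge, isFace_Fc_iff hf]
  constructor
  · rintro ⟨⟨e, he, rfl⟩, hd⟩
    exact ⟨e, he, by rwa [dim_Fc (hf.of_below he)] at hd, rfl⟩
  · rintro ⟨e, he, hr, rfl⟩
    exact ⟨⟨e, he, rfl⟩, by rwa [dim_Fc (hf.of_below he)]⟩

lemma exists_zero_of_rank {e : Code} (h : rank e = 1) : ∃ d, e d = 0 ∧ ∀ i, e i = 0 → i = d := by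
  obtain ⟨d, hd⟩ := Finset.card_eq_one.1 h
  have : ∀ i, e i = 0 ↔ i = d := fun i => by
    simpa using Finset.ext_iff.1 hd i
  exact ⟨d, (this d).2 rfl, fun i => (this i).1⟩

/-- Two edges of a square with different directions share a vertex, so disjoint ones have the same
direction. -/
lemma oppositeIn_dir {g k : ℕ} {f : Code} (hf : IsFaceCode g k f) {d : Fin 5} {G G' : Set E4}
    (h : OppositeIn (Fc g k f) G G') (hG : G ∈ dirEdges g k f d) : G' ∈ dirEdges g k f d := by
  obtain ⟨Q, hQ, hQ2, hGQ, hGQ', hdis⟩ := h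
  obtain ⟨q, hq, rfl⟩ := (isFace_Fc_iff hf).1 hQ
  have hqf := hf.of_below hq
  rw [dim_Fc hqf] at hQ2
  obtain ⟨e, he, her, hed, rfl⟩ := hG
  obtain ⟨e', he', her', rfl⟩ := (isEdge_Fc_iff hqf).1 hGQ'
  have heq : e ≼ q := (Fc_subset_iff hqf).1 hGQ.1.2.subset
  refine ⟨e', he'.trans hq, her', ?_, rfl⟩
  by_contra hd
  obtain ⟨z, hz, -⟩ := exists_zero_of_rank her'
  set v : Code := fun i => if e' i = 0 then e i else e' i with hv
  have h1 : v ≼ e' := fun i => by by_cases h : e' i = 0 <;> simp [hv, h]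
  have h2 : v ≼ e := fun i => by
    by_cases h : e' i = 0
    · right; simp [hv, h]
    by_cases h' : e i = 0
    · exact Or.inl h'
    right
    by_contra hne
    have hne' : e' i ≠ e i := by simpa [hv, h] using hne
    have hq0 : q i = 0 := by
      by_contra hq0
      exact hne' ((he'.apply_ne_zero hq0).trans (heq.apply_ne_zero hq0).symm)
    -- If the edges also disagreed in a coordinate other than their directions, the square would
    -- have three free coordinates.
    have hsub : ({i, d, z} : Finset (Fin 5)) ⊆ Finset.univ.filter fun i => q i = 0 := by
      intro j hj
      simp only [Finset.mem_insert, Finset.mem_singleton] at hj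
      simp only [Finset.mem_filter, Finset.mem_univ, true_and]
      rcases hj with rfl | rfl | rfl
      · exact hq0
      · exact heq.apply_eq_zero hed
      · exact he'.apply_eq_zero hz
    have hc := Finset.card_le_card hsub
    rw [Finset.card_eq_three.2 ⟨i, d, z, fun e => h' (e ▸ hed), fun e => h (e ▸ hz),
      fun e => hd (e ▸ hz), rfl⟩] at hc
    unfold rank at hQ2
    omega
  obtain ⟨x, hx, hxt⟩ := exists_tight_eq hf.1 v
  have hxv : x ∈ Fc g k v := ⟨hx, hxt.ge⟩
  exact Set.disjoint_left.1 hdis ((Fc_subset_iff (hf.of_below he)).2 h2 hxv)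
    ((Fc_subset_iff (hqf.of_below he')).2 h1 hxv)

lemma OppositeIn.symm {E : Type*} [NormedAddCommGroup E] [NormedSpace ℝ E] {F e e' : Set E}
    (h : OppositeIn F e e') : OppositeIn F e' e := by
  obtain ⟨G, h1, h2, h3, h4, h5⟩ := h
  exact ⟨G, h1, h2, h4, h3, h5.symm⟩

lemma iff_of_eqvGen {α : Type*} {r : α → α → Prop} {p : α → Prop} (h : ∀ a b, r a b → (p a ↔ p b))
    {a b : α} (hab : Relation.EqvGen r a b) : p a ↔ p b := by
  induction hab with
  | rel a b hab => exact h a b hab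
  | refl a => rfl
  | symm a b _ ih => exact ih.symm
  | trans a b c _ _ ih ih' => exact ih.trans ih'

lemma rank_update_zero {e : Code} {i : Fin 5} (hi : e i ≠ 0) :
    rank (Function.update e i 0) = rank e + 1 := by
  have : (Finset.univ.filter fun j => Function.update e i 0 j = 0) =
      insert i (Finset.univ.filter fun j => e j = 0) := by
    ext j
    by_cases hj : j = i
    · subst hj; simp
    · simp [hj]
  rw [rank, this, Finset.card_insert_of_notMem (by simpa using hi)]; rfl

lemma rank_eq_of_zeros {e e' : Code} (h : ∀ i, e i = 0 ↔ e' i = 0) : rank e = rank e' := by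
  unfold rank; simp only [h]

/-- The parallel classes of the edges of a face are given by the directions. -/
lemma parallelClass_eq {g k : ℕ} {f e : Code} (hf : IsFaceCode g k f) {d : Fin 5} (he : e ≼ f)
    (hr : rank e = 1) (hd : e d = 0) :
    parallelClass (Fc g k f) (Fc g k e) = dirEdges g k f d := by
  ext G
  constructor
  · rintro ⟨-, hG⟩
    exact (iff_of_eqvGen (fun a b h => ⟨oppositeIn_dir hf h, oppositeIn_dir hf h.symm⟩) hG).1
      ⟨e, he, hr, hd, rfl⟩
  · rintro ⟨e', he', hr', hd', rfl⟩
    refine ⟨(isEdge_Fc_iff hf).2 ⟨e', he', hr', rfl⟩, ?_⟩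
    have hz : ∀ i, e i = 0 ↔ e' i = 0 := fun i => by
      obtain ⟨z, hz, hz'⟩ := exists_zero_of_rank hr
      obtain ⟨w, hw, hw'⟩ := exists_zero_of_rank hr'
      have h1 := hz' d hd
      have h2 := hw' d hd'
      subst h1 h2
      exact ⟨fun h => (hz' i h) ▸ hw, fun h => (hw' i h) ▸ hz⟩
    refine eqv_of_update (r := fun a b => Relation.EqvGen (OppositeIn (Fc g k f)) (Fc g k a)
      (Fc g k b)) ((Relation.EqvGen.is_equivalence _).comap _) fun e1 i h1 hi h2 => ?_
    have hz1 : ∀ j, e1 j = 0 ↔ e j = 0 := fun j => by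
      rcases h1 j with h | h
      · rw [h]
      · rw [h, hz]
    have hei : e i ≠ 0 := fun h => hi (by rw [h, (hz i).1 h])
    have he'i : e' i ≠ 0 := fun h => hei ((hz i).2 h)
    have hfi : f i = 0 := by
      by_contra h
      exact hi ((he.apply_ne_zero h).trans (he'.apply_ne_zero h).symm)
    have he1 : e1 ≼ f := fun j => by
      rcases h1 j with h | h
      · rw [h]; exact he j
      · rw [h]; exact he' j
    have he1i : e1 i ≠ 0 := by rw [h2]; exact hei
    -- Freeing the coordinate `i` spans a square of `f` in which the two edges are opposite.
    set q := Function.update e1 i 0 with hq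
    have hqf : q ≼ f := fun j => by
      by_cases hj : j = i
      · subst hj; exact Or.inl hfi
      · simpa [hq, hj] using he1 j
    set e2 := Function.update e1 i (e' i) with he2
    have h12 : e2 ≼ q := fun j => by
      by_cases hj : j = i
      · subst hj; left; simp [hq]
      · right; simp [hq, he2, hj]
    have hr1 : rank e1 = 1 := (rank_eq_of_zeros hz1).trans hr
    have hr2 : rank e2 = 1 := by
      rw [← hr1]
      refine rank_eq_of_zeros fun j => ?_
      by_cases hj : j = i
      · subst hj; simp [he2, he'i, he1i]
      · simp [he2, hj]
    have hqc := hf.of_below hqf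
    refine Relation.EqvGen.rel _ _ ⟨Fc g k q, (isFace_Fc_iff hf).2 ⟨q, hqf, rfl⟩, ?_,
      (isEdge_Fc_iff hqc).2 ⟨e1, below_update_zero _ _, hr1, rfl⟩,
      (isEdge_Fc_iff hqc).2 ⟨e2, h12, hr2, rfl⟩, ?_⟩
    · rw [dim_Fc hqc, hq, rank_update_zero he1i, hr1]
    · refine disjoint_Fc (i := i) (hf.of_below he1) (hqc.of_below h12) he1i ?_ ?_
      · simpa [he2] using he'i
      · simpa [he2, h2] using hi

lemma exists_edge_below {f : Code} {d : Fin 5} (hd : f d = 0) :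
    ∃ e, e ≼ f ∧ rank e = 1 ∧ e d = 0 := by
  refine ⟨fun i => if i = d then 0 else if f i = 0 then 1 else f i, fun i => ?_, ?_, by simp⟩
  · by_cases hi : f i = 0
    · exact Or.inl hi
    · right
      have : i ≠ d := fun h => hi (h ▸ hd)
      simp [this, hi]
  · rw [rank, Finset.card_eq_one]
    refine ⟨d, ?_⟩
    ext i
    by_cases hi : i = d
    · simp [hi]
    · by_cases h0 : f i = 0 <;> simp [hi, h0]

/-- The cell with the given face and direction. -/
def cell {g k : ℕ} {f : Code} (hf : IsFaceCode g k f) {d : Fin 5} (hd : f d = 0) :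
    DualCell (poly (ineq g)) where
  face := Fc g k f
  edges := dirEdges g k f d
  isFace := isFace_Fc hf
  proper := Fc_ne_poly hf
  isClass := by
    obtain ⟨e, h1, h2, h3⟩ := exists_edge_below hd
    exact ⟨Fc g k e, (isEdge_Fc_iff hf).2 ⟨e, h1, h2, rfl⟩, (parallelClass_eq hf h1 h2 h3).symm⟩

/-- The cell `c` consists of the face with code `f` in the copy `k` and the direction `d`. -/
def IsCell {g : ℕ} (c : DualCell (poly (ineq g))) (k : ℕ) (f : Code) (d : Fin 5) : Prop :=
  IsFaceCode g k f ∧ f d = 0 ∧ c.face = Fc g k f ∧ c.edges = dirEdges g k f d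

lemma isCell_cell {g k : ℕ} {f : Code} (hf : IsFaceCode g k f) {d : Fin 5} (hd : f d = 0) :
    IsCell (cell hf hd) k f d := ⟨hf, hd, rfl, rfl⟩

lemma IsCell.eq_cell {g k : ℕ} {f : Code} {d : Fin 5} {c : DualCell (poly (ineq g))}
    (h : IsCell c k f d) : c = cell h.1 h.2.1 := DualCell.ext h.2.2.1 h.2.2.2

lemma exists_isCell {g : ℕ} (hg : 0 < g) (c : DualCell (poly (ineq g))) :
    ∃ k f d, IsCell c k f d := by
  obtain ⟨k, f, hf, hF⟩ := (isFace_ne_iff hg).1 ⟨c.isFace, c.proper⟩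
  obtain ⟨G, hG, hc⟩ := c.isClass
  rw [hF] at hG hc
  obtain ⟨e, he, hr, rfl⟩ := (isEdge_Fc_iff hf).1 hG
  obtain ⟨d, hd, -⟩ := exists_zero_of_rank hr
  exact ⟨k, f, d, hf, he.apply_eq_zero hd, hF, hc.trans (parallelClass_eq hf he hr hd)⟩

lemma dirEdges_glue {g k : ℕ} {f : Code} (h : f ≼ topW) (d : Fin 5) :
    dirEdges g k f d = dirEdges g (k + 1) (flip f) d := by
  ext G
  constructor
  · rintro ⟨e, he, hr, hd, rfl⟩
    refine ⟨flip e, he.flip, by rw [rank_flip, hr], (flip_apply_eq_zero _ _).2 hd, ?_⟩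
    rw [Fc, facetsOf_glue g k (he.trans h)]; rfl
  · rintro ⟨e, he, hr, hd, rfl⟩
    have he' : flip e ≼ f := flip_below_comm.2 he
    refine ⟨flip e, he', by rw [rank_flip, hr], (flip_apply_eq_zero _ _).2 hd, ?_⟩
    rw [Fc, Fc, facetsOf_glue g k (he'.trans h), flip_flip]

lemma SameFace.dirEdges_eq (g : ℕ) {k k' : ℕ} {f f' : Code} (h : SameFace k f k' f') (d : Fin 5) :
    dirEdges g k f d = dirEdges g k' f' d := by
  rcases h with ⟨rfl, rfl⟩ | ⟨rfl, h, rfl⟩ | ⟨rfl, h, rfl⟩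
  · rfl
  · exact dirEdges_glue h d
  · rw [dirEdges_glue (flip_below_topW.2 h), flip_flip]

lemma SameFace.apply_eq_zero {k k' : ℕ} {f f' : Code} (h : SameFace k f k' f') (d : Fin 5) :
    f d = 0 ↔ f' d = 0 :=
  h.iff_of_flip (p := fun f => f d = 0) fun f => flip_apply_eq_zero f d

lemma IsCell.of_sameFace {g k k' : ℕ} {f f' : Code} {d : Fin 5} {c : DualCell (poly (ineq g))}
    (h : IsCell c k f d) (hf : IsFaceCode g k' f') (hs : SameFace k f k' f') : IsCell c k' f' d :=
  ⟨hf, (hs.apply_eq_zero d).1 h.2.1, h.2.2.1.trans (hs.Fc_eq g), h.2.2.2.trans (hs.dirEdges_eq g d)⟩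

lemma IsCell.sameFace {g k k' : ℕ} {f f' : Code} {d d' : Fin 5} {c : DualCell (poly (ineq g))}
    (h : IsCell c k f d) (h' : IsCell c k' f' d') : SameFace k f k' f' :=
  (Fc_eq_iff h.1 h'.1).1 (h.2.2.1.symm.trans h'.2.2.1)

/-- A subface of the face of a cell has a code in the same copy. -/
lemma IsCell.exists_below {g k k' : ℕ} {f f' : Code} {d d' : Fin 5} {c c' : DualCell (poly (ineq g))}
    (h : IsCell c k f d) (h' : IsCell c' k' f' d') (hsub : c.face ⊆ c'.face) :
    ∃ e, e ≼ f' ∧ SameFace k f k' e ∧ IsCell c k' e d := by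
  rw [h.2.2.1, h'.2.2.1] at hsub
  obtain ⟨e, he, hs⟩ := exists_code_of_subset h'.1 h.1.1 hsub
  exact ⟨e, he, hs, h.of_sameFace (h'.1.of_below he) hs⟩

lemma IsCell.le_iff {g k k' : ℕ} {f f' : Code} {d d' : Fin 5} {c c' : DualCell (poly (ineq g))}
    (h : IsCell c k f d) (h' : IsCell c' k' f' d') : c ≤ c' ↔ c.face ⊆ c'.face ∧ d = d' := by
  constructor
  · rintro ⟨h1, h2⟩
    refine ⟨h1, ?_⟩
    obtain ⟨e, he, -, hc⟩ := h.exists_below h' h1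
    obtain ⟨a, ha, har, had⟩ := exists_edge_below hc.2.1
    have hmem : Fc g k' a ∈ c'.edges := h2 (by rw [hc.2.2.2]; exact ⟨a, ha, har, had, rfl⟩)
    rw [h'.2.2.2] at hmem
    obtain ⟨b, hb, hbr, hbd, hab⟩ := hmem
    have := Fc_injective (hc.1.of_below ha) (h'.1.of_below hb) hab
    subst this
    obtain ⟨z, -, hz⟩ := exists_zero_of_rank har
    rw [hz d had, hz d' hbd]
  · rintro ⟨h1, rfl⟩
    refine ⟨h1, ?_⟩
    obtain ⟨e, he, -, hc⟩ := h.exists_below h' h1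
    rw [hc.2.2.2, h'.2.2.2]
    rintro G ⟨a, ha, har, had, rfl⟩
    exact ⟨a, ha.trans he, har, had, rfl⟩

lemma IsCell.le_iff_below {g k : ℕ} {f f' : Code} {d : Fin 5} {c c' : DualCell (poly (ineq g))}
    (h : IsCell c k f d) (h' : IsCell c' k f' d) : c ≤ c' ↔ f ≼ f' := by
  rw [h.le_iff h', h.2.2.1, h'.2.2.1, Fc_subset_iff h'.1]
  exact and_iff_left rfl

lemma IsCell.dir_eq {g k k' : ℕ} {f f' : Code} {d d' : Fin 5} {c : DualCell (poly (ineq g))}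
    (h : IsCell c k f d) (h' : IsCell c k' f' d') : d = d' := ((h.le_iff h').1 le_rfl).2

lemma finite_dualCell {g : ℕ} (hg : 0 < g) : Finite (DualCell (poly (ineq g))) := by
  choose k f d h using exists_isCell hg
  refine Finite.of_injective
    (fun c => ((⟨k c, (h c).1.1⟩, f c, d c) : Fin g × Code × Fin 5)) fun c c' e => ?_
  simp only [Prod.mk.injEq, Fin.mk.injEq] at e
  obtain ⟨e1, e2, e3⟩ := e
  have h1 := h c
  rw [e1, e2, e3] at h1
  exact h1.eq_cell.trans (h c').eq_cell.symm

end Cells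

/-! ### Connected components of the derivative complex and their cell counts -/

section Components

/-- The connected component of the cells of direction `d`; for `d = 0` and `d = 2` every copy `k`
has a component of its own. -/
def comp (g : ℕ) (d : Fin 5) (k : ℕ) : Set (DualCell (poly (ineq g))) :=
  {c | ∃ m f, IsCell c m f d ∧ (d = 0 ∨ d = 2 → m = k)}

/-- Both walls fix the coordinates `0` and `2`; this is why these directions never leave a copy. -/
lemma not_below_walls {f : Code} {d : Fin 5} (hf : f d = 0) (hd : d = 0 ∨ d = 2) :
    ¬ f ≼ topW ∧ ¬ f ≼ botW := by
  constructor <;> intro h <;> have := h.apply_eq_zero hf <;> rcases hd with rfl | rfl <;>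
    exact absurd this (by decide)

lemma SameFace.eq_of_dir {k k' : ℕ} {f f' : Code} {d : Fin 5} (h : SameFace k f k' f')
    (hf : f d = 0) (hd : d = 0 ∨ d = 2) : k = k' ∧ f = f' := by
  obtain ⟨h1, h2⟩ := not_below_walls hf hd
  rcases h with h | ⟨-, h, -⟩ | ⟨-, h, -⟩
  · exact h
  · exact absurd h h1
  · exact absurd h h2

lemma mem_comp_iff {g k m : ℕ} {f : Code} {d : Fin 5} {c : DualCell (poly (ineq g))} {d' : Fin 5}
    (h : IsCell c m f d') : c ∈ comp g d k ↔ d' = d ∧ (d = 0 ∨ d = 2 → m = k) := by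
  constructor
  · rintro ⟨m', f', h', hk⟩
    have e := h.dir_eq h'
    subst e
    exact ⟨rfl, fun hd => ((h.sameFace h').eq_of_dir h.2.1 hd).1.trans (hk hd)⟩
  · rintro ⟨rfl, hk⟩
    exact ⟨m, f, h, hk⟩

lemma comp_le_iff {g k : ℕ} (hg : 0 < g) {d : Fin 5} {c c' : DualCell (poly (ineq g))}
    (h : c ≤ c') : c ∈ comp g d k ↔ c' ∈ comp g d k := by
  obtain ⟨m, f, d1, hc⟩ := exists_isCell hg c
  obtain ⟨m', f', d2, hc'⟩ := exists_isCell hg c'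
  obtain ⟨hsub, rfl⟩ := (hc.le_iff hc').1 h
  obtain ⟨e, he, hs, -⟩ := hc.exists_below hc' hsub
  rw [mem_comp_iff hc, mem_comp_iff hc']
  refine and_congr_right ?_
  rintro rfl
  refine forall_congr' fun hd => ?_
  rw [(hs.eq_of_dir hc.2.1 hd).1]

/-- With the direction fixed, a cell carries no information beyond its face. All components are
embedded for this reason, and it identifies them with sets of proper faces. -/
lemma comp_le_iff_face {g k : ℕ} {d : Fin 5} {c c' : DualCell (poly (ineq g))}
    (h : c ∈ comp g d k) (h' : c' ∈ comp g d k) : c ≤ c' ↔ c.face ⊆ c'.face := by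
  obtain ⟨m, f, hc, -⟩ := h
  obtain ⟨m', f', hc', -⟩ := h'
  rw [hc.le_iff hc']
  exact and_iff_left rfl

lemma isFaceCode_of_rank {g k : ℕ} (hk : k < g) {f : Code} (hf : Valid f) (hr : rank f ≠ 3) :
    IsFaceCode g k f :=
  ⟨hk, hf, fun e => absurd (e ▸ facetCode_botW.2) hr, fun e => absurd (e ▸ facetCode_topW.2) hr⟩

lemma valid_of_rank_one : ∀ e : Code, rank e = 1 → Valid e := by
  refine forall_code ?_
  decide +kernel

/-- The value of the last coordinate for which all squares of direction `d` are valid. -/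
def lastSign (d : Fin 5) : SignType := if d = 2 ∨ d = 3 then 1 else -1

set_option synthInstance.maxSize 1000 in
set_option synthInstance.maxHeartbeats 200000 in
/-- The squares containing an edge are valid except for two pairs of directions. -/
lemma valid_update : ∀ e : Code, rank e = 1 → ∀ d i : Fin 5, e d = 0 → i ≠ d →
    (i = 4 ∨ d = 4 ∨ e 4 = lastSign d) → Valid (Function.update e i 0) := by
  refine forall_code ?_
  decide +kernel

lemma isFaceCode_edge {g k : ℕ} (hk : k < g) {e : Code} (hr : rank e = 1) : IsFaceCode g k e :=
  isFaceCode_of_rank hk (valid_of_rank_one e hr) (by omega)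

/-- All edges of direction `d` in one copy are connected. -/
lemma eqvGen_edges {g k : ℕ} (hk : k < g) {d : Fin 5} {e e' : Code} (hr : rank e = 1)
    (hr' : rank e' = 1) (hd : e d = 0) (hd' : e' d = 0) :
    Relation.EqvGen (· ≤ ·) (cell (isFaceCode_edge hk hr) hd) (cell (isFaceCode_edge hk hr') hd') := by
  classical
  let φ : Code → DualCell (poly (ineq g)) := fun a =>
    if h : rank a = 1 ∧ a d = 0 then cell (isFaceCode_edge hk h.1) h.2
    else cell (isFaceCode_edge hk hr) hd
  let r : Code → Code → Prop := fun a b => Relation.EqvGen (· ≤ ·) (φ a) (φ b)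
  have hreq : Equivalence r := (Relation.EqvGen.is_equivalence _).comap φ
  have hstep : ∀ (a : Code) (i : Fin 5) (s : SignType), rank a = 1 → a d = 0 → i ≠ d → s ≠ 0 →
      Valid (Function.update a i 0) → r a (Function.update a i s) := by
    intro a i s ha had hid hs hv
    have hai : a i ≠ 0 := fun h => by
      obtain ⟨z, -, hz⟩ := exists_zero_of_rank ha
      exact hid ((hz i h).trans (hz d had).symm)
    have hrq : rank (Function.update a i 0) = 2 := by rw [rank_update_zero hai, ha]
    have hqd : Function.update a i 0 d = 0 := by simpa [hid.symm] using had
    have hra : rank (Function.update a i s) = 1 := by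
      rw [← ha]
      refine rank_eq_of_zeros fun j => ?_
      by_cases hj : j = i
      · subst hj; simp [hs, hai]
      · simp [hj]
    have had' : Function.update a i s d = 0 := by simpa [hid.symm] using had
    have hq := isFaceCode_of_rank hk hv (by omega)
    have hle : ∀ b (hb : rank b = 1) (hbd : b d = 0), b ≼ Function.update a i 0 →
        φ b ≤ cell hq hqd := fun b hb hbd hle => by
      simp only [φ, dif_pos (And.intro hb hbd)]
      exact ((isCell_cell _ hbd).le_iff_below (isCell_cell hq hqd)).2 hle
    refine Relation.EqvGen.trans _ _ _ (.rel _ _ (hle a ha had (below_update_zero a i)))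
      (.symm _ _ (.rel _ _ (hle _ hra had' fun j => ?_)))
    by_cases hj : j = i
    · subst hj; left; simp
    · right; simp [hj]
  have hz : ∀ a : Code, rank a = 1 → a d = 0 → ∀ i, a i = 0 ↔ i = d := fun a ha had i => by
    obtain ⟨z, -, hz⟩ := exists_zero_of_rank ha
    exact ⟨fun h => (hz i h).trans (hz d had).symm, fun h => h ▸ had⟩
  set σ : SignType := lastSign d with hσ
  have hσ0 : σ ≠ 0 := by rw [hσ, lastSign]; split_ifs <;> decide
  -- Some squares of the 5-cube are missing from the boundary. The path therefore runs where the
  -- last sign is `σ`, on which side every needed square is present; changing the last sign itself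
  -- is always possible.
  have hpath : ∀ a b : Code, rank a = 1 → a d = 0 → rank b = 1 → b d = 0 →
      (d = 4 ∨ (a 4 = σ ∧ b 4 = σ)) → r a b := by
    intro a b ha had hb hbd h4
    refine eqv_of_update hreq fun c i hc hi hci => ?_
    have hzc : ∀ j, c j = 0 ↔ a j = 0 := fun j => by
      rcases hc j with h | h
      · rw [h]
      · rw [h, hz a ha had, hz b hb hbd]
    have hcr := (rank_eq_of_zeros hzc).trans ha
    have hcd := (hzc d).2 had
    have hid : i ≠ d := fun h => hi (by rw [h, had, hbd])
    refine hstep c i _ hcr hcd hid (fun h => hid ((hz b hb hbd i).1 h))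
      (valid_update c hcr d i hcd hid ?_)
    rcases h4 with h4 | ⟨h4, h4'⟩
    · exact Or.inr (Or.inl h4)
    · right; right
      rcases hc 4 with h | h <;> rw [h] <;> assumption
  have hfix : ∀ a : Code, rank a = 1 → a d = 0 → ∃ b, rank b = 1 ∧ b d = 0 ∧ (d = 4 ∨ b 4 = σ) ∧
      r a b := by
    intro a ha had
    by_cases h4 : d = 4
    · exact ⟨a, ha, had, Or.inl h4, hreq.refl _⟩
    · refine ⟨Function.update a 4 σ, ?_, by simpa [h4] using had, Or.inr (by simp),
        hstep a 4 σ ha had (Ne.symm h4) hσ0 (valid_update a ha d 4 had (Ne.symm h4) (Or.inl rfl))⟩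
      rw [← ha]
      refine rank_eq_of_zeros fun j => ?_
      by_cases hj : j = 4
      · subst hj; simp only [Function.update_self, hσ0, false_iff]
        exact fun h => h4 ((hz a ha had 4).1 h).symm
      · simp [hj]
  obtain ⟨b, h1, h2, h3, h4⟩ := hfix e hr hd
  obtain ⟨b', h1', h2', h3', h4'⟩ := hfix e' hr' hd'
  have := hreq.trans h4 (hreq.trans (hpath b b' h1 h2 h1' h2' (by tauto)) (hreq.symm h4'))
  simpa only [r, φ, dif_pos (And.intro hr hd), dif_pos (And.intro hr' hd')] using this

lemma eqvGen_cells {g m : ℕ} {f f' : Code} {d : Fin 5} {c c' : DualCell (poly (ineq g))}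
    (h : IsCell c m f d) (h' : IsCell c' m f' d) : Relation.EqvGen (· ≤ ·) c c' := by
  obtain ⟨e, he, hr, hd⟩ := exists_edge_below h.2.1
  obtain ⟨e', he', hr', hd'⟩ := exists_edge_below h'.2.1
  have h1 := ((isCell_cell (isFaceCode_edge h.1.1 hr) hd).le_iff_below h).2 he
  have h2 := ((isCell_cell (isFaceCode_edge h'.1.1 hr') hd').le_iff_below h').2 he'
  exact .trans _ _ _ (.symm _ _ (.rel _ _ h1))
    (.trans _ _ _ (eqvGen_edges h.1.1 hr hr' hd hd') (.rel _ _ h2))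

/-- For these directions the shared wall contains an edge of direction `d`, which is a cell of both
adjacent copies. -/
lemma eqvGen_copies {g : ℕ} {d : Fin 5} (hd : ¬ (d = 0 ∨ d = 2)) : ∀ (m : ℕ) {f f' : Code}
    {c c' : DualCell (poly (ineq g))}, IsCell c 0 f d → IsCell c' m f' d →
    Relation.EqvGen (· ≤ ·) c c' := by
  intro m
  induction m with
  | zero => intro f f' c c' h h'; exact eqvGen_cells h h'
  | succ m ih =>
    intro f f' c c' h h'
    have hm := h'.1.1
    have key : ∀ d : Fin 5, ¬ (d = 0 ∨ d = 2) →
        rank (Function.update 1 d 0 : Code) = 1 ∧ (Function.update 1 d 0 : Code) ≼ topW := by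
      decide
    obtain ⟨hr, ht⟩ := key d hd
    have h0 : (Function.update 1 d 0 : Code) d = 0 := by simp
    have h1 := isCell_cell (isFaceCode_edge (g := g) (k := m) (by omega) hr) h0
    have h2 := h1.of_sameFace (k' := m + 1) (f' := flip (Function.update 1 d 0))
      (isFaceCode_edge hm (by rw [rank_flip, hr])) (Or.inr (Or.inl ⟨rfl, ht, rfl⟩))
    exact (ih h h1).trans _ _ _ (eqvGen_cells h2 h')

lemma eqvGen_comp {g k : ℕ} {d : Fin 5} {c c' : DualCell (poly (ineq g))}
    (h : c ∈ comp g d k) (h' : c' ∈ comp g d k) : Relation.EqvGen (· ≤ ·) c c' := by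
  obtain ⟨m, f, hc, hk⟩ := h
  obtain ⟨m', f', hc', hk'⟩ := h'
  by_cases hd : d = 0 ∨ d = 2
  · have := (hk hd).trans (hk' hd).symm
    subst this
    exact eqvGen_cells hc hc'
  · obtain ⟨e, -, hr, hed⟩ := exists_edge_below hc.2.1
    have h0 := isCell_cell (isFaceCode_edge (g := g) (k := 0) (by have := hc.1.1; omega) hr) hed
    exact .trans _ _ _ (.symm _ _ (eqvGen_copies hd m h0 hc)) (eqvGen_copies hd m' h0 hc')

lemma comp_nonempty {g k : ℕ} (hk : k < g) (d : Fin 5) : (comp g d k).Nonempty := by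
  obtain ⟨e, -, hr, hed⟩ := exists_edge_below (f := 0) (d := d) rfl
  exact ⟨_, k, e, isCell_cell (isFaceCode_edge hk hr) hed, fun _ => rfl⟩

lemma comp_eq_component {g k : ℕ} (hg : 0 < g) {d : Fin 5} {c : DualCell (poly (ineq g))}
    (hc : c ∈ comp g d k) : comp g d k = {c' | Relation.EqvGen (· ≤ ·) c c'} := by
  ext c'
  exact ⟨fun h => eqvGen_comp hc h, fun h =>
    (iff_of_eqvGen (p := fun c => c ∈ comp g d k) (fun a b h => comp_le_iff hg h) h).1 hc⟩

/-- The dual manifolds of the chain. -/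
lemma isDualManifold_iff {g : ℕ} (hg : 0 < g) {M : Set (DualCell (poly (ineq g)))} :
    IsDualManifold (poly (ineq g)) M ↔ ∃ d, ∃ k < g, M = comp g d k := by
  constructor
  · rintro ⟨c, rfl⟩
    obtain ⟨m, f, d, hc⟩ := exists_isCell hg c
    exact ⟨d, m, hc.1.1, (comp_eq_component hg ⟨m, f, hc, fun _ => rfl⟩).symm⟩
  · rintro ⟨d, k, hk, rfl⟩
    obtain ⟨c, hc⟩ := comp_nonempty hk d
    exact ⟨c, comp_eq_component hg hc⟩

lemma comp_eq_of_ne {g k k' : ℕ} {d : Fin 5} (hd : ¬ (d = 0 ∨ d = 2)) : comp g d k = comp g d k' := by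
  simp only [comp, hd, false_imp_iff]

lemma injOn_face (g : ℕ) (d : Fin 5) (k : ℕ) : InjOn DualCell.face (comp g d k) :=
  fun _ hc _ hc' e => le_antisymm ((comp_le_iff_face hc hc').2 e.subset)
    ((comp_le_iff_face hc' hc).2 e.superset)

lemma dualFNum_eq {g k : ℕ} (d : Fin 5) (n : ℕ) :
    dualFNum (comp g d k) n = {F | ∃ m f, IsFaceCode g m f ∧ (f d = 0 ∧ rank f = n + 1) ∧
      (d = 0 ∨ d = 2 → m = k) ∧ F = Fc g m f}.ncard := by
  rw [dualFNum, ← InjOn.ncard_image ((injOn_face g d k).mono fun c hc => hc.1)]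
  congr 1
  ext F
  constructor
  · rintro ⟨c, ⟨⟨m, f, hc, hm⟩, hd⟩, rfl⟩
    exact ⟨m, f, hc.1, ⟨hc.2.1, by rwa [hc.2.2.1, dim_Fc hc.1] at hd⟩, hm, hc.2.2.1⟩
  · rintro ⟨m, f, hf, ⟨h1, h2⟩, h3, rfl⟩
    exact ⟨cell hf h1, ⟨⟨m, f, isCell_cell hf h1, h3⟩, (dim_Fc hf).trans h2⟩, rfl⟩

lemma dualFNum_global {g k : ℕ} (hg : 0 < g) {d : Fin 5} (hd : ¬ (d = 0 ∨ d = 2)) (n : ℕ) :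
    dualFNum (comp g d k) n =
      g * (Finset.univ.filter fun f => Valid f ∧ (f d = 0 ∧ rank f = n + 1) ∧ ¬ f ≼ topW ∧
        f ≠ botW).card +
      (Finset.univ.filter fun f => Valid f ∧ (f d = 0 ∧ rank f = n + 1) ∧
        (f ≼ topW ∨ f = botW)).card := by
  rw [dualFNum_eq, ← ncard_faces hg (fun f => f d = 0 ∧ rank f = n + 1) fun f => by
    rw [rank_flip, flip_apply_eq_zero]]
  simp only [hd, false_imp_iff, true_and]

lemma dualFNum_local {g k : ℕ} (hk : k < g) {d : Fin 5} (hd : d = 0 ∨ d = 2) (n : ℕ) :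
    dualFNum (comp g d k) n =
      (Finset.univ.filter fun f => Valid f ∧ f d = 0 ∧ rank f = n + 1).card := by
  rw [dualFNum_eq, ← ncard_faces_copy hk (fun f => f d = 0 ∧ rank f = n + 1) fun f h =>
    ⟨fun e => (not_below_walls h.1 hd).2 (e ▸ Below.refl _),
      fun e => (not_below_walls h.1 hd).1 (e ▸ Below.refl _)⟩]
  congr 1
  ext F
  constructor
  · rintro ⟨m, f, h1, h2, h3, rfl⟩
    rw [h3 hd] at h1 ⊢
    exact ⟨f, h1, h2, rfl⟩
  · rintro ⟨f, h1, h2, rfl⟩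
    exact ⟨k, f, h1, h2, fun _ => rfl, rfl⟩

lemma fVector_comp_four {g k : ℕ} (hg : 0 < g) :
    dualFNum (comp g 4 k) 0 = 12 * g + 4 ∧ dualFNum (comp g 4 k) 1 = 28 * g + 4 ∧
      dualFNum (comp g 4 k) 2 = 14 * g + 2 := by
  have h0 : (Finset.univ.filter fun f : Code => Valid f ∧ (f 4 = 0 ∧ rank f = 0 + 1) ∧
        ¬ f ≼ topW ∧ f ≠ botW).card = 12 ∧
      (Finset.univ.filter fun f : Code => Valid f ∧ (f 4 = 0 ∧ rank f = 0 + 1) ∧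
        (f ≼ topW ∨ f = botW)).card = 4 := by decide +kernel
  have h1 : (Finset.univ.filter fun f : Code => Valid f ∧ (f 4 = 0 ∧ rank f = 1 + 1) ∧
        ¬ f ≼ topW ∧ f ≠ botW).card = 28 ∧
      (Finset.univ.filter fun f : Code => Valid f ∧ (f 4 = 0 ∧ rank f = 1 + 1) ∧
        (f ≼ topW ∨ f = botW)).card = 4 := by decide +kernel
  have h2 : (Finset.univ.filter fun f : Code => Valid f ∧ (f 4 = 0 ∧ rank f = 2 + 1) ∧
        ¬ f ≼ topW ∧ f ≠ botW).card = 14 ∧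
      (Finset.univ.filter fun f : Code => Valid f ∧ (f 4 = 0 ∧ rank f = 2 + 1) ∧
        (f ≼ topW ∨ f = botW)).card = 2 := by decide +kernel
  have hd : ¬ ((4 : Fin 5) = 0 ∨ (4 : Fin 5) = 2) := by decide
  rw [dualFNum_global hg hd, dualFNum_global hg hd, dualFNum_global hg hd, h0.1, h0.2, h1.1, h1.2,
    h2.1, h2.2]
  omega

lemma eulerChar_comp_four {g k : ℕ} (hg : 0 < g) : eulerChar (comp g 4 k) = 2 - 2 * (g : ℤ) := by
  obtain ⟨h0, h1, h2⟩ := fVector_comp_four (k := k) hg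
  rw [eulerChar, h0, h1, h2]
  push_cast
  ring

lemma eulerChar_comp {g k : ℕ} (hk : k < g) {d : Fin 5} (hd : d ≠ 4) :
    eulerChar (comp g d k) = 2 := by
  by_cases h : d = 0 ∨ d = 2
  · have key : ∀ d : Fin 5, d = 0 ∨ d = 2 →
        (((Finset.univ.filter fun f : Code => Valid f ∧ f d = 0 ∧ rank f = 0 + 1).card : ℤ) -
        (Finset.univ.filter fun f : Code => Valid f ∧ f d = 0 ∧ rank f = 1 + 1).card +
        (Finset.univ.filter fun f : Code => Valid f ∧ f d = 0 ∧ rank f = 2 + 1).card) = 2 := by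
      decide +kernel
    rw [eulerChar, dualFNum_local hk h, dualFNum_local hk h, dualFNum_local hk h]
    exact key d h
  · have hg : 0 < g := by omega
    -- Each copy contributes zero to the Euler characteristic and the two ends together contribute
    -- two.
    have key : ∀ d : Fin 5, ¬ (d = 0 ∨ d = 2) → d ≠ 4 →
        (((Finset.univ.filter fun f : Code => Valid f ∧ (f d = 0 ∧ rank f = 0 + 1) ∧
            ¬ f ≼ topW ∧ f ≠ botW).card : ℤ) -
        (Finset.univ.filter fun f : Code => Valid f ∧ (f d = 0 ∧ rank f = 1 + 1) ∧
            ¬ f ≼ topW ∧ f ≠ botW).card +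
        (Finset.univ.filter fun f : Code => Valid f ∧ (f d = 0 ∧ rank f = 2 + 1) ∧
            ¬ f ≼ topW ∧ f ≠ botW).card) = 0 ∧
        (((Finset.univ.filter fun f : Code => Valid f ∧ (f d = 0 ∧ rank f = 0 + 1) ∧
            (f ≼ topW ∨ f = botW)).card : ℤ) -
        (Finset.univ.filter fun f : Code => Valid f ∧ (f d = 0 ∧ rank f = 1 + 1) ∧
            (f ≼ topW ∨ f = botW)).card +
        (Finset.univ.filter fun f : Code => Valid f ∧ (f d = 0 ∧ rank f = 2 + 1) ∧
            (f ≼ topW ∨ f = botW)).card) = 2 := by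
      decide +kernel
    obtain ⟨h1, h2⟩ := key d h hd
    rw [eulerChar, dualFNum_global hg h, dualFNum_global hg h, dualFNum_global hg h]
    push_cast
    linear_combination (g : ℤ) * h1 + h2

end Components

/-! ### The components other than direction `4` are hyperplane sections -/

section Spheres

lemma Fc_pos {g m : ℕ} {f : Code} (hf : IsFaceCode g m f) {h : E4 →ᵃ[ℝ] ℝ}
    (hh : ∀ v ∈ verts f, 0 < h (vpt m v)) {x : E4} (hx : x ∈ Fc g m f) : 0 < h x := by
  rw [Fc_eq_convexHull hf] at hx
  refine (convexHull_min ?_ ((convex_Ioi (0 : ℝ)).affine_preimage h) : _ ⊆ h ⁻¹' Ioi 0) hx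
  rintro _ ⟨v, hv, rfl⟩
  exact hh v hv

lemma Fc_neg {g m : ℕ} {f : Code} (hf : IsFaceCode g m f) {h : E4 →ᵃ[ℝ] ℝ}
    (hh : ∀ v ∈ verts f, h (vpt m v) < 0) {x : E4} (hx : x ∈ Fc g m f) : h x < 0 := by
  rw [Fc_eq_convexHull hf] at hx
  refine (convexHull_min ?_ ((convex_Iio (0 : ℝ)).affine_preimage h) : _ ⊆ h ⁻¹' Iio 0) hx
  rintro _ ⟨v, hv, rfl⟩
  exact hh v hv

/-- The face with a given code as a proper face. -/
def properFc {g k : ℕ} {f : Code} (hf : IsFaceCode g k f) : ProperFace (poly (ineq g)) :=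
  ⟨Fc g k f, isFace_Fc hf, Fc_ne_poly hf⟩

lemma properFc_mem_sectionFaces {g m : ℕ} {f : Code} (hf : IsFaceCode g m f) {h : E4 →ᵃ[ℝ] ℝ}
    {y z : E4} (hy : y ∈ Fc g m f) (hz : z ∈ Fc g m f) (hhy : h y < 0) (hhz : 0 < h z) :
    properFc hf ∈ sectionFaces (ineq g) h := by
  obtain ⟨b, hb, hbt⟩ := exists_tight_eq hf.1 f
  rw [Fc, ← hbt] at hy hz
  obtain ⟨x, hx, hx0, hxt⟩ := exists_tight_eq_of_signs hb hy hz hhy hhz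
  exact ⟨x, hx, hx0, by rw [hxt, hbt]; rfl⟩

lemma exists_zero_of_mem_sectionFaces {g : ℕ} {h : E4 →ᵃ[ℝ] ℝ} {F : ProperFace (poly (ineq g))}
    (hF : F ∈ sectionFaces (ineq g) h) : ∃ x ∈ F.1, h x = 0 := by
  obtain ⟨x, hx, hx0, hxF⟩ := hF
  exact ⟨x, hxF ▸ mem_strat_tight hx, hx0⟩

/-- A hyperplane with points of the chain on both sides cuts its boundary in a sphere. -/
lemma sectionFaces_ineq_sphere {g : ℕ} (hg : 0 < g) {h : E4 →ᵃ[ℝ] ℝ} {y z : E4}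
    (hy : y ∈ poly (ineq g)) (hz : z ∈ poly (ineq g)) (hhy : h y < 0) (hhz : 0 < h z) :
    Nonempty (ordReal (sectionFaces (ineq g) h) ≃ₜ
      Metric.sphere (0 : EuclideanSpace ℝ (Fin 3)) 1) := by
  obtain ⟨b, hb⟩ := exists_interior hg
  have hbt : tight (ineq g) b = ∅ := by
    ext J; simpa using (hb J).ne
  rw [← strat_empty, ← hbt] at hy hz
  obtain ⟨x, hx, hx0, hxt⟩ := exists_tight_eq_of_signs (fun J => (hb J).le) hy hz hhy hhz
  refine sectionFaces_sphere (by simp) (poly_bounded hg) (fun h0 => ?_) (x0 := x) (fun J => ?_) hx0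
  · have := affine_linear_sub h z y
    rw [h0] at this
    simp at this
    linarith
  · refine lt_of_le_of_ne (hx J) fun hJ => ?_
    have : J ∈ tight (ineq g) x := hJ
    rw [hxt, hbt] at this
    exact this

lemma exists_vert {f : Code} {d : Fin 5} (hd : f d = 0) {s : SignType} (hs : s ≠ 0) :
    ∃ v ∈ verts f, v d = s := by
  refine ⟨fun i => if i = d then s else if f i = 0 then 1 else f i, ⟨fun i => ?_, fun i => ?_⟩,
    by simp⟩
  · by_cases hi : i = d
    · simp [hi, hs]
    · by_cases h0 : f i = 0 <;> simp [hi, h0]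
  · by_cases h0 : f i = 0
    · exact Or.inl h0
    · right
      have : i ≠ d := fun h => h0 (h ▸ hd)
      simp [this, h0]

/-- If a hyperplane separates the vertices by their coordinate `d` in all copies in which the
component has cells, then the component is the section of the boundary by this hyperplane. -/
theorem comp_sphere {g k : ℕ} (hk : k < g) {d : Fin 5} {h : E4 →ᵃ[ℝ] ℝ}
    (hsame : ∀ m, (d = 0 ∨ d = 2 → m = k) → ∀ v, VertexCode v →
      (v d = -1 → h (vpt m v) < 0) ∧ (v d = 1 → 0 < h (vpt m v)))
    (hne : ∀ m, d = 0 ∨ d = 2 → m ≠ k → (∀ v, VertexCode v → h (vpt m v) < 0) ∨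
      ∀ v, VertexCode v → 0 < h (vpt m v)) :
    IsTwoSphere (realization (comp g d k)) := by
  have hg : 0 < g := by omega
  have := finite_dualCell hg
  have := finite_properFace (ineq g)
  let φ : comp g d k → sectionFaces (ineq g) h := fun c => ⟨⟨c.1.face, c.1.isFace, c.1.proper⟩, by
    obtain ⟨m, f, hc, hm⟩ := c.2
    obtain ⟨v, hv, hvd⟩ := exists_vert hc.2.1 (show (-1 : SignType) ≠ 0 by decide)
    obtain ⟨w, hw, hwd⟩ := exists_vert hc.2.1 (show (1 : SignType) ≠ 0 by decide)
    have := properFc_mem_sectionFaces hc.1 (vpt_mem_Fc hc.1.1 hv) (vpt_mem_Fc hc.1.1 hw)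
      ((hsame m hm v hv.1).1 hvd) ((hsame m hm w hw.1).2 hwd)
    simp only [hc.2.2.1]
    exact this⟩
  have hφ : Function.Surjective φ := by
    rintro ⟨⟨F, hF⟩, hFs⟩
    obtain ⟨m, f, hf, rfl⟩ := (isFace_ne_iff hg).1 hF
    obtain ⟨x, hxF, hx0⟩ := exists_zero_of_mem_sectionFaces hFs
    change x ∈ Fc g m f at hxF
    -- A face with a fixed sign in the coordinate `d`, or in a copy lying on one side, has all
    -- vertices strictly on one side and is not met.
    have key : f d = 0 ∧ (d = 0 ∨ d = 2 → m = k) := by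
      by_cases hm : d = 0 ∨ d = 2 → m = k
      · refine ⟨?_, hm⟩
        by_contra hfd
        rcases sign_cases hfd with h1 | h1
        · have := Fc_pos (h := h) hf (fun v hv =>
            (hsame m hm v hv.1).2 ((hv.2.apply_ne_zero hfd).trans h1)) hxF
          linarith
        · have := Fc_neg (h := h) hf (fun v hv =>
            (hsame m hm v hv.1).1 ((hv.2.apply_ne_zero hfd).trans h1)) hxF
          linarith
      · push Not at hm
        rcases hne m hm.1 hm.2 with h1 | h1
        · have := Fc_neg hf (fun v hv => h1 v hv.1) hxF
          linarith
        · have := Fc_pos hf (fun v hv => h1 v hv.1) hxF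
          linarith
    exact ⟨⟨cell hf key.1, m, f, isCell_cell hf key.1, key.2⟩, rfl⟩
  obtain ⟨e, -⟩ := orderIso_of_surjective (φ := (id : comp g d k → comp g d k)) (ψ := φ)
    Function.surjective_id hφ fun c c' => comp_le_iff_face c.2 c'.2
  obtain ⟨y, hy, hhy⟩ : ∃ y ∈ poly (ineq g), h y < 0 :=
    ⟨vpt k (-1), vpt_mem hk (by decide), (hsame k (fun _ => rfl) (-1) (by decide)).1 rfl⟩
  obtain ⟨z, hz, hhz⟩ : ∃ z ∈ poly (ineq g), 0 < h z :=
    ⟨vpt k 1, vpt_mem hk (by decide), (hsame k (fun _ => rfl) 1 (by decide)).2 rfl⟩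
  obtain ⟨s⟩ := sectionFaces_ineq_sphere hg hy hz hhy hhz
  exact ⟨(ordRealCongr e).trans s⟩

/-- A coordinate of a copy as an affine function. -/
noncomputable def coord (k : ℕ) (d : Fin 5) : E4 →ᵃ[ℝ] ℝ :=
  ((LinearMap.proj d).comp (boost ((9 : ℝ) ^ k)⁻¹)).toAffineMap.comp chart

lemma coord_vpt (k m : ℕ) (d : Fin 5) {v : Code} (hv : VertexCode v) :
    coord k d (vpt m v) = (size (boost ((9 : ℝ) ^ m) (hvert v)))⁻¹ *
      boost (((9 : ℝ) ^ k)⁻¹ * 9 ^ m) (hvert v) d := by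
  have : coord k d (vpt m v) = boost ((9 : ℝ) ^ k)⁻¹ (chart (vpt m v)) d := rfl
  rw [this, chart_vpt m hv, map_smul, boost_boost (by positivity) (by positivity)]
  rfl

lemma hvert_sign {v : Code} {d : Fin 5} (hd : d ≠ 4) :
    (v d = -1 → hvert v d < 0) ∧ (v d = 1 → 0 < hvert v d) := by
  have hs : ∀ i, (0 : ℝ) < scale v i := fun i => by
    unfold scale; split_ifs <;> norm_num
  constructor <;> intro h <;> fin_cases d <;> simp_all [hvert]

/-- Later copies lie on the positive side of the hyperplanes `x 0 = 0` and `x 2 = 0` of a given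
copy. -/
lemma boost_hvert_pos {r : ℝ} (hr : 9 ≤ r) {v : Code} (hv : VertexCode v) :
    0 < boost r (hvert v) 0 ∧ 0 < boost r (hvert v) 2 := by
  have hu : 0 < r⁻¹ := by positivity
  have hu' : r⁻¹ ≤ 1 / 9 := by rw [one_div]; exact inv_anti₀ (by norm_num) hr
  rcases sign_cases (hv 4) with h4 | h4 <;> rcases sign_cases (hv 0) with h0 | h0 <;>
    rcases sign_cases (hv 2) with h2 | h2 <;>
    · simp [boost, hvert, scale, h4, h0, h2]
      constructor <;> linarith

lemma boost_inv_hvert_sign {r : ℝ} (hr : 9 ≤ r) {v : Code} (hv : VertexCode v) :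
    boost r⁻¹ (hvert v) 0 < 0 ∧ 0 < boost r⁻¹ (hvert v) 2 := by
  obtain ⟨h1, h2⟩ := boost_hvert_pos hr hv.flip
  have e : boost r⁻¹ (hvert v) = mirror (boost r (hvert (flip v))) := by
    rw [← boost_mirror, ← hvert_flip, flip_flip]
  rw [e]
  exact ⟨by simpa [mirror] using h1, by simpa [mirror] using h2⟩

/-- The hyperplane is `x d = 0` in the coordinates of copy `k`. The maps `boost` do not change `x 1`
and `x 3`, so for these directions it separates the vertices in all copies at once. For `d = 0` and
`d = 2` each other copy lies on one side. -/
lemma isTwoSphere_comp {g k : ℕ} (hk : k < g) {d : Fin 5} (hd : d ≠ 4) :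
    IsTwoSphere (realization (comp g d k)) := by
  have hsize : ∀ (m : ℕ) (v : Code), VertexCode v →
      0 < (size (boost ((9 : ℝ) ^ m) (hvert v)))⁻¹ := fun m v hv =>
    inv_pos.2 (size_pos (by positivity) hv)
  refine comp_sphere hk (h := coord k d) (fun m hm v hv => ?_) fun m hd' hm => ?_
  · rw [coord_vpt k m d hv]
    have e : boost (((9 : ℝ) ^ k)⁻¹ * 9 ^ m) (hvert v) d = hvert v d := by
      by_cases h : d = 0 ∨ d = 2
      · rw [hm h, inv_mul_cancel₀ (by positivity), boost_one]
      · have key : ∀ d : Fin 5, d ≠ 4 → ¬ (d = 0 ∨ d = 2) → d = 1 ∨ d = 3 := by decide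
        rcases key d hd h with rfl | rfl <;> rfl
    rw [e]
    exact ⟨fun h => mul_neg_of_pos_of_neg (hsize m v hv) ((hvert_sign hd).1 h),
      fun h => mul_pos (hsize m v hv) ((hvert_sign hd).2 h)⟩
  · rcases lt_or_gt_of_ne hm with h | h
    · obtain ⟨n, rfl⟩ := Nat.exists_eq_add_of_lt h
      have e : ((9 : ℝ) ^ (m + n + 1))⁻¹ * 9 ^ m = (9 ^ (n + 1))⁻¹ := by
        rw [add_assoc, pow_add]; field_simp
      rcases hd' with rfl | rfl
      · left; intro v hv
        rw [coord_vpt _ m 0 hv, e]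
        exact mul_neg_of_pos_of_neg (hsize m v hv)
          (boost_inv_hvert_sign (nine_le_pow (Nat.succ_ne_zero n)) hv).1
      · right; intro v hv
        rw [coord_vpt _ m 2 hv, e]
        exact mul_pos (hsize m v hv) (boost_inv_hvert_sign (nine_le_pow (Nat.succ_ne_zero n)) hv).2
    · obtain ⟨n, rfl⟩ := Nat.exists_eq_add_of_lt h
      right; intro v hv
      have := boost_hvert_pos (nine_le_pow (Nat.succ_ne_zero n)) hv
      rw [coord_vpt _ _ d hv, add_assoc, pow_ratio]
      refine mul_pos (hsize _ v hv) ?_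
      rcases hd' with rfl | rfl
      · exact this.1
      · exact this.2

end Spheres

/-! ### The canonical immersions are embeddings -/

section Embedding

lemma barycenter_Fc {g k : ℕ} {f : Code} (hf : IsFaceCode g k f) :
    barycenter (Fc g k f) ∈ poly (ineq g) ∧
      tight (ineq g) (barycenter (Fc g k f)) = facetsOf g k f := by
  obtain ⟨x, hx, hxt⟩ := exists_tight_eq hf.1 f
  have hfin : (vpt k '' verts f).Finite := (toFinite (verts f)).image _
  have := tight_barycenter hx hfin (by rw [hxt]; exact Fc_eq_convexHull hf)
  rwa [hxt] at this

lemma canonicalMap_eq {g : ℕ} [Fintype (DualCell (poly (ineq g)))]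
    (M : Set (DualCell (poly (ineq g)))) (w : realization M) :
    canonicalMap M w = ∑ c, (w : DualCell (poly (ineq g)) → ℝ) c • barycenter c.face :=
  finsum_eq_sum_of_fintype _

/-- All dual manifolds of the chain are embedded. -/
lemma isEmbeddedDual_comp {g : ℕ} (hg : 0 < g) (d : Fin 5) (k : ℕ) :
    IsEmbeddedDual (comp g d k) := by
  have := finite_dualCell hg
  have := Fintype.ofFinite (DualCell (poly (ineq g)))
  have hcont : Continuous (canonicalMap (comp g d k)) := by
    simp_rw [funext (canonicalMap_eq (comp g d k))]
    exact continuous_finsetSum _ fun c _ =>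
      ((continuous_apply c).comp continuous_subtype_val).smul continuous_const
  have : CompactSpace (realization (comp g d k)) :=
    isCompact_iff_compactSpace.1 (isCompact_ordReal (comp g d k))
  -- The realization is compact, so injectivity suffices, and this is the uniqueness of barycentric
  -- coordinates in the subdivided boundary.
  refine (hcont.isClosedEmbedding fun w w' e => Subtype.ext ?_).isEmbedding
  rw [canonicalMap_eq, canonicalMap_eq] at e
  refine barycentric_injective (S := comp g d k) (β := fun c => barycenter c.face) (ℓ := ineq g)
    ?_ ?_ w.2 w'.2 e
  · rintro c ⟨m, f, hc, -⟩
    simp only [hc.2.2.1]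
    exact (barycenter_Fc hc.1).1
  · intro a ha b hb
    rw [comp_le_iff_face ha hb]
    obtain ⟨m, f, hc, -⟩ := ha
    obtain ⟨m', f', hc', -⟩ := hb
    simp only [hc.2.2.1, hc'.2.2.1]
    rw [(barycenter_Fc hc.1).2, (barycenter_Fc hc'.1).2, Fc_subset_iff' hc.1.1]

end Embedding

/-! ### The direction `4` component is a closed surface -/

section Surface

lemma isCompact_Fc {g k : ℕ} {f : Code} (hf : IsFaceCode g k f) : IsCompact (Fc g k f) := by
  rw [Fc_eq_convexHull hf]
  exact ((toFinite (verts f)).image _).isCompact_convexHull ℝ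

/-- A hyperplane that separates two disjoint faces. -/
lemma exists_separating {g k : ℕ} {f f' : Code} (hf : IsFaceCode g k f)
    (hd : Disjoint (Fc g k f) (Fc g k f')) :
    ∃ h : E4 →ᵃ[ℝ] ℝ, (∀ x ∈ Fc g k f, h x < 0) ∧ ∀ x ∈ Fc g k f', 0 < h x := by
  obtain ⟨l, u, v, hu, huv, hv⟩ := geometric_hahn_banach_compact_closed (strat_convex _ _)
    (isCompact_Fc hf) (strat_convex _ _) (strat_closed _ _) hd
  refine ⟨l.toLinearMap.toAffineMap - AffineMap.const ℝ _ u, fun x hx => ?_, fun x hx => ?_⟩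
  · have := hu x hx
    simpa using this
  · have := hv x hx
    have : u < l x := by linarith
    simpa using this

/-- Near a cell, the component of direction `4` looks like a section of the boundary of the
chain. -/
lemma exists_star_congr {g m k : ℕ} {f : Code} {c : DualCell (poly (ineq g))} (hc : IsCell c m f 4) :
    ∃ Y : Set (ProperFace (poly (ineq g))), ∃ F,
      Nonempty (ordReal Y ≃ₜ Metric.sphere (0 : EuclideanSpace ℝ (Fin 3)) 1) ∧
      Nonempty (openStar (comp g 4 k) c ≃ₜ openStar Y F) := by
  have hg : 0 < g := by have := hc.1.1; omega
  have := finite_dualCell hg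
  have := finite_properFace (ineq g)
  have h4 := hc.2.1
  have hcM : c ∈ comp g 4 k := ⟨m, f, hc, fun h => absurd h (by decide)⟩
  set f1 := Function.update f 4 (-1) with hf1
  set f2 := Function.update f 4 1 with hf2
  have hb1 : f1 ≼ f := update_below h4 _
  have hb2 : f2 ≼ f := update_below h4 _
  -- The hyperplane separates the two sides of the face of `c` across direction `4`. It meets every
  -- face containing that face, and meets a subface exactly when the subface has direction `4`; so
  -- the stars agree.
  obtain ⟨h, hneg, hpos⟩ := exists_separating (hc.1.of_below hb1)
    (disjoint_Fc (i := 4) (hc.1.of_below hb1) (hc.1.of_below hb2) (by simp [hf1]) (by simp [hf2])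
      (by simp [hf1, hf2]))
  have hsub : ∀ e : Code, e ≼ f → ∀ s : SignType, (e 4 = s → e ≼ Function.update f 4 s) := by
    intro e he s hs i
    by_cases hi : i = 4
    · subst hi; right; simpa using hs
    · simpa [hi] using he i
  obtain ⟨y, hy, hyt⟩ := exists_tight_eq hc.1.1 f1
  obtain ⟨z, hz, hzt⟩ := exists_tight_eq hc.1.1 f2
  have hy1 : h y < 0 := hneg y ⟨hy, hyt.ge⟩
  have hz1 : 0 < h z := hpos z ⟨hz, hzt.ge⟩
  -- the faces comparable to the face of `c`
  have hup : ∀ F : ProperFace (poly (ineq g)), c.face ⊆ F.1 → F ∈ sectionFaces (ineq g) h ∧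
      ∃ a ∈ comp g 4 k, a.face = F.1 := by
    rintro ⟨F, hF⟩ hcF
    obtain ⟨n, f', hf', rfl⟩ := (isFace_ne_iff hg).1 hF
    have hcF' := hcF
    simp only [hc.2.2.1] at hcF'
    constructor
    · refine properFc_mem_sectionFaces hf' (hcF' ?_) (hcF' ?_) hy1 hz1
      · exact (Fc_subset_iff hc.1).2 hb1 ⟨hy, hyt.ge⟩
      · exact (Fc_subset_iff hc.1).2 hb2 ⟨hz, hzt.ge⟩
    · obtain ⟨e, he, hs⟩ := exists_code_of_subset hf' hc.1.1 hcF'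
      have h0 : f' 4 = 0 := he.apply_eq_zero ((hs.apply_eq_zero 4).1 h4)
      exact ⟨cell hf' h0, ⟨n, f', isCell_cell hf' h0, fun h => absurd h (by decide)⟩, rfl⟩
  have hdown : ∀ F : ProperFace (poly (ineq g)), F.1 ⊆ c.face → (F ∈ sectionFaces (ineq g) h ↔
      ∃ a ∈ comp g 4 k, a.face = F.1) := by
    rintro ⟨F, hF⟩ hcF
    obtain ⟨n, f', hf', rfl⟩ := (isFace_ne_iff hg).1 hF
    simp only [hc.2.2.1] at hcF
    obtain ⟨e, he, hs⟩ := exists_code_of_subset hc.1 hf'.1 hcF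
    have hec := hc.1.of_below he
    constructor
    · intro hmem
      obtain ⟨x, hx, hx0⟩ := exists_zero_of_mem_sectionFaces hmem
      change x ∈ Fc g n f' at hx
      rw [hs.Fc_eq g] at hx
      have h0 : e 4 = 0 := by
        by_contra h0
        rcases sign_cases h0 with h1 | h1
        · have := hpos x ((Fc_subset_iff (hc.1.of_below hb2)).2 (hsub e he 1 h1) hx)
          linarith
        · have := hneg x ((Fc_subset_iff (hc.1.of_below hb1)).2 (hsub e he (-1) h1) hx)
          linarith
      exact ⟨cell hec h0, ⟨m, e, isCell_cell hec h0, fun h => absurd h (by decide)⟩,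
        (hs.Fc_eq g).symm⟩
    · rintro ⟨a, ⟨n', f'', ha, -⟩, haF⟩
      simp only [ha.2.2.1] at haF
      have h0 : e 4 = 0 := by
        rw [← hs.apply_eq_zero 4, ← ((Fc_eq_iff ha.1 hf').1 haF).apply_eq_zero 4]
        exact ha.2.1
      obtain ⟨v, hv, hvd⟩ := exists_vert h0 (show (-1 : SignType) ≠ 0 by decide)
      obtain ⟨w, hw, hwd⟩ := exists_vert h0 (show (1 : SignType) ≠ 0 by decide)
      refine properFc_mem_sectionFaces hf' (y := vpt m v) (z := vpt m w) ?_ ?_ ?_ ?_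
      · rw [hs.Fc_eq g]; exact vpt_mem_Fc hc.1.1 hv
      · rw [hs.Fc_eq g]; exact vpt_mem_Fc hc.1.1 hw
      · exact hneg _ (vpt_mem_Fc hc.1.1 ⟨hv.1, hsub v (hv.2.trans he) _ hvd⟩)
      · exact hpos _ (vpt_mem_Fc hc.1.1 ⟨hw.1, hsub w (hw.2.trans he) _ hwd⟩)
  let pf : DualCell (poly (ineq g)) → ProperFace (poly (ineq g)) := fun a =>
    ⟨a.face, a.isFace, a.proper⟩
  have hle : ∀ a ∈ comp g 4 k, ∀ b ∈ comp g 4 k, a ≤ b ↔ pf a ≤ pf b := fun a ha b hb =>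
    comp_le_iff_face ha hb
  let ψ : starSet (comp g 4 k) c → starSet (sectionFaces (ineq g) h) (pf c) := fun a =>
    ⟨pf a.1, by
      obtain ⟨a, ha, hac⟩ := a
      rcases hac with hac | hac
      · exact ⟨(hdown (pf a) hac.1).2 ⟨a, ha, rfl⟩, Or.inl hac.1⟩
      · exact ⟨(hup (pf a) hac.1).1, Or.inr hac.1⟩⟩
  have hψ : Function.Surjective ψ := by
    rintro ⟨F, hF, hFc⟩
    rcases hFc with hFc | hFc
    · obtain ⟨a, ha, haF⟩ := (hdown F hFc).1 hF
      have e : pf a = F := Subtype.ext haF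
      subst e
      exact ⟨⟨a, ha, Or.inl ((hle a ha c hcM).2 hFc)⟩, rfl⟩
    · obtain ⟨-, a, ha, haF⟩ := hup F hFc
      have e : pf a = F := Subtype.ext haF
      subst e
      exact ⟨⟨a, ha, Or.inr ((hle c hcM a ha).2 hFc)⟩, rfl⟩
  obtain ⟨e, he⟩ := orderIso_of_surjective (φ := (id : starSet (comp g 4 k) c → _)) (ψ := ψ)
    Function.surjective_id hψ fun a b => hle a.1 a.2.1 b.1 b.2.1
  refine ⟨sectionFaces (ineq g) h, pf c, sectionFaces_ineq_sphere hg hy hz hy1 hz1,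
    openStar_congr e ⟨hcM, Or.inl le_rfl⟩ ?_⟩
  have := he ⟨c, hcM, Or.inl le_rfl⟩
  exact congrArg Subtype.val this

lemma isClosedSurface_comp {g k : ℕ} (hk : k < g) : IsClosedSurface (realization (comp g 4 k)) := by
  have hg : 0 < g := by omega
  have := finite_dualCell hg
  obtain ⟨c, hc⟩ := comp_nonempty hk 4
  refine ⟨inferInstance, isCompact_iff_compactSpace.1 (isCompact_ordReal (comp g 4 k)), ?_, ?_⟩
  · have := isPathConnected_ordReal hc (fun a b h => comp_le_iff hg h) fun b hb => eqvGen_comp hc hb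
    exact isConnected_iff_connectedSpace.1 this.isConnected
  · intro w
    have hw := w.2
    obtain ⟨a, ha⟩ : ∃ a, (w : DualCell (poly (ineq g)) → ℝ) a ≠ 0 := by
      by_contra hn
      push Not at hn
      have h1 := hw.2.2.2.2
      simp [hn] at h1
    obtain ⟨m, f, hf, -⟩ := hw.2.2.1 ha
    -- A point lies in the open star of every cell that has positive weight, and that star is an
    -- open piece of a sphere.
    obtain ⟨Y, F, hY, hstar⟩ := exists_star_congr (k := k) hf
    exact exists_open_homeomorph_of_sphere hY (isOpen_openStar (comp g 4 k) a) (isOpen_openStar Y F)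
      hstar (lt_of_le_of_ne (hw.1 a) ha.symm)

end Surface

/-! ### An explicit coherent orientation of the direction `4` component -/

section Orientation

/-- The orientation of the triangles that depends on the smallest cell. -/
def signEdge (f : Code) : ℤˣ :=
  (if f 0 = 1 then 1 else -1) * (if f 1 = 1 then 1 else -1) * (if f 2 = 1 then 1 else -1) *
    (if f 3 = 1 then 1 else -1)

/-- The orientation of the triangles that depends on the middle cell. -/
def signSquare (f : Code) : ℤˣ := if f 0 = 0 ∨ f 1 = 0 then 1 else -1

/-- The orientation of the triangles that depends on the largest cell. -/
def signCube (f : Code) : ℤˣ := (if f 1 = 0 then -1 else 1) * (if f 3 = 0 then -1 else 1)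

/-- A facet of a face is obtained by fixing one coordinate. -/
lemma exists_update {f f' : Code} (h : f ≼ f') (hr : rank f' = rank f + 1) :
    ∃ i, f' i = 0 ∧ f i ≠ 0 ∧ f = Function.update f' i (f i) ∧ f' = Function.update f i 0 := by
  obtain ⟨i, hi, hi'⟩ : ∃ i, f' i = 0 ∧ f i ≠ 0 := by
    by_contra hn
    push Not at hn
    have := rank_eq_of_zeros (e := f) (e' := f') fun i => ⟨fun h' => h.apply_eq_zero h', hn i⟩
    omega
  have hle : Function.update f i 0 ≼ f' := fun j => by
    by_cases hj : j = i
    · subst hj; exact Or.inl hi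
    · simpa [hj] using h j
  have he : f' = Function.update f i 0 :=
    (hle.eq_of_rank_le (by rw [rank_update_zero hi', hr])).symm
  refine ⟨i, hi, hi', ?_, he⟩
  rw [he]; simp

/-- Besides `4` a square has one free coordinate, and its two edges of direction `4` differ in the
sign there; `signEdge` is a product of such signs. -/
lemma signEdge_update : ∀ f : Code, (rank f = 2 ∧ f 4 = 0) → ∀ i i', i ≠ 4 → i' ≠ 4 → f i = 0 →
    f i' = 0 → i = i' ∧ signEdge (Function.update f i 1) = -signEdge (Function.update f i (-1)) := by
  refine forall_code ?_
  decide +kernel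

-- A facet of direction `4` leaves free one coordinate among `0, 1` and one among `2, 3`. The two
-- squares differ in which of these pairs contains the remaining free coordinate, and `signSquare`
-- records the pair.
set_option synthInstance.maxSize 1000 in
set_option synthInstance.maxHeartbeats 200000 in
lemma signSquare_update : ∀ f : Code, (FacetCode f ∧ f 4 = 0) → ∀ i i', i ≠ 4 → i' ≠ 4 → i ≠ i' →
    f i = 0 → f i' = 0 → ∀ s s' : SignType, s ≠ 0 → s' ≠ 0 →
    signSquare (Function.update f i' s') = -signSquare (Function.update f i s) := by
  refine forall_code ?_
  decide +kernel

/-- If the square has a free coordinate in one of the pairs `0, 1` and `2, 3`, the facets above it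
free one of the two coordinates of the other pair; exactly one choice involves `1` or `3`. -/
lemma signCube_update : ∀ f : Code, (rank f = 2 ∧ f 4 = 0) → ∀ j j', j ≠ j' → f j ≠ 0 → f j' ≠ 0 →
    Valid (Function.update f j 0) → Valid (Function.update f j' 0) →
    signCube (Function.update f j' 0) = -signCube (Function.update f j 0) := by
  refine forall_code ?_
  decide +kernel

/-- Across a glued wall, the facets on the two sides free the same coordinate `0` or `2`, so this
factor agrees. The change of sign comes from `signEdge_flip`. -/
lemma signCube_update_flip : ∀ f : Code, (rank f = 2 ∧ f 4 = 0 ∧ f ≼ topW) → ∀ j j', f j ≠ 0 →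
    f j' ≠ 0 → Valid (Function.update f j 0) → Valid (Function.update f j' 0) →
    Function.update f j 0 ≠ topW → Function.update (flip f) j' 0 ≠ botW →
    signCube (Function.update (flip f) j' 0) = signCube (Function.update f j 0) := by
  refine forall_code ?_
  decide +kernel

lemma signEdge_flip {f : Code} (h : f 0 ≠ 0) : signEdge (flip f) = -signEdge f := by
  have e : ∀ i : Fin 5, i ≠ 0 → flip f i = f i := fun i hi => flip_apply_ne f hi
  have e0 : ∀ s : SignType, s ≠ 0 →
      (if -s = 1 then 1 else -1 : ℤˣ) = -(if s = 1 then 1 else -1) := by decide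
  unfold signEdge
  rw [flip_apply_zero, e 1 (by decide), e 2 (by decide), e 3 (by decide), e0 _ h, neg_mul, neg_mul,
    neg_mul]

lemma signSquare_flip (f : Code) : signSquare (flip f) = signSquare f := by
  unfold signSquare
  simp only [flip_apply_eq_zero]

/-- The codes of a triangle in one copy. -/
structure IsTriangleCode (g k : ℕ) (fa fb fc : Code) (a b c : DualCell (poly (ineq g))) : Prop where
  cellA : IsCell a k fa 4
  cellB : IsCell b k fb 4
  cellC : IsCell c k fc 4
  belowAB : fa ≼ fb
  belowBC : fb ≼ fc
  rankA : rank fa = 1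
  rankB : rank fb = 2
  rankC : rank fc = 3

lemma rank_pos {f : Code} {d : Fin 5} (h : f d = 0) : 0 < rank f :=
  Finset.card_pos.2 ⟨d, by simpa using h⟩

lemma exists_isTriangleCode {g k : ℕ} {a b c : DualCell (poly (ineq g))}
    (h : IsTriangle (comp g 4 k) a b c) : ∃ m fa fb fc, IsTriangleCode g m fa fb fc a b c := by
  obtain ⟨⟨_, _, ha, -⟩, ⟨_, _, hb, -⟩, ⟨m, fc, hc, -⟩, hab, hbc⟩ := h
  obtain ⟨fb, hbc', -, hb'⟩ := hb.exists_below hc hbc.le.1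
  obtain ⟨fa, hab', -, ha'⟩ := ha.exists_below hb' hab.le.1
  have lt_rank : ∀ {x y : DualCell (poly (ineq g))} {e e' : Code}, IsCell x m e 4 → IsCell y m e' 4 →
      x < y → e ≼ e' → rank e < rank e' := by
    intro x y e e' hx hy hxy hle
    by_contra hn
    have := hle.eq_of_rank_le (by omega)
    subst this
    exact hxy.ne (hx.eq_cell.trans hy.eq_cell.symm)
  have h1 := lt_rank ha' hb' hab hab'
  have h2 := lt_rank hb' hc hbc hbc'
  have h3 := rank_pos ha'.2.1
  have h4 := rank_le_three hc.1.2.1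
  exact ⟨m, fa, fb, fc, ha', hb', hc, hab', hbc', by omega, by omega, by omega⟩

/-- Two codes could arise only from a glued wall, which is not a facet of the chain. Hence the
largest cell fixes the copy in which a triangle is coded, and `orient` does not depend on the
choices. -/
lemma IsCell.facet_unique {g m m' : ℕ} {fc fc' : Code} {c : DualCell (poly (ineq g))}
    (h : IsCell c m fc 4) (h' : IsCell c m' fc' 4) (hr : rank fc = 3) : m = m' ∧ fc = fc' := by
  have hfc : FacetCode fc := ⟨h.1.2.1, hr⟩
  rcases h.sameFace h' with h1 | ⟨rfl, h1, rfl⟩ | ⟨rfl, h1, rfl⟩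
  · exact h1
  · have e := facetCode_eq hfc facetCode_topW.1 h1
    have := h.1.2.2.2 e.symm
    have := h'.1.1
    omega
  · have e := facetCode_eq hfc facetCode_botW.1 h1
    have := h.1.2.2.1 e.symm
    omega

lemma IsCell.code_eq {g m : ℕ} {f f' : Code} {c : DualCell (poly (ineq g))}
    (h : IsCell c m f 4) (h' : IsCell c m f' 4) : f = f' :=
  Fc_injective h.1 h'.1 (h.2.2.1.symm.trans h'.2.2.1)

open Classical in
/-- The orientation of the triangles of the component of direction `4`. -/
noncomputable def orient {g : ℕ} (a b c : DualCell (poly (ineq g))) : ℤˣ :=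
  if h : ∃ m fa fb fc, IsTriangleCode g m fa fb fc a b c then
    signEdge h.choose_spec.choose * signSquare h.choose_spec.choose_spec.choose *
      signCube h.choose_spec.choose_spec.choose_spec.choose
  else 1

lemma orient_eq {g m : ℕ} {fa fb fc : Code} {a b c : DualCell (poly (ineq g))}
    (h : IsTriangleCode g m fa fb fc a b c) :
    orient a b c = signEdge fa * signSquare fb * signCube fc := by
  have hex : ∃ m fa fb fc, IsTriangleCode g m fa fb fc a b c := ⟨m, fa, fb, fc, h⟩
  rw [orient, dif_pos hex]
  have hs := hex.choose_spec.choose_spec.choose_spec.choose_spec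
  set m' := hex.choose
  set fa' := hex.choose_spec.choose
  set fb' := hex.choose_spec.choose_spec.choose
  set fc' := hex.choose_spec.choose_spec.choose_spec.choose
  obtain ⟨e1, e2⟩ := IsCell.facet_unique h.cellC hs.cellC h.rankC
  have ha := h.cellA
  have hb := h.cellB
  rw [e1] at ha hb
  rw [IsCell.code_eq ha hs.cellA, IsCell.code_eq hb hs.cellB, e2]

lemma isOrientable_comp {g : ℕ} (k : ℕ) : IsOrientable (comp g 4 k) := by
  refine ⟨orient, fun a a' b c h h' hne => ?_, fun a b b' c h h' hne => ?_,
    fun a b c c' h h' hne => ?_⟩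
  · obtain ⟨m, fa, fb, fc, h⟩ := exists_isTriangleCode h
    obtain ⟨m', fa', fb', fc', h'⟩ := exists_isTriangleCode h'
    obtain ⟨rfl, rfl⟩ := IsCell.facet_unique h.cellC h'.cellC h.rankC
    obtain rfl := IsCell.code_eq h.cellB h'.cellB
    rw [orient_eq h, orient_eq h']
    have hfa : fa ≠ fa' := by
      rintro rfl
      exact hne (h.cellA.eq_cell.trans h'.cellA.eq_cell.symm)
    obtain ⟨i, hi, hai, e, -⟩ := exists_update h.belowAB (by rw [h.rankA, h.rankB])
    obtain ⟨i', hi', hai', e', -⟩ := exists_update h'.belowAB (by rw [h'.rankA, h.rankB])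
    have hi4 : i ≠ 4 := fun h4 => hai (h4 ▸ h.cellA.2.1)
    have hi4' : i' ≠ 4 := fun h4 => hai' (h4 ▸ h'.cellA.2.1)
    obtain ⟨rfl, hs⟩ := signEdge_update fb ⟨h.rankB, h.cellB.2.1⟩ i i' hi4 hi4' hi hi'
    have : signEdge fa' = -signEdge fa := by
      rw [e, e']
      rcases sign_cases hai with h1 | h1 <;> rcases sign_cases hai' with h2 | h2
      · exact absurd (by rw [e, e', h1, h2]) hfa
      · rw [h1, h2, hs, neg_neg]
      · rw [h1, h2, hs]
      · exact absurd (by rw [e, e', h1, h2]) hfa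
    rw [this, neg_mul, neg_mul]
  · obtain ⟨m, fa, fb, fc, h⟩ := exists_isTriangleCode h
    obtain ⟨m', fa', fb', fc', h'⟩ := exists_isTriangleCode h'
    obtain ⟨rfl, rfl⟩ := IsCell.facet_unique h.cellC h'.cellC h.rankC
    obtain rfl := IsCell.code_eq h.cellA h'.cellA
    rw [orient_eq h, orient_eq h']
    have hfb : fb ≠ fb' := by
      rintro rfl
      exact hne (h.cellB.eq_cell.trans h'.cellB.eq_cell.symm)
    obtain ⟨i, hi, hbi, e, -⟩ := exists_update h.belowBC (by rw [h.rankB, h.rankC])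
    obtain ⟨i', hi', hbi', e', -⟩ := exists_update h'.belowBC (by rw [h'.rankB, h.rankC])
    have hi4 : i ≠ 4 := fun h4 => hbi (h4 ▸ h.cellB.2.1)
    have hi4' : i' ≠ 4 := fun h4 => hbi' (h4 ▸ h'.cellB.2.1)
    have hii : i ≠ i' := by
      rintro rfl
      refine hfb ?_
      rw [e, e', ← h.belowAB.apply_ne_zero hbi, ← h'.belowAB.apply_ne_zero hbi']
    have : signSquare fb' = -signSquare fb := by
      rw [e, e']
      exact signSquare_update fc ⟨⟨h.cellC.1.2.1, h.rankC⟩, h.cellC.2.1⟩ i i' hi4 hi4' hii hi hi' _ _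
        hbi hbi'
    rw [this, mul_neg, neg_mul]
  · obtain ⟨m, fa, fb, fc, h⟩ := exists_isTriangleCode h
    obtain ⟨m', fa', fb', fc', h'⟩ := exists_isTriangleCode h'
    rw [orient_eq h, orient_eq h']
    -- the two squares lie in consecutive copies
    have glue : ∀ {m : ℕ} {fa fb fc fa' fb' fc' : Code} {a b c c' : DualCell (poly (ineq g))},
        IsTriangleCode g m fa fb fc a b c → IsTriangleCode g (m + 1) fa' fb' fc' a b c' →
        fb ≼ topW → fb' = flip fb →
        signEdge fa' * signSquare fb' * signCube fc' =
          -(signEdge fa * signSquare fb * signCube fc) := by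
      intro m fa fb fc fa' fb' fc' a b c c' h h' ht hfb
      subst hfb
      have hta := h.belowAB.trans ht
      have hfa : flip fa = fa' := IsCell.code_eq (h.cellA.of_sameFace
        (isFaceCode_of_rank h'.cellA.1.1 h.cellA.1.2.1.flip (by rw [rank_flip, h.rankA]; decide))
        (Or.inr (Or.inl ⟨rfl, hta, rfl⟩))) h'.cellA
      obtain ⟨j, -, hbj, -, e⟩ := exists_update h.belowBC (by rw [h.rankB, h.rankC])
      obtain ⟨j', -, hbj', -, e'⟩ := exists_update h'.belowBC (by rw [h'.rankB, h'.rankC])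
      have hm := h'.cellA.1.1
      have h1 : fc ≠ topW := fun e => by have := h.cellC.1.2.2.2 e; omega
      have h2 : fc' ≠ botW := fun e => by have := h'.cellC.1.2.2.1 e; omega
      have h3 : Valid fc := h.cellC.1.2.1
      have h4 : Valid (flip fc') := h'.cellC.1.2.1.flip
      have h5 : flip fc' = Function.update fb j' 0 := by
        rw [e']
        by_cases h0 : j' = 0
        · subst h0; simp [flip]
        · funext i
          by_cases hi : i = 0
          · subst hi
            simp [flip_apply_zero, Ne.symm h0]
          · rw [flip_apply_ne _ hi]
            by_cases hij : i = j'
            · subst hij; simp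
            · simp [hij, flip_apply_ne _ hi]
      rw [e] at h1 h3
      rw [e'] at h2
      rw [h5] at h4
      have key := signCube_update_flip fb ⟨h.rankB, h.cellB.2.1, ht⟩ j j' hbj
        (fun h0 => hbj' ((flip_apply_eq_zero _ _).2 h0)) h3 h4 h1 h2
      have h0 : fa 0 ≠ 0 := by rw [(below_topW_iff.1 hta).1]; decide
      rw [← hfa, signEdge_flip h0, signSquare_flip, e', key, ← e, neg_mul, neg_mul]
    rcases h.cellB.sameFace h'.cellB with ⟨rfl, rfl⟩ | ⟨rfl, ht, hfb⟩ | ⟨rfl, hb, hfb⟩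
    · obtain rfl := IsCell.code_eq h.cellA h'.cellA
      obtain ⟨j, -, hbj, -, e⟩ := exists_update h.belowBC (by rw [h.rankB, h.rankC])
      obtain ⟨j', -, hbj', -, e'⟩ := exists_update h'.belowBC (by rw [h'.rankB, h'.rankC])
      have hjj : j ≠ j' := by
        rintro rfl
        have hfc : fc = fc' := e.trans e'.symm
        subst hfc
        exact hne (h.cellC.eq_cell.trans h'.cellC.eq_cell.symm)
      have h3 : Valid fc := h.cellC.1.2.1
      have h4 : Valid fc' := h'.cellC.1.2.1
      rw [e] at h3
      rw [e'] at h4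
      rw [e, e', signCube_update fb ⟨h.rankB, h.cellB.2.1⟩ j j' hjj hbj hbj' h3 h4, mul_neg]
    · exact glue h h' ht hfb
    · have := glue h' h (by rw [hfb]; exact flip_below_topW.2 hb) (by rw [hfb, flip_flip])
      rw [this, neg_neg]

end Orientation

/-! ### An affinely regular facet that avoids the surface -/

section RegularFacet

/-- The code of an affinely regular facet. -/
def regularCode : Code := ![0, 0, 1, 0, -1]

lemma facetCode_regularCode : FacetCode regularCode := by decide

lemma isFaceCode_regularCode {g : ℕ} (hg : 0 < g) : IsFaceCode g 0 regularCode :=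
  ⟨hg, facetCode_regularCode.1, fun e => absurd e (by decide), fun e => absurd e (by decide)⟩

/-- On this facet `x 2 = 2` and `x 4 = 1`, so `size` is constantly one and the projective chart is
affine there. The facet stays a box with half-lengths `1, 1, 2`. -/
lemma vpt_regular {v : Code} (hv : v ∈ verts regularCode) :
    vpt 0 v = !₂[(v 0 : ℝ), 1, v 1, 2 * v 3] := by
  have h2 : v 2 = 1 := hv.2.apply_ne_zero (i := 2) (by decide)
  have h4 : v 4 = -1 := hv.2.apply_ne_zero (i := 4) (by decide)
  ext i
  unfold vpt
  rw [pow_zero, boost_one]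
  fin_cases i <;> simp [hvert, scale, size, h2, h4] <;> norm_num
  ring

/-- The parametrization of the affinely regular facet. -/
noncomputable def regularMap : (Fin 3 → ℝ) →ᵃ[ℝ] E4 where
  toFun u := !₂[u 0, 1, u 1, 2 * u 2]
  linear :=
    { toFun := fun u => !₂[u 0, 0, u 1, 2 * u 2]
      map_add' := fun u w => by ext i; fin_cases i <;> simp ; ring
      map_smul' := fun t u => by ext i; fin_cases i <;> simp ; ring }
  map_vadd' u w := by ext i; fin_cases i <;> simp ; ring

lemma regularMap_apply (u : Fin 3 → ℝ) : regularMap u = !₂[u 0, 1, u 1, 2 * u 2] := rfl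

lemma isAffinelyRegularCube_regular {g : ℕ} (hg : 0 < g) :
    IsAffinelyRegularCube (Fc g 0 regularCode) := by
  refine ⟨regularMap.comp (WithLp.linearEquiv 2 ℝ (Fin 3 → ℝ)).toLinearMap.toAffineMap, ?_, ?_⟩
  · intro u w h
    have h' : regularMap (WithLp.ofLp u) = regularMap (WithLp.ofLp w) := h
    rw [regularMap_apply, regularMap_apply] at h'
    have e := fun i : Fin 4 => congrArg (fun x : E4 => x i) h'
    ext i
    fin_cases i
    · simpa using e 0
    · simpa using e 2
    · simpa using e 3
  · have hcube : stdCube 3 = (WithLp.ofLp) ⁻¹' (convexHull ℝ (univ.pi fun _ : Fin 3 => {(-1 : ℝ), 1})) := by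
      ext u
      rw [convexHull_pi]
      simp only [convexHull_pair, segment_eq_Icc (show (-1 : ℝ) ≤ 1 by norm_num), mem_preimage,
        mem_pi, mem_univ, true_imp_iff, mem_Icc]
      rfl
    have himg : (regularMap.comp (WithLp.linearEquiv 2 ℝ (Fin 3 → ℝ)).toLinearMap.toAffineMap) ''
        stdCube 3 = regularMap '' convexHull ℝ (univ.pi fun _ : Fin 3 => {(-1 : ℝ), 1}) := by
      rw [hcube]
      ext x
      constructor
      · rintro ⟨u, hu, rfl⟩
        exact ⟨_, hu, rfl⟩
      · rintro ⟨u, hu, rfl⟩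
        exact ⟨WithLp.toLp 2 u, hu, rfl⟩
    rw [himg, AffineMap.image_convexHull, Fc_eq_convexHull (isFaceCode_regularCode hg)]
    congr 1
    ext x
    constructor
    · rintro ⟨u, hu, rfl⟩
      have hs : ∀ i, ∃ s : SignType, s ≠ 0 ∧ u i = s := fun i => by
        rcases hu i trivial with h | h
        · exact ⟨-1, by decide, by simpa using h⟩
        · exact ⟨1, by decide, by simpa using h⟩
      choose s hs0 hs using hs
      have hv : (![s 0, s 1, 1, s 2, -1] : Code) ∈ verts regularCode := by
        constructor
        · intro i
          fin_cases i <;> simp [hs0]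
        · intro i
          fin_cases i
          · exact Or.inl rfl
          · exact Or.inl rfl
          · exact Or.inr rfl
          · exact Or.inl rfl
          · exact Or.inr rfl
      refine ⟨_, hv, ?_⟩
      rw [vpt_regular hv, regularMap_apply, hs, hs, hs]
      rfl
    · rintro ⟨v, hv, rfl⟩
      refine ⟨![v 0, v 1, v 3], fun i _ => ?_, ?_⟩
      · have key : ∀ s : SignType, s ≠ 0 → (s : ℝ) ∈ ({-1, 1} : Set ℝ) := fun s hs => by
          rcases sign_cases hs with rfl | rfl <;> simp
        fin_cases i
        · exact key _ (hv.1 0)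
        · exact key _ (hv.1 1)
        · exact key _ (hv.1 3)
      · rw [vpt_regular hv, regularMap_apply]
        rfl

/-- The regular facet does not meet the component of direction `4`. -/
lemma disjoint_regular {g : ℕ} (hg : 0 < g) (k : ℕ) :
    Disjoint (Fc g 0 regularCode) (range (canonicalMap (comp g 4 k))) := by
  have := finite_dualCell hg
  have := Fintype.ofFinite (DualCell (poly (ineq g)))
  rw [Set.disjoint_left]
  rintro _ hx ⟨w, rfl⟩
  let J : FacetIndex g := ⟨(⟨0, hg⟩, regularCode), facetCode_regularCode,
    fun _ => rfl, fun e => absurd e (show regularCode ≠ topW by decide)⟩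
  have hJ : ineq g J (canonicalMap (comp g 4 k) w) = 0 := hx.2 (Or.inl ⟨rfl, Below.refl _⟩ : J ∈ _)
  -- A face of direction `4` leaves the last coordinate free and so does not lie in this facet,
  -- which fixes it. All barycenters used by the immersion are therefore strictly inside the
  -- inequality.
  have hneg : ∀ c ∈ comp g 4 k, ineq g J (barycenter c.face) < 0 := by
    rintro c ⟨m, f, hc, -⟩
    obtain ⟨h1, h2⟩ := barycenter_Fc hc.1
    rw [hc.2.2.1]
    refine lt_of_le_of_ne (h1 J) fun h0 => ?_
    have hmem : J ∈ facetsOf g m f := h2 ▸ h0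
    have h4 := hc.2.1
    have hr : regularCode 4 ≠ 0 := by decide
    rcases hmem with ⟨-, h⟩ | ⟨-, -, h⟩ | ⟨-, -, h⟩
    · exact hr (h.apply_eq_zero h4)
    · exact hr (h.apply_eq_zero ((flip_apply_eq_zero _ _).2 h4))
    · exact hr (h.apply_eq_zero ((flip_apply_eq_zero _ _).2 h4))
  obtain ⟨h1, h2, -, h4⟩ := mem_ordReal.1 w.2
  rw [canonicalMap_eq, affine_sum _ _ _ _ h4] at hJ
  have hnp : ∀ c ∈ (Finset.univ : Finset (DualCell (poly (ineq g)))),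
      (w : DualCell (poly (ineq g)) → ℝ) c * ineq g J (barycenter c.face) ≤ 0 := fun c _ => by
    by_cases hc : (w : DualCell (poly (ineq g)) → ℝ) c = 0
    · rw [hc, zero_mul]
    · exact mul_nonpos_of_nonneg_of_nonpos (h1 c) (hneg c (h2 c hc)).le
  rw [Finset.sum_eq_zero_iff_of_nonpos hnp] at hJ
  have hall : ∀ c, (w : DualCell (poly (ineq g)) → ℝ) c = 0 := fun c => by
    by_contra hc
    exact (mul_ne_zero hc (hneg c (h2 c hc)).ne) (hJ c (Finset.mem_univ c))
  simp [hall] at h4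

end RegularFacet

end CubicalPolytope

/-! ### Assembly -/

theorem mainTheorem9 (g : ℕ) (hg : 0 < g) :
    ∃ P : Set (EuclideanSpace ℝ (Fin 4)),
      CubicalPolytope.IsCubicalPolytope 4 P ∧
      (CubicalPolytope.fNum P 0 = 24 * g + 8 ∧ CubicalPolytope.fNum P 1 = 68 * g + 12 ∧
        CubicalPolytope.fNum P 2 = 66 * g + 6 ∧ CubicalPolytope.fNum P 3 = 22 * g + 2) ∧
      ∃ M : Set (CubicalPolytope.DualCell P),
        CubicalPolytope.IsDualManifold P M ∧
        CubicalPolytope.IsEmbeddedDual M ∧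
        CubicalPolytope.IsOrientableSurfaceOfGenus g M ∧
        (CubicalPolytope.dualFNum M 0 = 12 * g + 4 ∧ CubicalPolytope.dualFNum M 1 = 28 * g + 4 ∧
          CubicalPolytope.dualFNum M 2 = 14 * g + 2) ∧
        (∀ M' : Set (CubicalPolytope.DualCell P), CubicalPolytope.IsDualManifold P M' →
          CubicalPolytope.IsEmbeddedDual M' →
          CubicalPolytope.IsOrientableSurfaceOfGenus g M' → M' = M) ∧
        (∀ M' : Set (CubicalPolytope.DualCell P), CubicalPolytope.IsDualManifold P M' → M' ≠ M →
          CubicalPolytope.IsEmbeddedDual M' ∧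
          CubicalPolytope.IsTwoSphere (CubicalPolytope.realization M')) ∧
        ∃ F : Set (EuclideanSpace ℝ (Fin 4)),
          CubicalPolytope.IsFace P F ∧ CubicalPolytope.dim F = 3 ∧
          Disjoint F (Set.range (CubicalPolytope.canonicalMap M)) ∧
          CubicalPolytope.IsAffinelyRegularCube F := by
  have hM : ∀ (d : Fin 5) (k : ℕ), k < g →
      CubicalPolytope.comp g d k ≠ CubicalPolytope.comp g 4 0 → d ≠ 4 := by
    rintro d k - hne rfl
    exact hne (CubicalPolytope.comp_eq_of_ne (by decide))
  refine ⟨CubicalPolytope.poly (CubicalPolytope.ineq g), CubicalPolytope.isCubicalPolytope_chain hg,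
    CubicalPolytope.fVector_chain hg, CubicalPolytope.comp g 4 0,
    (CubicalPolytope.isDualManifold_iff hg).2 ⟨4, 0, hg, rfl⟩,
    CubicalPolytope.isEmbeddedDual_comp hg 4 0,
    ⟨CubicalPolytope.isClosedSurface_comp hg, CubicalPolytope.isOrientable_comp 0,
      CubicalPolytope.eulerChar_comp_four hg⟩,
    CubicalPolytope.fVector_comp_four hg, fun M' hM' _ hgenus => ?_, fun M' hM' hne => ?_,
    CubicalPolytope.Fc g 0 CubicalPolytope.regularCode,
    CubicalPolytope.isFace_Fc (CubicalPolytope.isFaceCode_regularCode hg), ?_,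
    CubicalPolytope.disjoint_regular hg 0, CubicalPolytope.isAffinelyRegularCube_regular hg⟩
  · obtain ⟨d, k, hk, rfl⟩ := (CubicalPolytope.isDualManifold_iff hg).1 hM'
    by_contra hne
    have h1 := hgenus.2.2
    rw [CubicalPolytope.eulerChar_comp hk (hM d k hk hne)] at h1
    -- The Euler characteristic `2` would force `g = 0`.
    omega
  · obtain ⟨d, k, hk, rfl⟩ := (CubicalPolytope.isDualManifold_iff hg).1 hM'
    exact ⟨CubicalPolytope.isEmbeddedDual_comp hg d k,
      CubicalPolytope.isTwoSphere_comp hk (hM d k hk hne)⟩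
  · rw [CubicalPolytope.dim_Fc (CubicalPolytope.isFaceCode_regularCode hg)]
    decide
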